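/- Let $n\ge 3$ and let $F$ be an infinite field of characteristic $\neq 2$ which is an NFT-field, i.e. the torsion subgroup $T$ of $F^\times$ is finite. Write $\equiv$ for elementary equivalence (of groups in the language of groups, of fields in the language of rings), and write $T(M)$ for the torsion subgroup of an abelian group $M$. An *addition* of a group $G$ is a subgroup $G_0\le Z(G)$ with $Z(G)=T(Z(G))\times G_0$; the quotient $G/G_0$ is the corresponding *foundation* of $G$. Let $L$ be an NFT-field, $L^\times=T(L^\times)\times A$, let $K_0$ be an addition of $K=GL_n(L)$ and $K_f=K/K_0$ the corresponding foundation. The determinant followed by the projection $L^\times\to A\to A/A^n$ induces a homomorphism $K_f\to A/A^n$, $x\mapsto\bar x$; it is trivial on the image in $K_f$ of $\{g\in K: g^m\in SL_n(L)\text{ for some } m\ge 1\}$ and sends the class of $\mathrm{diag}(\alpha,1,\dots,1)$ to the class of $\alpha$. For an abelian group $B\equiv A$ and a (normalized) symmetric 2-cocycle $h\in S^2(A/A^n,B)$, the *abelian deformation* $GL_n(L,h,B)$ is the central extension $$1\to B\to GL_n(L,h,B)\to K_f\to 1$$ with underlying set $B\times K_f$ and multiplication $(b_1,x_1)(b_2,x_2)=(b_1b_2\,h(\bar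 x_1,\bar x_2),\,x_1x_2)$. **Theorem.** Let $H$ be a group with $H\equiv GL_n(F)$. Then there are an NFT-field $L\equiv F$, a decomposition $L^\times=T(L^\times)\times A$, an addition $K_0$ of $GL_n(L)$, an addition $B$ of $H$ with $B\equiv F^\times/T$ and $B\equiv A$, and a symmetric 2-cocycle $h\in S^2(A/A^n,B)$, such that $H\cong GL_n(L,h,B)$, by an isomorphism that sends each $b\in B$ to $(b,1)$. -/

import Mathlib

open FirstOrder

universe u v

/-! ### Elementary equivalence of groups and of fields -/

/-- Function symbols of the language of groups: multiplication, inversion, identity. -/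
inductive GroupFunc : ℕ → Type
  | mul : GroupFunc 2
  | inv : GroupFunc 1
  | one : GroupFunc 0

/-- The first-order language of groups `(·, ⁻¹, 1)`. -/
def groupLanguage : FirstOrder.Language where
  Functions := GroupFunc
  Relations := fun _ => Empty

/-- A group as a structure in the language of groups. -/
@[reducible]
def groupStructure (G : Type*) [Group G] : groupLanguage.Structure G where
  funMap := fun {k} f =>
    match k, f with
    | _, .mul => fun x => x 0 * x 1
    | _, .inv => fun x => (x 0)⁻¹
    | _, .one => fun _ => 1
  RelMap := fun r => nomatch r

/-- Elementary equivalence of groups. -/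
def GroupElemEquiv (G H : Type*) [Group G] [Group H] : Prop :=
  letI := groupStructure G
  letI := groupStructure H
  G ≅[groupLanguage] H

/-- Elementary equivalence of fields, in the language of rings. -/
def FieldElemEquiv (K L : Type*) [Field K] [Field L] : Prop :=
  letI := FirstOrder.Ring.compatibleRingOfRing K
  letI := FirstOrder.Ring.compatibleRingOfRing L
  K ≅[FirstOrder.Language.ring] L

/-! ### NFT-fields and torsion complements -/

/-- `F` is a field of number field type: the torsion subgroup of `Fˣ` is finite. -/
def IsNFT (F : Type*) [Field F] : Prop := Finite (CommGroup.torsion Fˣ)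

/-- A direct complement of the torsion subgroup of an abelian group `M`:
a subgroup `A` with `M = T(M) × A` (internal direct product). -/
structure TorsionComplement (M : Type*) [CommGroup M] where
  carrier : Subgroup M
  isCompl : IsCompl (CommGroup.torsion M) carrier

namespace TorsionComplement

variable {M : Type*} [CommGroup M] (A : TorsionComplement M)

theorem bijective_mk :
    Function.Bijective
      ((QuotientGroup.mk' (CommGroup.torsion M)).comp A.carrier.subtype) := by
  constructor
  · rw [injective_iff_map_eq_one]
    intro a ha
    have h1 : (a : M) ∈ CommGroup.torsion M := (QuotientGroup.eq_one_iff (a : M)).1 ha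
    exact Subtype.ext (Subgroup.disjoint_def.1 A.isCompl.disjoint h1 a.2)
  · intro q
    obtain ⟨x, rfl⟩ := QuotientGroup.mk_surjective q
    have hx : x ∈ CommGroup.torsion M ⊔ A.carrier := by
      rw [A.isCompl.sup_eq_top]; trivial
    obtain ⟨t, ht, a, ha, rfl⟩ := Subgroup.mem_sup.1 hx
    refine ⟨⟨a, ha⟩, ?_⟩
    change (QuotientGroup.mk a : M ⧸ CommGroup.torsion M) = QuotientGroup.mk (t * a)
    rw [QuotientGroup.eq]
    have : a⁻¹ * (t * a) = t := by rw [mul_comm t a, inv_mul_cancel_left]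
    rwa [this]

/-- The projection of `M = T(M) × A` onto the factor `A`. -/
noncomputable def proj : M →* A.carrier :=
  (MulEquiv.ofBijective _ A.bijective_mk).symm.toMonoidHom.comp
    (QuotientGroup.mk' (CommGroup.torsion M))

theorem proj_coe (a : A.carrier) : A.proj a = a :=
  (MulEquiv.ofBijective _ A.bijective_mk).symm_apply_apply a

theorem proj_of_isOfFinOrder {x : M} (hx : IsOfFinOrder x) : A.proj x = 1 := by
  have h1 : (QuotientGroup.mk' (CommGroup.torsion M)) x = 1 :=
    (QuotientGroup.eq_one_iff x).2 hx
  rw [proj, MonoidHom.comp_apply, h1, map_one]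

/-- The quotient `A / A ^ n` by the subgroup of `n`-th powers. -/
abbrev ModPow (n : ℕ) : Type _ :=
  A.carrier ⧸ (powMonoidHom n : A.carrier →* A.carrier).range

/-- The composite `M = T(M) × A → A → A / A ^ n`. -/
noncomputable def toModPow (n : ℕ) : M →* A.ModPow n :=
  (QuotientGroup.mk' _).comp A.proj

theorem toModPow_pow (n : ℕ) (x : M) : A.toModPow n (x ^ n) = 1 := by
  change (QuotientGroup.mk (A.proj (x ^ n)) : A.ModPow n) = 1
  rw [QuotientGroup.eq_one_iff, map_pow]
  exact ⟨A.proj x, rfl⟩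

theorem toModPow_of_isOfFinOrder (n : ℕ) {x : M} (hx : IsOfFinOrder x) :
    A.toModPow n x = 1 := by
  simp [toModPow, A.proj_of_isOfFinOrder hx]

end TorsionComplement

/-! ### Additions and foundations of a group -/

instance centerCommGroup (G : Type*) [Group G] : CommGroup (Subgroup.center G) :=
  { (inferInstance : Group (Subgroup.center G)) with
    mul_comm := fun a b => Subtype.ext (Subgroup.mem_center_iff.1 b.2 a) }

/-- An addition of a group `G`: a direct complement of the torsion subgroup in the center. -/
abbrev Addition (G : Type*) [Group G] : Type _ := TorsionComplement (Subgroup.center G)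

/-- An addition of `G`, regarded as a subgroup of `G`. -/
def Addition.toSubgroup {G : Type*} [Group G] (G₀ : Addition G) : Subgroup G :=
  (TorsionComplement.carrier G₀).map (Subgroup.center G).subtype

theorem Addition.mem_center {G : Type*} [Group G] (G₀ : Addition G) {x : G}
    (hx : x ∈ Addition.toSubgroup G₀) : x ∈ Subgroup.center G := by
  obtain ⟨z, -, rfl⟩ := hx
  exact z.2

instance Addition.normal {G : Type*} [Group G] (G₀ : Addition G) :
    (Addition.toSubgroup G₀).Normal where
  conj_mem x hx g := by
    have := Subgroup.mem_center_iff.1 (Addition.mem_center G₀ hx) g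
    rw [this, mul_inv_cancel_right]
    exact hx

/-- The foundation `G / G₀` of `G` with respect to the addition `G₀`. -/
abbrev Foundation {G : Type*} [Group G] (G₀ : Addition G) : Type _ :=
  G ⧸ Addition.toSubgroup G₀

/-! ### Symmetric 2-cocycles -/

/-- The set `S²(Q, B)` of (normalized) symmetric 2-cocycles of abelian groups. -/
structure SymmCocycle (Q B : Type*) [CommGroup Q] [CommGroup B] where
  toFun : Q → Q → B
  cocycle : ∀ x y z, toFun (x * y) z * toFun x y = toFun x (y * z) * toFun y z
  one_left : ∀ x, toFun 1 x = 1
  one_right : ∀ x, toFun x 1 = 1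
  symm : ∀ x y, toFun x y = toFun y x

/-! ### Abelian deformations of `GL n L` -/

section Deformation

variable {n : ℕ} {L : Type*} [Field L]

theorem det_of_mem_center {g : GL (Fin n) L} (hg : g ∈ Subgroup.center (GL (Fin n) L)) :
    ∃ a : Lˣ, Matrix.GeneralLinearGroup.det g = a ^ n := by
  rw [Matrix.GeneralLinearGroup.center_eq_range_scalar] at hg
  obtain ⟨a, rfl⟩ := hg
  refine ⟨a, Units.ext ?_⟩
  simp

variable (A : TorsionComplement Lˣ) (K₀ : Addition (GL (Fin n) L))

/-- The homomorphism `K_f → A / A ^ n` from a foundation `K_f = K / K₀` of `K = GL n L`,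
induced by `det : K → Lˣ = T(L) × A`. It kills the image `H₁` of the isolator of `SL n L`
and sends the class of `diag(α, 1, …, 1)` to the class of `α`
(`foundationClass_of_pow`, `foundationClass_diagonal` below); so it sends `c * a`, with `c ∈ H₁`
and `a` the class of `diag(α, 1, …, 1)`, to the class of `α`. -/
noncomputable def foundationClass : Foundation K₀ →* A.ModPow n :=
  QuotientGroup.lift (Addition.toSubgroup K₀)
    ((A.toModPow n).comp Matrix.GeneralLinearGroup.det) (by
      intro g hg
      obtain ⟨a, ha⟩ := det_of_mem_center (Addition.mem_center K₀ hg)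
      rw [MonoidHom.mem_ker, MonoidHom.comp_apply, ha, A.toModPow_pow])

theorem foundationClass_of_pow (g : GL (Fin n) L) (m : ℕ) (hm : 0 < m)
    (hg : Matrix.GeneralLinearGroup.det (g ^ m) = 1) :
    foundationClass A K₀ (QuotientGroup.mk g) = 1 := by
  change A.toModPow n (Matrix.GeneralLinearGroup.det g) = 1
  apply A.toModPow_of_isOfFinOrder
  rw [isOfFinOrder_iff_pow_eq_one]
  exact ⟨m, hm, by rw [← map_pow, hg]⟩

theorem foundationClass_diagonal (g : GL (Fin n) L) (i : Fin n) (α : Lˣ)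
    (hg : (g : Matrix (Fin n) (Fin n) L) = Matrix.diagonal (Pi.mulSingle i (α : L))) :
    foundationClass A K₀ (QuotientGroup.mk g) = A.toModPow n α := by
  change A.toModPow n (Matrix.GeneralLinearGroup.det g) = _
  congr 1
  ext
  rw [Matrix.GeneralLinearGroup.val_det_apply, hg, Matrix.det_diagonal, Finset.prod_pi_mulSingle']
  simp

variable (B : Type*) [CommGroup B] (h : SymmCocycle (A.ModPow n) B)

/-- The abelian deformation `GL n (L, h, B)`: the set of pairs `(b, x)` with `b ∈ B` and `x` in
the foundation `K_f` of `K = GL n L` given by the addition `K₀`. -/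
@[ext]
structure AbelianDeformation (A : TorsionComplement Lˣ) (K₀ : Addition (GL (Fin n) L))
    (B : Type*) [CommGroup B] (h : SymmCocycle (A.ModPow n) B) where
  fst : B
  snd : Foundation K₀

namespace AbelianDeformation

variable {A K₀ B h}

/-- `(b₁, x₁) (b₂, x₂) = (b₁ b₂ h(x̄₁, x̄₂), x₁ x₂)`, where `x̄` is the class of `x` in
`A / A ^ n`. -/
noncomputable instance : Mul (AbelianDeformation A K₀ B h) where
  mul x y := ⟨x.fst * y.fst * h.toFun (foundationClass A K₀ x.snd) (foundationClass A K₀ y.snd),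
    x.snd * y.snd⟩

noncomputable instance : One (AbelianDeformation A K₀ B h) where
  one := ⟨1, 1⟩

noncomputable instance : Inv (AbelianDeformation A K₀ B h) where
  inv x := ⟨(x.fst * h.toFun (foundationClass A K₀ x.snd⁻¹) (foundationClass A K₀ x.snd))⁻¹,
    x.snd⁻¹⟩

theorem mul_def (x y : AbelianDeformation A K₀ B h) :
    x * y = ⟨x.fst * y.fst *
      h.toFun (foundationClass A K₀ x.snd) (foundationClass A K₀ y.snd), x.snd * y.snd⟩ := rfl

theorem one_def : (1 : AbelianDeformation A K₀ B h) = ⟨1, 1⟩ := rfl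

theorem inv_def (x : AbelianDeformation A K₀ B h) :
    x⁻¹ = ⟨(x.fst * h.toFun (foundationClass A K₀ x.snd⁻¹) (foundationClass A K₀ x.snd))⁻¹,
      x.snd⁻¹⟩ := rfl

noncomputable instance : Group (AbelianDeformation A K₀ B h) :=
  Group.ofLeftAxioms
    (by
      intro x y z
      ext
      · simp only [mul_def, map_mul]
        have := h.cocycle (foundationClass A K₀ x.snd) (foundationClass A K₀ y.snd)
          (foundationClass A K₀ z.snd)
        calc x.fst * y.fst * h.toFun _ _ * z.fst * h.toFun _ _
            = x.fst * y.fst * z.fst * (h.toFun (foundationClass A K₀ x.snd *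
                foundationClass A K₀ y.snd) (foundationClass A K₀ z.snd) *
                h.toFun (foundationClass A K₀ x.snd) (foundationClass A K₀ y.snd)) := by
              rw [mul_right_comm (x.fst * y.fst), mul_assoc (x.fst * y.fst * z.fst),
                mul_comm (h.toFun _ _)]
          _ = _ := by
              rw [this, mul_comm (h.toFun _ (_ * _))]
              simp only [mul_assoc]
      · simp only [mul_def, mul_assoc])
    (by
      intro x
      ext
      · simp [mul_def, one_def, h.one_left]
      · simp [mul_def, one_def])
    (by
      intro x
      ext
      · simp [mul_def, one_def, inv_def]
      · simp [mul_def, one_def, inv_def])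

/-- The embedding `b ↦ (b, 1)` of `B` in the central extension
`1 → B → GL n (L, h, B) → K_f → 1`. -/
noncomputable def inl : B →* AbelianDeformation A K₀ B h where
  toFun b := ⟨b, 1⟩
  map_one' := rfl
  map_mul' b c := by
    ext
    · simp [mul_def, h.one_left]
    · simp [mul_def]

/-- The projection `(b, x) ↦ x` in the central extension
`1 → B → GL n (L, h, B) → K_f → 1`. -/
def toFoundation : AbelianDeformation A K₀ B h →* Foundation K₀ where
  toFun x := x.snd
  map_one' := rfl
  map_mul' _ _ := rfl

theorem inl_mem_center (b : B) :
    inl b ∈ Subgroup.center (AbelianDeformation A K₀ B h) := by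
  rw [Subgroup.mem_center_iff]
  intro x
  ext
  · simp [mul_def, inl, h.one_left, h.one_right, mul_comm]
  · simp [mul_def, inl]

theorem inl_injective : Function.Injective (inl : B →* AbelianDeformation A K₀ B h) :=
  fun _ _ hbc => congrArg fst hbc

theorem toFoundation_surjective :
    Function.Surjective (toFoundation : AbelianDeformation A K₀ B h →* Foundation K₀) :=
  fun x => ⟨⟨1, x⟩, rfl⟩

theorem ker_toFoundation :
    (toFoundation : AbelianDeformation A K₀ B h →* Foundation K₀).ker = inl.range := by
  ext x
  constructor
  · intro hx
    exact ⟨x.fst, by ext; exacts [rfl, (MonoidHom.mem_ker.1 hx).symm]⟩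
  · rintro ⟨b, rfl⟩
    rfl

end AbelianDeformation

end Deformation

/-! By Frayne's theorem `H` embeds elementarily in `GL n R` for an ultrapower `R` of `F`
(`exists_groupElementary_GL`). So `H` becomes a concrete group of matrices with a strong closure
property: a condition definable in `GL n R` with parameters from `H` has a solution in `H` as soon
as it has one at all, and a unique solution lies in `H`.

This recovers a field. A family of `2 ^ n` distinct commuting elements of `H` with square 1 can be
conjugated to the family of all diagonal sign matrices. These make the diagonal group definable, and
then also the root subgroups, as squares of elements inverted by a reflection. After one more
diagonal conjugation all transvections with coefficient 1 lie in `H` (`exists_isStandard`).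
Commutators multiply coefficients, so the coefficients of the transvections in `H` form a field `L`.
Its operations are words in a root subgroup, so `L` is elementary in `R`
(`IsStandard.fieldElementary_subtype`), and `L ≡ R ≡ F`.

Inside `GL n R` the groups `H` and `GL n L` agree up to scalars
(`IsCoefficientMap.exists_eq_scalar_mul`, `IsCoefficientMap.exists_scalar_mul_map_mem`). Scalars
cancel in commutators, and every root of unity of `R` is both in `L` and, as a scalar, in `H`; so
`H` contains all matrices over `L` whose determinant is torsion
(`IsCoefficientMap.map_mem_of_isOfFinOrder_det`). The scalars of `H` and those of `L` need not
coincide otherwise, and this is the room for a deformation.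

A single retraction `π` of `Rˣ` onto its torsion subgroup cuts out compatible complements `A`, `K₀`
and `B`. A matrix `g` over `L` is corrected by a scalar that depends on the `A`-part of `det g`: its
class modulo `A ^ n`, and an `n`-th root of the rest. The corrected matrix lies in `H`, depends only
on the class of `g` modulo `K₀`, and is multiplicative up to scalars in `B` which depend
symmetrically on the classes of the determinants. These scalars are the cocycle
(`exists_mulEquiv_abelianDeformation`).

Finally, if `N` is the order of the torsion subgroup, the `N`-th power map identifies `ker π` with a
definable group of `N`-th powers, both in `R` and in the centre of `GL n R`. Interpretation gives `A
≡ ker π ≡ B`, and likewise for the complement in `Fˣ` (the two lemmas `groupElemEquiv_ker`). -/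

namespace FirstOrder.Language

/-! ### Definability with parameters from a smaller structure -/

section DefinableOver

variable {L : Language} {M N S : Type*} [L.Structure N] {β γ : Type*}

/-- A family `t` of elements of `N`, indexed by the valuations `β → S`, is given by a term of `L`
with parameters from the image of `j : M → N`; elements of `S` are read in `N` through `e`. -/
def TermOver (L : Language) {M N S : Type*} [L.Structure N] (j : M → N) (e : S → N)
    {β : Type*} (t : (β → S) → N) : Prop :=
  ∃ τ : L.Term (M ⊕ β), ∀ s, τ.realize (Sum.elim j (e ∘ s)) = t s

/-- A predicate on valuations `β → S` is given by a formula of `L` with parameters from the image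
of `j : M → N`; elements of `S` are read in `N` through `e`. -/
def DefinableOver (L : Language) {M N S : Type*} [L.Structure N] (j : M → N) (e : S → N)
    {β : Type*} (P : (β → S) → Prop) : Prop :=
  ∃ φ : L.Formula (M ⊕ β), ∀ s, φ.Realize (Sum.elim j (e ∘ s)) ↔ P s

variable {j : M → N} {e : S → N}

theorem TermOver.var (b : β) : TermOver L j e fun s => e (s b) :=
  ⟨Term.var (Sum.inr b), fun _ => rfl⟩

theorem TermOver.param (m : M) : TermOver L j e fun _ : β → S => j m :=
  ⟨Term.var (Sum.inl m), fun _ => rfl⟩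

theorem TermOver.funMap {n : ℕ} (f : L.Functions n) {t : Fin n → (β → S) → N}
    (h : ∀ i, TermOver L j e (t i)) :
    TermOver L j e fun s => Structure.funMap f fun i => t i s := by
  choose τ hτ using h
  refine ⟨Term.func f τ, fun s => ?_⟩
  simp only [Term.realize, hτ]

namespace DefinableOver

theorem congr {P Q : (β → S) → Prop} (h : DefinableOver L j e P) (hPQ : ∀ s, P s ↔ Q s) :
    DefinableOver L j e Q := by
  obtain ⟨φ, hφ⟩ := h
  exact ⟨φ, fun s => (hφ s).trans (hPQ s)⟩

theorem eq {t₁ t₂ : (β → S) → N} (h₁ : TermOver L j e t₁) (h₂ : TermOver L j e t₂) :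
    DefinableOver L j e fun s => t₁ s = t₂ s := by
  obtain ⟨τ₁, h₁⟩ := h₁
  obtain ⟨τ₂, h₂⟩ := h₂
  exact ⟨τ₁.equal τ₂, fun s => by simp only [Formula.realize_equal, h₁, h₂]⟩

theorem not {P : (β → S) → Prop} (h : DefinableOver L j e P) :
    DefinableOver L j e fun s => ¬ P s := by
  obtain ⟨φ, hφ⟩ := h
  exact ⟨φ.not, fun s => by simp only [Formula.realize_not, hφ]⟩

theorem imp {P Q : (β → S) → Prop} (h₁ : DefinableOver L j e P) (h₂ : DefinableOver L j e Q) :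
    DefinableOver L j e fun s => P s → Q s := by
  obtain ⟨φ, hφ⟩ := h₁
  obtain ⟨ψ, hψ⟩ := h₂
  exact ⟨φ.imp ψ, fun s => by simp only [Formula.realize_imp, hφ, hψ]⟩

theorem and {P Q : (β → S) → Prop} (h₁ : DefinableOver L j e P) (h₂ : DefinableOver L j e Q) :
    DefinableOver L j e fun s => P s ∧ Q s := by
  obtain ⟨φ, hφ⟩ := h₁
  obtain ⟨ψ, hψ⟩ := h₂
  exact ⟨φ ⊓ ψ, fun s => by simp only [Formula.realize_inf, hφ, hψ]⟩

theorem forall_finite {ι : Type*} [Finite ι] {P : ι → (β → S) → Prop}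
    (h : ∀ i, DefinableOver L j e (P i)) : DefinableOver L j e fun s => ∀ i, P i s := by
  choose φ hφ using h
  exact ⟨Formula.iInf φ, fun s => by simp only [Formula.realize_iInf, hφ]⟩

theorem const (p : Prop) : DefinableOver L j e fun _ : β → S => p := by
  by_cases hp : p
  · exact ⟨⊤, fun s => by simp [hp]⟩
  · exact ⟨⊥, fun s => by simp [hp]⟩

/-- Substitution of terms in a definable predicate. -/
theorem subst {P : (β → N) → Prop} (h : DefinableOver L j id P) {t : β → (γ → S) → N}
    (ht : ∀ b, TermOver L j e (t b)) : DefinableOver L j e fun s => P fun b => t b s := by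
  obtain ⟨φ, hφ⟩ := h
  choose τ hτ using ht
  refine ⟨BoundedFormula.subst φ (Sum.elim (fun m => Term.var (Sum.inl m)) τ), fun s => ?_⟩
  refine Iff.trans ?_ (hφ _)
  rw [Formula.Realize, BoundedFormula.realize_subst, Formula.Realize]
  apply iff_of_eq
  congr 1
  funext x
  rcases x with m | b
  · rfl
  · exact hτ b s

theorem exists_family [Finite γ] {P : (β → N) → (γ → N) → Prop}
    (h : DefinableOver L j id fun w : β ⊕ γ → N => P (w ∘ Sum.inl) (w ∘ Sum.inr)) :
    DefinableOver L j id fun v => ∃ g, P v g := by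
  obtain ⟨φ, hφ⟩ := h
  refine ⟨Formula.iExs γ (φ.relabel (Sum.elim (Sum.inl ∘ Sum.inl)
    (Sum.elim (Sum.inl ∘ Sum.inr) Sum.inr))), fun v => ?_⟩
  rw [Formula.realize_iExs]
  refine exists_congr fun g => ?_
  rw [Formula.realize_relabel]
  refine (iff_of_eq ?_).trans (hφ (Sum.elim v g))
  congr 1
  funext x
  rcases x with m | b | c <;> rfl

theorem exists_elem {P : (β → N) → N → Prop}
    (h : DefinableOver L j id fun w : β ⊕ Unit → N => P (w ∘ Sum.inl) (w (Sum.inr ()))) :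
    DefinableOver L j id fun v => ∃ x, P v x :=
  (exists_family (P := fun v g => P v (g ())) h).congr fun _ =>
    ⟨fun ⟨g, hg⟩ => ⟨g (), hg⟩, fun ⟨x, hx⟩ => ⟨fun _ => x, hx⟩⟩

theorem forall_elem {P : (β → N) → N → Prop}
    (h : DefinableOver L j id fun w : β ⊕ Unit → N => P (w ∘ Sum.inl) (w (Sum.inr ()))) :
    DefinableOver L j id fun v => ∀ x, P v x :=
  (exists_elem (P := fun v x => ¬ P v x) h.not).not.congr fun _ => by simp

/-- Elementary embeddings reflect the solvability of definable conditions. -/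
theorem exists_of_exists [L.Structure M] (f : M ↪ₑ[L] N) [Finite β] {P : (β → N) → Prop}
    (h : DefinableOver L f id P) (hP : ∃ v, P v) : ∃ w : β → M, P (f ∘ w) := by
  obtain ⟨φ, hφ⟩ := h
  obtain ⟨v, hv⟩ := hP
  have h1 : (φ.iExs β).Realize (f ∘ id) :=
    Formula.realize_iExs.2 ⟨v, (hφ v).2 hv⟩
  rw [f.map_formula, Formula.realize_iExs] at h1
  obtain ⟨w, hw⟩ := h1
  refine ⟨w, (hφ _).1 ?_⟩
  rw [← f.map_formula] at hw
  refine (iff_of_eq ?_).1 hw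
  congr 1
  funext x
  rcases x with m | b <;> rfl

theorem exists_of_exists_elem [L.Structure M] (f : M ↪ₑ[L] N) {P : N → Prop}
    (h : DefinableOver L f id fun v : Unit → N => P (v ())) (hP : ∃ x, P x) : ∃ m, P (f m) := by
  obtain ⟨x, hx⟩ := hP
  obtain ⟨w, hw⟩ := exists_of_exists f h ⟨fun _ => x, hx⟩
  exact ⟨w (), hw⟩

/-- Quantification over a set interpreted by a definable range. -/
theorem exists_interpreted [Finite γ]
    (hr : DefinableOver L j id fun w : Unit → N => w () ∈ Set.range e)
    {P : (β → S) → (γ → S) → Prop}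
    (h : DefinableOver L j e fun w : β ⊕ γ → S => P (w ∘ Sum.inl) (w ∘ Sum.inr)) :
    DefinableOver L j e fun v => ∃ g, P v g := by
  obtain ⟨φ, hφ⟩ := h
  have h1 : DefinableOver L j id fun w : β ⊕ γ → N =>
      (∀ c, w (Sum.inr c) ∈ Set.range e) ∧ φ.Realize (Sum.elim j w) :=
    .and (.forall_finite fun c => hr.subst (t := fun _ w => w (Sum.inr c)) fun _ => .var _)
      ⟨φ, fun _ => Iff.rfl⟩
  obtain ⟨ψ, hψ⟩ := exists_family
    (P := fun v g => (∀ c, g c ∈ Set.range e) ∧ φ.Realize (Sum.elim j (Sum.elim v g)))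
    (h1.congr fun w => by simp)
  refine ⟨ψ, fun s => (hψ (e ∘ s)).trans ⟨?_, ?_⟩⟩
  · rintro ⟨g, hg, hφg⟩
    choose g' hg' using hg
    obtain rfl : e ∘ g' = g := funext hg'
    refine ⟨g', (hφ (Sum.elim s g')).1 ?_⟩
    rwa [Sum.comp_elim]
  · rintro ⟨g, hg⟩
    refine ⟨e ∘ g, fun c => ⟨g c, rfl⟩, ?_⟩
    rw [← Sum.comp_elim]
    exact (hφ (Sum.elim s g)).2 hg

end DefinableOver

end DefinableOver

/-! ### Interpretations -/

section Interpretation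

variable {L L' : Language} {M N S A : Type*} [L.Structure N] [L'.Structure S] {j : M → N}
  {e : S → N}

/-- Only the graphs of the operations are assumed definable, so a composite term is unfolded by
quantifying over the values of its subterms, which range over the definable set `Set.range e`. -/
theorem definableOver_term_eq (he : Function.Injective e)
    (hr : DefinableOver L j id fun w : Unit → N => w () ∈ Set.range e)
    (hfun : ∀ (n : ℕ) (g : L'.Functions n), DefinableOver L j e
      fun s : Fin n ⊕ Unit → S => Structure.funMap g (s ∘ Sum.inl) = s (Sum.inr ()))
    {β : Type*} (t : L'.Term β) :
    DefinableOver L j e fun s : β ⊕ Unit → S => t.realize (s ∘ Sum.inl) = s (Sum.inr ()) := by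
  induction t with
  | var b =>
    exact (DefinableOver.eq (.var (Sum.inl b)) (.var (Sum.inr ()))).congr fun s => he.eq_iff
  | @func n g ts ih =>
    have h1 : DefinableOver L j e fun w : (β ⊕ Unit) ⊕ Fin n → S =>
        (∀ i, (ts i).realize (fun b => w (Sum.inl (Sum.inl b))) = w (Sum.inr i)) ∧
          Structure.funMap g (fun i => w (Sum.inr i)) = w (Sum.inl (Sum.inr ())) := by
      refine .and (.forall_finite fun i => ?_) ?_
      · obtain ⟨φ, hφ⟩ := ih i
        refine ⟨φ.relabel (Sum.map id (Sum.elim (fun b => Sum.inl (Sum.inl b))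
          fun _ => Sum.inr i)), fun s => ?_⟩
        rw [Formula.realize_relabel]
        refine (iff_of_eq ?_).trans (hφ (Sum.elim (fun b => s (Sum.inl (Sum.inl b)))
          fun _ => s (Sum.inr i)))
        congr 1
        funext x
        rcases x with m | b | c <;> rfl
      · obtain ⟨φ, hφ⟩ := hfun n g
        refine ⟨φ.relabel (Sum.map id (Sum.elim (fun b => Sum.inr b)
          fun _ => Sum.inl (Sum.inr ()))), fun s => ?_⟩
        rw [Formula.realize_relabel]
        refine (iff_of_eq ?_).trans (hφ (Sum.elim (fun b => s (Sum.inr b))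
          fun _ => s (Sum.inl (Sum.inr ()))))
        congr 1
        funext x
        rcases x with m | b | c <;> rfl
    refine (DefinableOver.exists_interpreted hr (P := fun s y =>
      (∀ i, (ts i).realize (s ∘ Sum.inl) = y i) ∧ Structure.funMap g y = s (Sum.inr ()))
      h1).congr fun s => ?_
    constructor
    · rintro ⟨y, hy, hg⟩
      rw [Term.realize, ← hg]
      congr 1
      funext i
      exact hy i
    · intro h
      exact ⟨fun i => (ts i).realize (s ∘ Sum.inl), fun _ => rfl, h⟩

/-- Formulas of the interpreted structure translate by induction: atomic formulas are equations of
terms, and a quantifier over `S` becomes a quantifier over the definable range of `e`. -/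
theorem definableOver_boundedFormula [L'.IsAlgebraic] (he : Function.Injective e)
    (hr : DefinableOver L j id fun w : Unit → N => w () ∈ Set.range e)
    (hfun : ∀ (n : ℕ) (g : L'.Functions n), DefinableOver L j e
      fun s : Fin n ⊕ Unit → S => Structure.funMap g (s ∘ Sum.inl) = s (Sum.inr ()))
    {α : Type*} {n : ℕ} (φ : L'.BoundedFormula α n) :
    DefinableOver L j e fun s : α ⊕ Fin n → S => φ.Realize (s ∘ Sum.inl) (s ∘ Sum.inr) := by
  induction φ with
  | falsum => exact .const False
  | @equal n t₁ t₂ =>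
    have h1 : DefinableOver L j e fun w : (α ⊕ Fin n) ⊕ Unit → S =>
        t₁.realize (w ∘ Sum.inl) = w (Sum.inr ()) ∧ t₂.realize (w ∘ Sum.inl) = w (Sum.inr ()) :=
      .and (definableOver_term_eq he hr hfun t₁) (definableOver_term_eq he hr hfun t₂)
    refine (DefinableOver.exists_interpreted hr (P := fun s (y : Unit → S) =>
      t₁.realize s = y () ∧ t₂.realize s = y ()) h1).congr fun s => ?_
    rw [BoundedFormula.Realize, ← Sum.comp_elim, Sum.elim_inl_inr, Function.comp_id]
    exact ⟨fun ⟨y, h₁, h₂⟩ => h₁.trans h₂.symm, fun h => ⟨fun _ => t₁.realize s, rfl, h.symm⟩⟩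
  | rel R => exact isEmptyElim R
  | imp _ _ ih₁ ih₂ => exact ih₁.imp ih₂
  | @all n φ ih =>
    have h1 : DefinableOver L j e fun w : (α ⊕ Fin n) ⊕ Unit → S =>
        ¬ φ.Realize (fun a => w (Sum.inl (Sum.inl a)))
          (Fin.snoc (fun i => w (Sum.inl (Sum.inr i))) (w (Sum.inr ()))) := by
      obtain ⟨ψ, hψ⟩ := ih.not
      refine ⟨ψ.relabel (Sum.map id (Sum.elim (fun a => Sum.inl (Sum.inl a))
        (Fin.snoc (fun i => Sum.inl (Sum.inr i)) (Sum.inr ())))), fun w => ?_⟩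
      rw [Formula.realize_relabel]
      refine (iff_of_eq ?_).trans (hψ (Sum.elim (fun a => w (Sum.inl (Sum.inl a)))
          (Fin.snoc (fun i => w (Sum.inl (Sum.inr i))) (w (Sum.inr ())))))
      congr 1
      funext x
      rcases x with m | a | i
      · rfl
      · rfl
      · refine Fin.lastCases ?_ (fun i => ?_) i <;> simp
    refine (DefinableOver.exists_interpreted hr (P := fun s (y : Unit → S) =>
      ¬ φ.Realize (s ∘ Sum.inl) (Fin.snoc (s ∘ Sum.inr) (y ()))) h1).not.congr fun s => ?_
    rw [BoundedFormula.realize_all]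
    push Not
    exact ⟨fun h x => h fun _ => x, fun h y => h (y ())⟩

/-- A substructure of an interpreted structure consisting of its points in an elementary
substructure is elementary. -/
theorem nonempty_elementaryEmbedding_of_interpretation [L'.IsAlgebraic] [L.Structure M]
    [L'.Structure A] (f : M ↪ₑ[L] N) (he : Function.Injective e)
    (hr : DefinableOver L f id fun w : Unit → N => w () ∈ Set.range e)
    (hfun : ∀ (n : ℕ) (g : L'.Functions n), DefinableOver L f e
      fun s : Fin n ⊕ Unit → S => Structure.funMap g (s ∘ Sum.inl) = s (Sum.inr ()))
    (k : A ↪[L'] S) (hk : ∀ a, e (k a) ∈ Set.range f)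
    (hk' : ∀ s, e s ∈ Set.range f → s ∈ Set.range k) : ∃ g : A ↪ₑ[L'] S, ⇑g = k := by
  -- Tarski–Vaught test: a solution `a` in `S` of a formula with parameters from `A` is translated
  -- to `N`, moved into `M` by elementarity of `f`, and brought back to `A` by `hk'`.
  refine ⟨k.toElementaryEmbedding fun n φ x a ha => ?_, rfl⟩
  obtain ⟨ψ, hψ⟩ := definableOver_boundedFormula (j := f) he hr hfun φ
  choose m hm using fun i => hk (x i)
  have key : ∀ b : S, ψ.Realize (Sum.elim f
        (Sum.elim isEmptyElim (Fin.snoc (f ∘ m) (e b)) : Empty ⊕ Fin (n + 1) → N)) ↔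
      φ.Realize default (Fin.snoc (k ∘ x) b : _ → S) := by
    intro b
    have := hψ (Sum.elim isEmptyElim (Fin.snoc (k ∘ x) b : _ → S))
    simp only [Sum.elim_comp_inl, Sum.elim_comp_inr] at this
    rw [Subsingleton.elim (default : Empty → S) isEmptyElim, ← this]
    apply iff_of_eq
    congr 1
    funext y
    rcases y with y | y | y
    · rfl
    · exact y.elim
    · refine Fin.lastCases ?_ (fun i => ?_) y
      · simp
      · simpa using hm i
  have h1 : DefinableOver L f id fun w : Unit → N => w () ∈ Set.range e ∧
      ψ.Realize (Sum.elim f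
        (Sum.elim isEmptyElim (Fin.snoc (f ∘ m) (w ())) : Empty ⊕ Fin (n + 1) → N)) := by
    refine hr.and ?_
    refine ((DefinableOver.subst (P := fun v => ψ.Realize (Sum.elim f v)) ⟨ψ, fun _ => Iff.rfl⟩
      (t := fun y (w : Unit → N) =>
        (Sum.elim isEmptyElim (Fin.snoc (f ∘ m) (w ())) : Empty ⊕ Fin (n + 1) → N) y)
      (e := id) ?_).congr fun _ => Iff.rfl)
    rintro (y | y)
    · exact y.elim
    · refine Fin.lastCases ?_ (fun i => ?_) y
      · simpa using TermOver.var (e := id) ()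
      · simpa using TermOver.param (m i)
  obtain ⟨c, ⟨b, hb⟩, hc⟩ := DefinableOver.exists_of_exists_elem f (P := fun x =>
    x ∈ Set.range e ∧ ψ.Realize (Sum.elim f
        (Sum.elim isEmptyElim (Fin.snoc (f ∘ m) x) : Empty ⊕ Fin (n + 1) → N))) h1
    ⟨e a, ⟨a, rfl⟩, (key a).2 ha⟩
  obtain ⟨a', rfl⟩ := hk' b ⟨c, hb.symm⟩
  exact ⟨a', (key _).1 (hb ▸ hc)⟩

end Interpretation

/-! ### Ultrapowers -/

section Ultrapower

variable {L : Language.{0, 0}} {M M' I : Type*} {N : Type v} [L.Structure M] [L.Structure N]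
  [L.Structure M'] [Nonempty M]

/-- **Łoś's theorem** for a structure presented as an ultrapower. -/
theorem realize_iff_eventually_of_ultrapower (U : Ultrafilter I) (p : (I → M) → M')
    (hp : Function.Surjective p) (hpeq : ∀ x y, p x = p y ↔ ∀ᶠ i in U, x i = y i)
    (hfun : ∀ (n : ℕ) (f : L.Functions n) (x : Fin n → I → M),
      Structure.funMap f (fun k => p (x k)) = p fun i => Structure.funMap f fun k => x k i)
    (hrel : ∀ (n : ℕ) (r : L.Relations n) (x : Fin n → I → M),
      Structure.RelMap r (fun k => p (x k)) ↔ ∀ᶠ i in U, Structure.RelMap r fun k => x k i)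
    {β : Type*} (φ : L.Formula β) (x : β → I → M) :
    φ.Realize (fun b => p (x b)) ↔ ∀ᶠ i in U, φ.Realize fun b => x b i := by
  let q : (U : Filter I).Product (fun _ => M) → M' :=
    Quotient.lift p fun x y hxy => (hpeq x y).2 hxy
  have hq : Function.Bijective q := by
    constructor
    · intro x y
      induction x using Quotient.inductionOn
      induction y using Quotient.inductionOn
      intro hxy
      exact Quotient.sound ((hpeq _ _).1 hxy)
    · intro y
      obtain ⟨x, rfl⟩ := hp y
      exact ⟨Quotient.mk _ x, rfl⟩
  let E : (U : Filter I).Product (fun _ => M) ≃[L] M' :=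
    { Equiv.ofBijective q hq with
      map_fun' := fun {n} f x => by
        choose y hy using fun k => Quotient.exists_rep (x k)
        obtain rfl : (fun k => Quotient.mk _ (y k)) = x := funext hy
        change q _ = Structure.funMap f fun k => p (y k)
        rw [hfun]
        exact congrArg q (Ultraproduct.funMap_cast f y)
      map_rel' := fun {n} r x => by
        choose y hy using fun k => Quotient.exists_rep (x k)
        obtain rfl : (fun k => Quotient.mk _ (y k)) = x := funext hy
        change Structure.RelMap r (fun k => p (y k)) ↔ _
        rw [hrel]
        exact (relMap_quotient_mk' (s := (U : Filter I).productSetoid fun _ => M) r y).symm }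
  rw [← Ultraproduct.realize_formula_cast]
  have h := StrongHomClass.realize_formula E φ
    (v := fun b => Quotient.mk (Filter.productSetoid U fun _ => M) (x b))
  exact h

/-- **Frayne's theorem**: a structure elementarily equivalent to `M` realizes its formulas along
an ultrafilter of valuations in `M`. -/
theorem exists_ultrafilter_valuation (h : N ≅[L] M) :
    ∃ (I : Type v) (U : Ultrafilter I) (a : N → I → M),
      ∀ φ : L.Formula N, φ.Realize (id : N → N) → ∀ᶠ i in U, φ.Realize fun x => a x i := by
  classical
  -- The elementary diagram of `N`. The conjunction of finitely many members is satisfiable in `M`,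
  -- because its existential closure is a sentence true in `N`.
  let D := {φ : L.Formula N // φ.Realize (id : N → N)}
  have hex : ∀ s : Finset D, ∃ a : N → M, ∀ φ ∈ s, φ.1.Realize a := by
    intro s
    let φ : L.Formula N := Formula.iInf fun d : s => d.1.1
    have hφ : φ.Realize (id : N → N) := by
      rw [Formula.realize_iInf]
      exact fun d => d.1.2
    have h1 : φ.exClosure.Realize N := by
      rw [Formula.realize_exClosure]
      exact ⟨fun x => (x : N), (BoundedFormula.realize_restrictFreeVar (φ := φ) (f := id)
        (v := fun a => (a : N)) (v' := id) fun _ => rfl).2 hφ⟩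
    have h2 : φ.exClosure.Realize M := (elementarilyEquivalent_iff.1 h _).1 h1
    obtain ⟨v, hv⟩ := (Formula.realize_exClosure φ).1 h2
    let v' : N → M := fun a => if hmem : a ∈ φ.freeVarFinset then v ⟨a, hmem⟩ else
      Classical.choice inferInstance
    have h3 : φ.Realize v' := (BoundedFormula.realize_restrictFreeVar v' (by grind)).1 hv
    rw [Formula.realize_iInf] at h3
    exact ⟨v', fun ψ hψ => h3 ⟨ψ, hψ⟩⟩
  choose a ha using hex
  -- An ultrafilter containing all tails `{s | {φ} ⊆ s}`: each formula of the diagram holds at every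
  -- index of such a tail.
  refine ⟨Finset D, Ultrafilter.of Filter.atTop, fun x s => a s x, fun φ hφ => ?_⟩
  refine Ultrafilter.of_le _ ?_
  filter_upwards [Filter.mem_atTop ({⟨φ, hφ⟩} : Finset D)] with s hs
  exact ha s ⟨φ, hφ⟩ (hs (Finset.mem_singleton_self _))

end Ultrapower

end FirstOrder.Language

/-! ### Elementary homomorphisms of groups and of fields -/

section Elementary

open FirstOrder.Language FirstOrder.Ring
open scoped commutatorElement

attribute [local instance] groupStructure
attribute [local instance] FirstOrder.Ring.compatibleRingOfRing

instance : groupLanguage.IsAlgebraic := fun _ => inferInstanceAs (IsEmpty Empty)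

/-- A homomorphism of groups which is an elementary embedding. -/
def GroupElementary {H G : Type*} [Group H] [Group G] (j : H →* G) : Prop :=
  ∃ f : H ↪ₑ[groupLanguage] G, ⇑f = j

/-- A homomorphism of fields which is an elementary embedding. -/
def FieldElementary {E R : Type*} [Field E] [Field R] (ι : E →+* R) : Prop :=
  ∃ f : E ↪ₑ[Language.ring] R, ⇑f = ι

/-- Predicates on families of elements of a group which are first-order definable with parameters
in the image of `j`. -/
abbrev GroupDefinable {M G S : Type*} [Group G] (j : M → G) (e : S → G) {β : Type*}
    (P : (β → S) → Prop) : Prop :=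
  DefinableOver groupLanguage j e P

/-- Families of group elements given by words with parameters in the image of `j`. -/
abbrev GroupTerm {M G S : Type*} [Group G] (j : M → G) (e : S → G) {β : Type*}
    (t : (β → S) → G) : Prop :=
  TermOver groupLanguage j e t

/-- Predicates on families of elements of a field which are first-order definable with parameters
in the image of `j`. -/
abbrev FieldDefinable {M R S : Type*} [Field R] (j : M → R) (e : S → R) {β : Type*}
    (P : (β → S) → Prop) : Prop :=
  DefinableOver Language.ring j e P

/-- Families of field elements given by polynomials with parameters in the image of `j`. -/
abbrev FieldTerm {M R S : Type*} [Field R] (j : M → R) (e : S → R) {β : Type*}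
    (t : (β → S) → R) : Prop :=
  TermOver Language.ring j e t

namespace GroupTerm

variable {M G S : Type*} [Group G] {j : M → G} {e : S → G} {β : Type*} {t t₁ t₂ : (β → S) → G}

theorem mul (h₁ : GroupTerm j e t₁) (h₂ : GroupTerm j e t₂) :
    GroupTerm j e fun s => t₁ s * t₂ s :=
  TermOver.funMap (L := groupLanguage) (n := 2) GroupFunc.mul (t := ![t₁, t₂]) fun i => by
    fin_cases i
    exacts [h₁, h₂]

theorem inv (h : GroupTerm j e t) : GroupTerm j e fun s => (t s)⁻¹ :=
  TermOver.funMap (L := groupLanguage) (n := 1) GroupFunc.inv (t := fun _ => t) fun _ => h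

theorem one : GroupTerm j e fun _ : β → S => (1 : G) :=
  TermOver.funMap (L := groupLanguage) (n := 0) GroupFunc.one (t := fun i => i.elim0)
    fun i => i.elim0

theorem pow (h : GroupTerm j e t) : ∀ n : ℕ, GroupTerm j e fun s => t s ^ n
  | 0 => by simpa using one
  | n + 1 => by
    simp only [pow_succ]
    exact (pow h n).mul h

theorem commutator (h₁ : GroupTerm j e t₁) (h₂ : GroupTerm j e t₂) :
    GroupTerm j e fun s => ⁅t₁ s, t₂ s⁆ :=
  ((h₁.mul h₂).mul h₁.inv).mul h₂.inv

theorem commute (h₁ : GroupTerm j e t₁) (h₂ : GroupTerm j e t₂) :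
    GroupDefinable j e fun s => Commute (t₁ s) (t₂ s) :=
  .eq (h₁.mul h₂) (h₂.mul h₁)

end GroupTerm

namespace FieldTerm

variable {M R S : Type*} [Field R] {j : M → R} {e : S → R} {β : Type*} {t t₁ t₂ : (β → S) → R}

theorem mul (h₁ : FieldTerm j e t₁) (h₂ : FieldTerm j e t₂) :
    FieldTerm j e fun s => t₁ s * t₂ s :=
  TermOver.funMap (L := Language.ring) (n := 2) ringFunc.mul (t := ![t₁, t₂]) fun i => by
    fin_cases i
    exacts [h₁, h₂]

theorem zero : FieldTerm j e fun _ : β → S => (0 : R) :=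
  TermOver.funMap (L := Language.ring) (n := 0) ringFunc.zero (t := fun i => i.elim0)
    fun i => i.elim0

theorem one : FieldTerm j e fun _ : β → S => (1 : R) :=
  TermOver.funMap (L := Language.ring) (n := 0) ringFunc.one (t := fun i => i.elim0)
    fun i => i.elim0

theorem pow (h : FieldTerm j e t) : ∀ n : ℕ, FieldTerm j e fun s => t s ^ n
  | 0 => by simpa using one
  | n + 1 => by
    simp only [pow_succ]
    exact (pow h n).mul h

end FieldTerm

theorem GroupElemEquiv.symm {G H : Type*} [Group G] [Group H] (h : GroupElemEquiv G H) :
    GroupElemEquiv H G :=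
  ElementarilyEquivalent.symm h

theorem GroupElemEquiv.trans {G H K : Type*} [Group G] [Group H] [Group K]
    (h : GroupElemEquiv G H) (h' : GroupElemEquiv H K) : GroupElemEquiv G K :=
  ElementarilyEquivalent.trans h h'

theorem FieldElemEquiv.symm {G H : Type*} [Field G] [Field H] (h : FieldElemEquiv G H) :
    FieldElemEquiv H G :=
  ElementarilyEquivalent.symm h

theorem FieldElemEquiv.trans {G H K : Type*} [Field G] [Field H] [Field K]
    (h : FieldElemEquiv G H) (h' : FieldElemEquiv H K) : FieldElemEquiv G K :=
  ElementarilyEquivalent.trans h h'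

namespace GroupElementary

variable {H G : Type*} [Group H] [Group G] {j : H →* G}

theorem groupElemEquiv (hj : GroupElementary j) : GroupElemEquiv H G := by
  obtain ⟨f, -⟩ := hj
  exact f.elementarilyEquivalent

theorem injective (hj : GroupElementary j) : Function.Injective j := by
  obtain ⟨f, hf⟩ := hj
  rw [← hf]
  exact f.injective

theorem exists_family {β : Type*} [Finite β] (hj : GroupElementary j) {P : (β → G) → Prop}
    (hP : GroupDefinable j id P) (h : ∃ v, P v) : ∃ w : β → H, P (j ∘ w) := by
  obtain ⟨f, hf⟩ := hj
  rw [← hf] at hP ⊢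
  exact hP.exists_of_exists f h

theorem exists_elem (hj : GroupElementary j) {P : G → Prop}
    (hP : GroupDefinable j id fun v : Unit → G => P (v ())) (h : ∃ x, P x) : ∃ m, P (j m) := by
  obtain ⟨f, hf⟩ := hj
  rw [← hf] at hP ⊢
  exact DefinableOver.exists_of_exists_elem f hP h

theorem mem_range_of_unique (hj : GroupElementary j) {P : G → Prop}
    (hP : GroupDefinable j id fun v : Unit → G => P (v ())) {x : G} (h : P x)
    (huniq : ∀ y, P y → y = x) : x ∈ j.range := by
  obtain ⟨m, hm⟩ := hj.exists_elem hP ⟨x, h⟩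
  exact ⟨m, huniq _ hm⟩

theorem comp_mulEquiv {G' : Type*} [Group G'] (hj : GroupElementary j) (α : G ≃* G') :
    GroupElementary (α.toMonoidHom.comp j) := by
  obtain ⟨f, hf⟩ := hj
  let E : G ≃[groupLanguage] G' :=
    { α.toEquiv with
      map_fun' := fun {n} g x => by
        cases g
        · exact map_mul α _ _
        · exact map_inv α _
        · exact map_one α
      map_rel' := fun {n} r => isEmptyElim r }
  exact ⟨E.toElementaryEmbedding.comp f, funext fun x => congrArg α (congrFun hf x)⟩

/-- Elementarity of the homomorphism of interpreted groups induced by an elementary embedding. -/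
theorem of_interpretation {L : Language} {M N A S : Type*} [L.Structure M] [L.Structure N]
    [Group A] [Group S] (f : M ↪ₑ[L] N) {e : S → N} (he : Function.Injective e)
    (hr : DefinableOver L f id fun w : Unit → N => w () ∈ Set.range e)
    (hmul : DefinableOver L f e fun s : Fin 2 ⊕ Unit → S =>
      s (Sum.inl 0) * s (Sum.inl 1) = s (Sum.inr ()))
    (k : A →* S) (hkinj : Function.Injective k) (hk : ∀ a, e (k a) ∈ Set.range f)
    (hk' : ∀ s, e s ∈ Set.range f → s ∈ Set.range k) : GroupElementary k := by
  let k' : A ↪[groupLanguage] S :=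
    { toFun := k
      inj' := hkinj
      map_fun' := fun {n} g x => by
        cases g
        · exact map_mul k _ _
        · exact map_inv k _
        · exact map_one k
      map_rel' := fun {n} r => isEmptyElim r }
  have hmul' : ∀ {γ : Type} (x y z : γ), DefinableOver L f e fun s : γ → S => s x * s y = s z := by
    intro γ x y z
    obtain ⟨φ, hφ⟩ := hmul
    refine ⟨φ.relabel (Sum.map id (Sum.elim ![x, y] fun _ => z)), fun s => ?_⟩
    rw [Formula.realize_relabel]
    refine (iff_of_eq ?_).trans (hφ (Sum.elim ![s x, s y] fun _ => s z))
    congr 1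
    funext w
    rcases w with m | b | c
    · rfl
    · fin_cases b <;> rfl
    · rfl
  -- The identity is the only idempotent of a group, so multiplication alone defines the identity
  -- and inversion.
  have hone : ∀ {γ : Type} (x : γ), DefinableOver L f e fun s : γ → S => s x = 1 := fun x =>
    (hmul' x x x).congr fun s => by simp
  refine nonempty_elementaryEmbedding_of_interpretation (L' := groupLanguage) f he hr
    (fun n g => ?_) k' hk hk'
  cases g
  · exact hmul
  · refine (DefinableOver.exists_interpreted (γ := Unit) hr
      (P := fun (s : Fin 1 ⊕ Unit → S) (y : Unit → S) =>
        s (Sum.inl 0) * s (Sum.inr ()) = y () ∧ y () = 1) ?_).congr fun s => ?_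
    · exact (hmul' (Sum.inl (Sum.inl 0)) (Sum.inl (Sum.inr ())) (Sum.inr ())).and (hone _)
    · change _ ↔ (s (Sum.inl 0))⁻¹ = _
      rw [inv_eq_iff_mul_eq_one]
      exact ⟨fun ⟨y, h1, h2⟩ => h1.trans h2, fun h => ⟨fun _ => 1, h, rfl⟩⟩
  · exact (hone (Sum.inr ())).congr fun s => eq_comm

end GroupElementary

namespace FieldElementary

variable {E R : Type*} [Field E] [Field R] {ι : E →+* R}

theorem fieldElemEquiv (hι : FieldElementary ι) : FieldElemEquiv E R := by
  obtain ⟨f, -⟩ := hι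
  exact f.elementarilyEquivalent

theorem exists_family {β : Type*} [Finite β] (hι : FieldElementary ι) {P : (β → R) → Prop}
    (hP : FieldDefinable ι id P) (h : ∃ v, P v) : ∃ w : β → E, P (ι ∘ w) := by
  obtain ⟨f, hf⟩ := hι
  rw [← hf] at hP ⊢
  exact hP.exists_of_exists f h

theorem exists_elem (hι : FieldElementary ι) {P : R → Prop}
    (hP : FieldDefinable ι id fun v : Unit → R => P (v ())) (h : ∃ x, P x) : ∃ m, P (ι m) := by
  obtain ⟨f, hf⟩ := hι
  rw [← hf] at hP ⊢
  exact DefinableOver.exists_of_exists_elem f hP h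

theorem comp_ringEquiv {E' : Type*} [Field E'] (hι : FieldElementary ι) (α : E' ≃+* E) :
    FieldElementary (ι.comp α.toRingHom) := by
  obtain ⟨f, hf⟩ := hι
  exact ⟨f.comp (languageEquivEquivRingEquiv.symm α).toElementaryEmbedding,
    funext fun x => congrFun hf (α x)⟩

/-- Elementarity of the homomorphism of fields induced by an elementary embedding of groups in
which the fields are interpreted. -/
theorem of_interpretation {H G A S : Type*} [Group H] [Group G] [Field A] [Field S]
    {j : H →* G} (hj : GroupElementary j) {e : S → G} (he : Function.Injective e)
    (hr : GroupDefinable j id fun w : Unit → G => w () ∈ Set.range e)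
    (hadd : ∀ x y, e (x + y) = e x * e y) (hone : e 1 ∈ Set.range j)
    (hmul : GroupTerm j e fun s : Fin 2 → S => e (s 0 * s 1))
    (k : A →+* S) (hk : ∀ a, e (k a) ∈ Set.range j)
    (hk' : ∀ s, e s ∈ Set.range j → s ∈ Set.range k) : FieldElementary k := by
  obtain ⟨f, hf⟩ := hj
  rw [← hf] at hr hone hmul hk hk'
  let k' : A ↪[Language.ring] S :=
    { toFun := k
      inj' := k.injective
      map_fun' := fun {n} g x => by
        cases g
        · exact map_add k _ _
        · exact map_mul k _ _
        · exact map_neg k _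
        · exact map_zero k
        · exact map_one k
      map_rel' := fun {n} r => isEmptyElim r }
  have hzero : e 0 = 1 := by simpa using hadd 0 0
  have hneg : ∀ x, e (-x) = (e x)⁻¹ := fun x => eq_inv_of_mul_eq_one_left (by
    rw [← hadd, neg_add_cancel, hzero])
  refine nonempty_elementaryEmbedding_of_interpretation (L' := Language.ring) f he hr
    (fun n g => ?_) k' hk hk'
  cases g
  · refine (DefinableOver.eq (GroupTerm.mul (TermOver.var (Sum.inl 0)) (TermOver.var (Sum.inl 1)))
      (TermOver.var (Sum.inr ()))).congr fun s => ?_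
    rw [← hadd, he.eq_iff]
    rfl
  · obtain ⟨τ, hτ⟩ := hmul
    have h1 : GroupTerm f e fun s : Fin 2 ⊕ Unit → S => e (s (Sum.inl 0) * s (Sum.inl 1)) := by
      refine ⟨τ.relabel (Sum.map id Sum.inl), fun s => ?_⟩
      rw [Term.realize_relabel]
      refine Eq.trans ?_ (hτ (s ∘ Sum.inl))
      congr 1
      funext w
      rcases w with m | b <;> rfl
    exact (DefinableOver.eq h1 (TermOver.var (Sum.inr ()))).congr fun s => he.eq_iff
  · refine (DefinableOver.eq (GroupTerm.inv (TermOver.var (Sum.inl 0)))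
      (TermOver.var (Sum.inr ()))).congr fun s => ?_
    rw [← hneg, he.eq_iff]
    rfl
  · refine (DefinableOver.eq GroupTerm.one (TermOver.var (Sum.inr ()))).congr fun s => ?_
    rw [← hzero, he.eq_iff]
    rfl
  · obtain ⟨m, hm⟩ := hone
    refine (DefinableOver.eq (TermOver.param m) (TermOver.var (Sum.inr ()))).congr fun s => ?_
    rw [hm, he.eq_iff]
    rfl

end FieldElementary

/-! ### Ultrapowers of fields and of general linear groups -/

section Ultrapower

open Filter

variable {I : Type*} (U : Ultrafilter I) {F : Type*} [Field F] {n : ℕ}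

/-- The matrix over an ultrapower represented by a family of matrices. -/
def germMatrix (X : I → Matrix (Fin n) (Fin n) F) :
    Matrix (Fin n) (Fin n) (Germ (U : Filter I) F) :=
  .of fun a b => Germ.coeRingHom (U : Filter I) fun i => X i a b

theorem germMatrix_mul (X Y : I → Matrix (Fin n) (Fin n) F) :
    germMatrix U (fun i => X i * Y i) = germMatrix U X * germMatrix U Y := by
  ext a b
  simp only [germMatrix, Matrix.mul_apply, Matrix.of_apply, ← map_mul, ← map_sum]
  congr 1
  funext i
  simp [Finset.sum_apply]

theorem germMatrix_one : germMatrix U (fun _ => (1 : Matrix (Fin n) (Fin n) F)) = 1 := by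
  ext a b
  simp only [germMatrix, Matrix.of_apply, Matrix.one_apply]
  split_ifs
  exacts [map_one (Germ.coeRingHom (U : Filter I)), map_zero (Germ.coeRingHom (U : Filter I))]

theorem germMatrix_eq_iff (X Y : I → Matrix (Fin n) (Fin n) F) :
    germMatrix U X = germMatrix U Y ↔ ∀ᶠ i in U, X i = Y i := by
  simp only [← Matrix.ext_iff, germMatrix, Matrix.of_apply, eventually_all]
  exact forall_congr' fun a => forall_congr' fun b => Germ.coe_eq

theorem germMatrix_surjective :
    Function.Surjective (germMatrix U : (I → Matrix (Fin n) (Fin n) F) → _) := by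
  intro X
  choose Y hY using fun a b => Quotient.exists_rep (X a b)
  exact ⟨fun i => .of fun a b => Y a b i, Matrix.ext hY⟩

/-- The element of the general linear group of an ultrapower represented by a family. -/
def germGL (g : I → GL (Fin n) F) : GL (Fin n) (Germ (U : Filter I) F) where
  val := germMatrix U fun i => (g i).val
  inv := germMatrix U fun i => (g i)⁻¹.val
  val_inv := by
    rw [← germMatrix_mul]
    simp only [Units.mul_inv, germMatrix_one]
  inv_val := by
    rw [← germMatrix_mul]
    simp only [Units.inv_mul, germMatrix_one]

theorem germGL_eq_iff (g h : I → GL (Fin n) F) :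
    germGL U g = germGL U h ↔ ∀ᶠ i in U, g i = h i := by
  rw [Units.ext_iff]
  simp only [germGL, germMatrix_eq_iff, Units.ext_iff]

theorem germGL_mul (g h : I → GL (Fin n) F) :
    germGL U (fun i => g i * h i) = germGL U g * germGL U h :=
  Units.ext (germMatrix_mul U _ _)

theorem germGL_one : germGL U (fun _ => (1 : GL (Fin n) F)) = 1 :=
  Units.ext (germMatrix_one U)

theorem germGL_inv (g : I → GL (Fin n) F) : germGL U (fun i => (g i)⁻¹) = (germGL U g)⁻¹ :=
  eq_inv_of_mul_eq_one_left (by rw [← germGL_mul]; simp only [inv_mul_cancel, germGL_one])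

theorem germGL_surjective : Function.Surjective (germGL U : (I → GL (Fin n) F) → _) := by
  classical
  intro X
  obtain ⟨Y, hY⟩ := germMatrix_surjective U X.val
  obtain ⟨Z, hZ⟩ := germMatrix_surjective U X⁻¹.val
  have h : ∀ᶠ i in U, IsUnit (Y i) := by
    have h1 : ∀ᶠ i in U, Y i * Z i = 1 := by
      rw [← germMatrix_eq_iff, germMatrix_mul, germMatrix_one, hY, hZ, Units.mul_inv]
    filter_upwards [h1] with i hi
    exact IsUnit.of_mul_eq_one _ hi
  -- The representatives are invertible almost everywhere, as the representatives of the inverse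
  -- show; the value 1 elsewhere is invisible to the ultrafilter.
  refine ⟨fun i => if hi : IsUnit (Y i) then hi.unit else 1, Units.ext ?_⟩
  rw [← hY]
  refine (germMatrix_eq_iff U _ _).2 ?_
  filter_upwards [h] with i hi
  simp [hi]

/-- A group elementarily equivalent to a general linear group embeds elementarily in the general
linear group of an elementary extension of the field. -/
theorem exists_groupElementary_GL {F : Type u} [Field F] {n : ℕ} {H : Type v} [Group H]
    (hH : GroupElemEquiv H (GL (Fin n) F)) :
    ∃ (R : Type (max u v)) (_ : Field R) (ι : F →+* R) (j : H →* GL (Fin n) R),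
      FieldElementary ι ∧ GroupElementary j := by
  obtain ⟨I, U, a, ha⟩ := exists_ultrafilter_valuation hH
  let ι : F →+* Germ (U : Filter I) F :=
    (Germ.coeRingHom (U : Filter I)).comp (Pi.constRingHom I F)
  have hι : FieldElementary ι := by
    refine ⟨⟨ι, fun k φ x => ?_⟩, rfl⟩
    refine (realize_iff_eventually_of_ultrapower U (Germ.coeRingHom (U : Filter I))
      Quotient.mk_surjective (fun x y => Germ.coe_eq) (fun n f x => ?_)
      (fun n r => isEmptyElim r) φ fun l _ => x l).trans eventually_const
    cases f
    exacts [(map_add (Germ.coeRingHom (U : Filter I)) _ _).symm,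
      (map_mul (Germ.coeRingHom (U : Filter I)) _ _).symm,
      (map_neg (Germ.coeRingHom (U : Filter I)) _).symm,
      (map_zero (Germ.coeRingHom (U : Filter I))).symm,
      (map_one (Germ.coeRingHom (U : Filter I))).symm]
  have hlos : ∀ {β : Type v} (φ : groupLanguage.Formula β) (x : β → I → GL (Fin n) F),
      φ.Realize (fun b => germGL U (x b)) ↔ ∀ᶠ i in U, φ.Realize fun b => x b i := by
    intro β φ x
    refine realize_iff_eventually_of_ultrapower U (germGL U) (germGL_surjective U)
      (germGL_eq_iff U) (fun n f x => ?_) (fun n r => isEmptyElim r) φ x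
    cases f
    exacts [(germGL_mul U _ _).symm, (germGL_inv U _).symm, (germGL_one U).symm]
  -- The valuations preserve truth of every formula, hence also of its negation, so they reflect
  -- truth; this is what makes the map elementary.
  have hid : ∀ φ : groupLanguage.Formula H,
      φ.Realize (fun x => germGL U (a x)) ↔ φ.Realize (id : H → H) := by
    intro φ
    rw [hlos]
    refine ⟨fun h => ?_, ha φ⟩
    by_contra hc
    have := ha φ.not (Formula.realize_not.2 hc)
    obtain ⟨i, h1, h2⟩ := (h.and this).exists
    exact Formula.realize_not.1 h2 h1
  let f : H ↪ₑ[groupLanguage] GL (Fin n) (Germ (U : Filter I) F) :=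
    ⟨fun x => germGL U (a x), fun k φ x => by
      have := hid (φ.relabel x)
      rw [Formula.realize_relabel, Formula.realize_relabel] at this
      exact this⟩
  let j : H →* GL (Fin n) (Germ (U : Filter I) F) :=
    { toFun := f
      map_one' := f.map_fun (L := groupLanguage) GroupFunc.one ![]
      map_mul' := fun x y => f.map_fun (L := groupLanguage) GroupFunc.mul ![x, y] }
  exact ⟨Germ (U : Filter I) F, inferInstance, ι, j, hι, f, rfl⟩

end Ultrapower

end Elementary

/-! ### Retractions onto the torsion subgroup -/

/-- Let `N` be the order of the torsion subgroup `T`. Then `T` embeds in `M / M ^ N`, and a faithful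
character of the cyclic group `T` with values in the divisible group `ℚ / ℤ` extends to `M / M ^ N`.
The extension is killed by `N`, so its values lie in the cyclic subgroup of order `N`, which is the
image of `T`. -/
theorem exists_retraction_torsion (M : Type*) [CommGroup M] [Finite (CommGroup.torsion M)]
    [IsCyclic (CommGroup.torsion M)] :
    ∃ π : M →* M, (∀ x, IsOfFinOrder (π x)) ∧ ∀ t, IsOfFinOrder t → π t = t := by
  let T := CommGroup.torsion M
  let N := Nat.card (Additive T)
  have hN : 0 < N := Nat.card_pos
  let P := (powMonoidHom N : M →* M).range
  let i : Additive T →+ Additive (M ⧸ P) :=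
    MonoidHom.toAdditive ((QuotientGroup.mk' P).comp T.subtype)
  -- If an `N`-th power `m ^ N` is torsion, then so is `m`, and therefore `m ^ N = 1`.
  have hi : Function.Injective i := by
    rw [injective_iff_map_eq_zero]
    intro t ht
    obtain ⟨m, hm⟩ := (QuotientGroup.eq_one_iff (t.toMul : M)).1 ht
    have hm' : m ∈ T := by
      have : IsOfFinOrder (m ^ N) := by
        change IsOfFinOrder (powMonoidHom N m)
        rw [hm]
        exact t.toMul.2
      exact IsOfFinOrder.of_pow this hN.ne'
    have h1 : (⟨m, hm'⟩ : T) ^ N = 1 := pow_card_eq_one'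
    exact Subtype.ext (hm.symm.trans (congrArg Subtype.val h1))
  let e : ZMod N ≃+ Additive T := zmodAddCyclicAddEquiv inferInstance
  let u : AddCircle (1 : ℚ) := ((1 / N : ℚ) : AddCircle (1 : ℚ))
  have hu : addOrderOf u = N := AddCircle.addOrderOf_period_div hN
  let f : ZMod N →+ AddCircle (1 : ℚ) := ZMod.lift N ⟨zmultiplesHom _ u, by
    rw [zmultiplesHom_apply, natCast_zsmul, ← hu, addOrderOf_nsmul_eq_zero]⟩
  have hf : Function.Injective f := by
    rw [ZMod.lift_injective]
    intro m hm
    rw [ZMod.intCast_zmod_eq_zero_iff_dvd, ← hu]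
    exact addOrderOf_dvd_iff_zsmul_eq_zero.2 hm
  let c : Additive T →+ AddCircle (1 : ℚ) := f.comp e.symm.toAddMonoidHom
  have hc : Function.Injective c := hf.comp e.symm.injective
  obtain ⟨χ, hχ⟩ := CharacterModule.dual_surjective_of_injective (R := ℤ) i.toIntLinearMap hi c
  have hχi : ∀ t, χ (i t) = c t := fun t => DFunLike.congr_fun hχ t
  have hex : ∀ y : Additive (M ⧸ P), ∃ t : Additive T, c t = χ y := by
    intro y
    have hy : N • y = 0 := by
      obtain ⟨x, hx⟩ := QuotientGroup.mk_surjective y.toMul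
      change y.toMul ^ N = 1
      rw [← hx, ← QuotientGroup.mk_pow, QuotientGroup.eq_one_iff]
      exact ⟨x, rfl⟩
    have h1 : N • χ y = 0 := by rw [← map_nsmul, hy, map_zero]
    obtain ⟨q, hq⟩ := QuotientAddGroup.mk_surjective (χ y)
    rw [← hq] at h1 ⊢
    obtain ⟨m, hm⟩ := (AddCircle.coe_eq_zero_iff (1 : ℚ)).1 h1
    refine ⟨e (m : ZMod N), ?_⟩
    have hfm : f (m : ZMod N) = m • u := ZMod.lift_coe _ _ _
    change f (e.symm (e _)) = _
    rw [e.symm_apply_apply, hfm]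
    have : q = m • (1 / N : ℚ) := by
      have hN' : (N : ℚ) ≠ 0 := by exact_mod_cast hN.ne'
      simp only [zsmul_eq_mul, nsmul_eq_mul, mul_one] at hm ⊢
      field_simp
      linarith
    rw [this]
    rfl
  choose g hg using hex
  let π : M →* M :=
    { toFun := fun x => ((g (Additive.ofMul (QuotientGroup.mk x))).toMul : T)
      map_one' := by
        have : g (Additive.ofMul (QuotientGroup.mk (1 : M))) = 0 :=
          hc (by rw [hg, map_zero]; exact map_zero χ)
        rw [this]
        rfl
      map_mul' := fun x y => by
        have : g (Additive.ofMul (QuotientGroup.mk (x * y))) =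
            g (Additive.ofMul (QuotientGroup.mk x)) + g (Additive.ofMul (QuotientGroup.mk y)) :=
          hc (by rw [hg, map_add, hg, hg]; exact map_add χ (Additive.ofMul (QuotientGroup.mk x)) (Additive.ofMul (QuotientGroup.mk y)))
        rw [this]
        rfl }
  refine ⟨π, fun x => (g (Additive.ofMul (QuotientGroup.mk x))).toMul.2, fun t ht => ?_⟩
  have : g (i (Additive.ofMul ⟨t, ht⟩)) = Additive.ofMul ⟨t, ht⟩ := hc (by rw [hg, hχi])
  exact congrArg (fun s : Additive T => (s.toMul : M)) this

/-- The complement of the torsion subgroup cut out by a retraction of an overgroup onto its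
torsion subgroup. -/
def TorsionComplement.ofRetraction {M P : Type*} [CommGroup M] [CommGroup P] (f : M →* P)
    (hf : Function.Injective f) (hT : ∀ t : P, IsOfFinOrder t → t ∈ f.range)
    (π : P →* P) (hπ : ∀ x, IsOfFinOrder (π x)) (hπT : ∀ t, IsOfFinOrder t → π t = t) :
    TorsionComplement M where
  carrier := (π.comp f).ker
  isCompl := by
    constructor
    · rw [Subgroup.disjoint_def]
      intro x hx hx'
      have h1 : IsOfFinOrder (f x) := f.isOfFinOrder hx
      have h2 : π (f x) = 1 := hx'
      rw [hπT _ h1] at h2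
      exact hf (h2.trans (map_one f).symm)
    · rw [codisjoint_iff, eq_top_iff]
      intro x _
      obtain ⟨t, ht⟩ := hT _ (hπ (f x))
      have ht' : IsOfFinOrder t := by
        rw [← hf.isOfFinOrder_iff, ht]
        exact hπ _
      refine Subgroup.mem_sup.2 ⟨t, ht', t⁻¹ * x, ?_, mul_inv_cancel_left _ _⟩
      rw [MonoidHom.mem_ker, MonoidHom.comp_apply, map_mul, map_mul, map_inv, map_inv, ht,
        hπT _ (hπ _), inv_mul_cancel]

theorem TorsionComplement.eq_one_of_isOfFinOrder {M : Type*} [CommGroup M]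
    (A : TorsionComplement M) {a : M} (ha : a ∈ A.carrier) (h : IsOfFinOrder a) : a = 1 :=
  Subgroup.disjoint_def.1 A.isCompl.disjoint h ha

theorem TorsionComplement.pow_injective {M : Type*} [CommGroup M] (A : TorsionComplement M)
    {n : ℕ} (hn : n ≠ 0) : Function.Injective fun a : A.carrier => a ^ n := by
  intro a b hab
  have h1 : (a * b⁻¹) ^ n = 1 := by
    have : a ^ n = b ^ n := hab
    rw [mul_pow, inv_pow, this, mul_inv_cancel]
  have h2 : IsOfFinOrder ((a * b⁻¹ : A.carrier) : M) :=
    isOfFinOrder_iff_pow_eq_one.2 ⟨n, Nat.pos_of_ne_zero hn, congrArg Subtype.val h1⟩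
  exact mul_inv_eq_one.1 (Subtype.ext (A.eq_one_of_isOfFinOrder (a * b⁻¹).2 h2))

theorem TorsionComplement.isOfFinOrder_div_proj {M : Type*} [CommGroup M]
    (A : TorsionComplement M) (x : M) : IsOfFinOrder (x * (A.proj x : M)⁻¹) := by
  have hx : x ∈ CommGroup.torsion M ⊔ A.carrier := by rw [A.isCompl.sup_eq_top]; trivial
  obtain ⟨t, ht, a, ha, rfl⟩ := Subgroup.mem_sup.1 hx
  have h1 : A.proj (t * a) = ⟨a, ha⟩ := by
    rw [map_mul, A.proj_of_isOfFinOrder ht, one_mul]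
    exact A.proj_coe ⟨a, ha⟩
  rw [h1, mul_inv_cancel_right]
  exact ht

/-! ### Deformations inside a larger general linear group -/

section Deformation

open Matrix.GeneralLinearGroup

variable {n : ℕ} {R L H : Type*} [Field R] [Field L] [Group H]

theorem Matrix.GeneralLinearGroup.scalar_injective {n : ℕ} (hn : n ≠ 0) {R : Type*} [Field R] :
    Function.Injective (scalar (Fin n) : Rˣ →* GL (Fin n) R) := by
  intro a b hab
  have h := congrArg (fun g : GL (Fin n) R => g.val ⟨0, Nat.pos_of_ne_zero hn⟩
    ⟨0, Nat.pos_of_ne_zero hn⟩) hab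
  simpa [Units.ext_iff] using h

/-- The scalars by which the center of a subgroup acts. -/
theorem exists_centerScalar (hn : n ≠ 0) (j : H →* GL (Fin n) R) (hj : Function.Injective j)
    (hc : ∀ z ∈ Subgroup.center H, ∃ a : Rˣ, j z = scalar (Fin n) a) :
    ∃ θ : Subgroup.center H →* Rˣ, Function.Injective θ ∧
      ∀ z : Subgroup.center H, j z = scalar (Fin n) (θ z) := by
  choose θ hθ using fun z : Subgroup.center H => hc z z.2
  refine ⟨MonoidHom.mk' θ fun a b => ?_, fun a b hab => ?_, hθ⟩
  · apply scalar_injective hn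
    rw [map_mul, ← hθ, ← hθ, ← hθ, Subgroup.coe_mul, map_mul]
  · apply Subtype.ext
    apply hj
    rw [hθ, hθ]
    exact congrArg _ hab

theorem map_injective (ι : L →+* R) :
    Function.Injective (map ι : GL (Fin n) L →* GL (Fin n) R) := by
  intro g h hgh
  ext a b
  have := congrArg (fun g : GL (Fin n) R => g.val a b) hgh
  exact ι.injective this

theorem exists_scalar_of_map_eq_scalar (hn : n ≠ 0) (ι : L →+* R) {g : GL (Fin n) L} {a : Rˣ}
    (h : map ι g = scalar (Fin n) a) : ∃ c : Lˣ, g = scalar (Fin n) c ∧ Units.map ι c = a := by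
  have h1 : g ∈ Subgroup.center (GL (Fin n) L) := by
    rw [Subgroup.mem_center_iff]
    intro k
    apply map_injective ι
    rw [map_mul, map_mul, h, scalar_commute]
  rw [center_eq_range_scalar] at h1
  obtain ⟨c, rfl⟩ := h1
  refine ⟨c, rfl, scalar_injective hn ?_⟩
  rw [← h, map_scalar]

end Deformation

/-! ### Roots modulo representatives of the classes of powers -/

section PowRoot

variable {C : Type*} [CommGroup C] {n : ℕ}

/-- Elements of a group `C` with injective `n`-th power map as products of `n`-th powers and
chosen representatives of the classes modulo `n`-th powers. -/
theorem exists_powRoot (hinj : Function.Injective fun a : C => a ^ n)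
    (rep : C ⧸ (powMonoidHom n : C →* C).range → C) (hrep : ∀ q, QuotientGroup.mk (rep q) = q) :
    ∃ κ : C → C, (∀ x, κ x ^ n * rep (QuotientGroup.mk x) = x) ∧
      (∀ x t, κ (x * t ^ n) = κ x * t) ∧
      (∀ x y, κ (x * y) = κ x * κ y *
        κ (rep (QuotientGroup.mk x) * rep (QuotientGroup.mk y))) := by
  have hex : ∀ x : C, ∃ k : C, k ^ n * rep (QuotientGroup.mk x) = x := by
    intro x
    have h1 : (QuotientGroup.mk x : C ⧸ (powMonoidHom n : C →* C).range) =
        QuotientGroup.mk (rep (QuotientGroup.mk x)) := (hrep _).symm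
    obtain ⟨k, hk⟩ := QuotientGroup.eq.1 h1.symm
    refine ⟨k, ?_⟩
    have hk' : k ^ n = _ := hk
    rw [hk', mul_comm, mul_inv_cancel_left]
  choose κ hκ using hex
  have huniq : ∀ x y : C, y ^ n * rep (QuotientGroup.mk x) = x → κ x = y := by
    intro x y hy
    apply hinj
    exact mul_right_cancel ((hκ x).trans hy.symm)
  refine ⟨κ, hκ, fun x t => ?_, fun x y => ?_⟩
  · have h1 : (QuotientGroup.mk (x * t ^ n) : C ⧸ (powMonoidHom n : C →* C).range) =
        QuotientGroup.mk x := by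
      rw [QuotientGroup.mk_mul_of_mem]
      exact ⟨t, rfl⟩
    apply huniq
    rw [h1, mul_pow, mul_right_comm, hκ]
  · apply huniq
    have h1 : (QuotientGroup.mk (x * y) : C ⧸ (powMonoidHom n : C →* C).range) =
        QuotientGroup.mk (rep (QuotientGroup.mk x) * rep (QuotientGroup.mk y)) := by
      rw [QuotientGroup.mk_mul, QuotientGroup.mk_mul, hrep, hrep]
    rw [h1, mul_pow, mul_pow, mul_assoc, hκ]
    calc κ x ^ n * κ y ^ n * (rep (QuotientGroup.mk x) * rep (QuotientGroup.mk y))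
        = κ x ^ n * rep (QuotientGroup.mk x) * (κ y ^ n * rep (QuotientGroup.mk y)) := by
          rw [mul_mul_mul_comm]
      _ = x * y := by rw [hκ, hκ]

end PowRoot

/-! ### Matrix groups that agree with `GL n L` up to scalars -/

section Deformation

open Matrix.GeneralLinearGroup

variable {n : ℕ} {R L H : Type*} [Field R] [Field L] [Group H]

/-- A cocycle multiplied by a coboundary is a cocycle; the letters are the values of the bounding
function at three elements and at their products. -/
theorem mul_cocycle_eq {C : Type*} [CommGroup C] (x y z w u v : C) {c₁ c₂ c₃ c₄ : C}
    (h : c₁ * c₂ = c₃ * c₄) :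
    w * z * c₁ * u⁻¹ * (x * y * c₂ * w⁻¹) = x * v * c₃ * u⁻¹ * (y * z * c₄ * v⁻¹) :=
  calc _ = x * y * z * u⁻¹ * (c₁ * c₂) * (w * w⁻¹) := by
        simp only [mul_assoc, mul_comm, mul_left_comm]
    _ = x * y * z * u⁻¹ * (c₃ * c₄) * (v * v⁻¹) := by rw [h, mul_inv_cancel, mul_inv_cancel]
    _ = _ := by simp only [mul_assoc, mul_comm, mul_left_comm]

theorem mul_inv_eq_of_cocycle {C : Type*} [CommGroup C] (x y z w u v : C) :
    x * y * w * z⁻¹ * (z * (u⁻¹ * v⁻¹ * w⁻¹)) = x * u⁻¹ * (y * v⁻¹) :=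
  calc _ = x * u⁻¹ * (y * v⁻¹) * (z⁻¹ * z) * (w * w⁻¹) := by
        simp only [mul_assoc, mul_comm, mul_left_comm]
    _ = _ := by rw [inv_mul_cancel, mul_inv_cancel, mul_one, mul_one]

theorem scalar_mul_mul_scalar_mul (a b : Rˣ) (X Y : GL (Fin n) R) :
    scalar (Fin n) a * X * (scalar (Fin n) b * Y) = scalar (Fin n) (a * b) * (X * Y) := by
  rw [mul_assoc, ← mul_assoc X, ← scalar_commute b X, mul_assoc, ← mul_assoc, map_mul]

set_option maxHeartbeats 2000000 in
/-- A group `H` of matrices over `R` which agrees with `GL n L` up to scalars is an abelian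
deformation of `GL n L`. -/
theorem exists_mulEquiv_abelianDeformation (hn : n ≠ 0) (ι : L →+* R) (j : H →* GL (Fin n) R)
    (hj : Function.Injective j) (π : Rˣ →* Rˣ) (hπ : ∀ x, IsOfFinOrder (π x))
    (hπT : ∀ t, IsOfFinOrder t → π t = t)
    (hc : ∀ z ∈ Subgroup.center H, ∃ a : Rˣ, j z = scalar (Fin n) a)
    (hH : ∀ x, ∃ (a : Rˣ) (g : GL (Fin n) L), j x = scalar (Fin n) a * map ι g)
    (hL : ∀ g : GL (Fin n) L, ∃ a : Rˣ, scalar (Fin n) a * map ι g ∈ j.range)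
    (hdet : ∀ g : GL (Fin n) L, IsOfFinOrder (det g) → map ι g ∈ j.range)
    (hT : ∀ t : Rˣ, IsOfFinOrder t → scalar (Fin n) t ∈ j.range ∧ t ∈ (Units.map ι.toMonoidHom).range) :
    ∃ (A : TorsionComplement Lˣ) (K₀ : Addition (GL (Fin n) L)) (B : Addition H)
      (h : SymmCocycle (A.ModPow n) B.carrier) (φ : H ≃* AbelianDeformation A K₀ B.carrier h),
      A.carrier = (π.comp (Units.map ι.toMonoidHom)).ker ∧
      (∀ z, z ∈ B.carrier ↔ ∃ a : Rˣ, j z = scalar (Fin n) a ∧ π a = 1) ∧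
      ∀ b : B.carrier, φ ((b : Subgroup.center H) : H) = AbelianDeformation.inl b := by
  classical
  let υ : Lˣ →* Rˣ := Units.map ι.toMonoidHom
  have hυ : Function.Injective υ := Units.map_injective ι.injective
  obtain ⟨θ, hθinj, hθ⟩ := exists_centerScalar hn j hj hc
  have hcL : ∀ z ∈ Subgroup.center (GL (Fin n) L), ∃ a : Rˣ, map ι z = scalar (Fin n) a := by
    intro z hz
    rw [center_eq_range_scalar] at hz
    obtain ⟨c, rfl⟩ := hz
    exact ⟨_, map_scalar _ _⟩
  obtain ⟨θL, hθLinj, hθL⟩ := exists_centerScalar hn (map ι) (map_injective ι) hcL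
  have hscalar : ∀ {x : H} {a : Rˣ}, j x = scalar (Fin n) a → x ∈ Subgroup.center H := by
    intro x a hx
    rw [Subgroup.mem_center_iff]
    intro y
    apply hj
    rw [map_mul, map_mul, hx, scalar_commute]
  -- The three complements come from the same retraction. Hence membership in each is the one
  -- condition `π a = 1` on a scalar `a`, and they can be compared inside `Rˣ`.
  let A : TorsionComplement Lˣ := .ofRetraction υ hυ (fun t ht => (hT t ht).2) π hπ hπT
  let K₀ : Addition (GL (Fin n) L) := .ofRetraction θL hθLinj (fun t ht => by
    obtain ⟨c, hc⟩ := (hT t ht).2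
    have h1 : scalar (Fin n) c ∈ Subgroup.center (GL (Fin n) L) := by
      rw [center_eq_range_scalar]
      exact ⟨c, rfl⟩
    refine ⟨⟨_, h1⟩, scalar_injective hn ?_⟩
    rw [← hθL, map_scalar, ← hc]
    rfl) π hπ hπT
  let B : Addition H := .ofRetraction θ hθinj (fun t ht => by
    obtain ⟨x, hx⟩ := (hT t ht).1
    refine ⟨⟨x, hscalar hx⟩, scalar_injective hn ?_⟩
    rw [← hθ, hx]) π hπ hπT
  have hA : ∀ a : A.carrier, π (υ a) = 1 := fun a => a.2
  have hK₀ : ∀ {g : GL (Fin n) L}, g ∈ Addition.toSubgroup K₀ ↔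
      ∃ a : A.carrier, g = scalar (Fin n) (a : Lˣ) := by
    intro g
    constructor
    · rintro ⟨z, hz, rfl⟩
      obtain ⟨c, hc, hc'⟩ := exists_scalar_of_map_eq_scalar hn ι (hθL z)
      refine ⟨⟨c, ?_⟩, hc⟩
      change π (υ c) = 1
      change π (θL z) = 1 at hz
      rw [← hz, ← hc']
      rfl
    · rintro ⟨a, rfl⟩
      have h1 : scalar (Fin n) (a : Lˣ) ∈ Subgroup.center (GL (Fin n) L) := by
        rw [center_eq_range_scalar]
        exact ⟨a, rfl⟩
      refine ⟨⟨_, h1⟩, ?_, rfl⟩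
      change π (θL _) = 1
      rw [← hA a]
      congr 1
      apply scalar_injective hn
      rw [← hθL, map_scalar]
      rfl
  have hBmem : ∀ z : Subgroup.center H, z ∈ B.carrier ↔ π (θ z) = 1 := fun z => Iff.rfl
  have hBex : ∀ a : Rˣ, scalar (Fin n) a ∈ j.range → π a = 1 →
      ∃ b : B.carrier, j ((b : Subgroup.center H) : H) = scalar (Fin n) a := by
    rintro a ⟨x, hx⟩ ha
    refine ⟨⟨⟨x, hscalar hx⟩, ?_⟩, hx⟩
    rw [hBmem, ← ha]
    congr 1
    apply scalar_injective hn
    rw [← hθ, hx]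
  -- representatives of the classes modulo powers
  have hdetsurj : ∀ a : Lˣ, ∃ d : GL (Fin n) L, det d = a := by
    have : Nonempty (Fin n) := ⟨⟨0, Nat.pos_of_ne_zero hn⟩⟩
    exact det_surjective
  have hrepex : ∀ q : A.ModPow n, ∃ (a : A.carrier) (l : Rˣ), QuotientGroup.mk a = q ∧ π l = 1 ∧
      (∃ d : GL (Fin n) L, det d = a ∧ scalar (Fin n) l * map ι d ∈ j.range) ∧
      (q = 1 → a = 1 ∧ l = 1) := by
    intro q
    -- The trivial class is represented by 1 with scalar 1; this normalizes the cocycle and makes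
    -- the section send 1 to 1.
    by_cases hq : q = 1
    · refine ⟨1, 1, hq.symm, map_one π, ⟨1, map_one det, ?_⟩, fun _ => ⟨rfl, rfl⟩⟩
      rw [map_one, map_one, one_mul]
      exact one_mem _
    · obtain ⟨a, ha⟩ := QuotientGroup.mk_surjective q
      obtain ⟨d, hd⟩ := hdetsurj a
      obtain ⟨l, hl⟩ := hL d
      refine ⟨a, (π l)⁻¹ * l, ha, ?_, ⟨d, hd, ?_⟩, fun h => absurd h hq⟩
      · rw [map_mul, map_inv, hπT _ (hπ l), inv_mul_cancel]
      · rw [map_mul, mul_assoc]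
        exact mul_mem (hT _ (hπ l).inv).1 hl
  choose rep ℓ hrep hℓ hd h1 using hrepex
  choose d hdd hdj using hd
  obtain ⟨κ, hκ, hκpow, hκmul⟩ := exists_powRoot (A.pow_injective hn) rep hrep
  -- The cocycle of `A` as an extension of `A / A ^ n` by the image of the injective `n`-th power
  -- map: `rep q * rep r = c q r ^ n * rep (q * r)`.
  let c : A.ModPow n → A.ModPow n → A.carrier := fun q r => κ (rep q * rep r)
  have hκ1 : ∀ q, κ (rep q) = 1 := by
    intro q
    have := hκ (rep q)
    rw [hrep, mul_eq_right] at this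
    exact A.pow_injective hn (this.trans (one_pow n).symm)
  have hcone : ∀ q, c 1 q = 1 := fun q => by
    change κ (rep 1 * rep q) = 1
    rw [(h1 1 rfl).1, one_mul, hκ1]
  have hcsymm : ∀ q r, c q r = c r q := fun q r => congrArg κ (mul_comm _ _)
  have hcc : ∀ q r s, c (q * r) s * c q r = c q (r * s) * c r s := by
    intro q r s
    have e1 := hκmul (rep q * rep r) (rep s)
    have e2 := hκmul (rep q) (rep r * rep s)
    rw [QuotientGroup.mk_mul, hrep, hrep, hrep, hκ1, mul_one] at e1
    rw [QuotientGroup.mk_mul, hrep, hrep, hrep, hκ1, one_mul] at e2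
    rw [mul_assoc, e2] at e1
    calc c (q * r) s * c q r = κ (rep q * rep r) * κ (rep (q * r) * rep s) := mul_comm _ _
      _ = _ := e1.symm
      _ = _ := mul_comm _ _
  -- The coboundary of `ℓ` twists `c`. Neither factor need consist of scalars of `H`, but the
  -- product does (`hmj`).
  let m : A.ModPow n → A.ModPow n → Rˣ := fun q r => ℓ q * ℓ r * υ (c q r) * (ℓ (q * r))⁻¹
  have hmπ : ∀ q r, π (m q r) = 1 := by
    intro q r
    simp only [m, map_mul, map_inv, hℓ, hA, mul_one, inv_one]
  -- the section
  let cls : GL (Fin n) L → A.ModPow n := fun g => A.toModPow n (det g)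
  have hcls : ∀ g, cls g = QuotientGroup.mk (A.proj (det g)) := fun g => rfl
  -- The factor `ℓ` brings a representative of the determinant class into `H`; dividing by the root
  -- `κ` cancels the effect of multiplying `g` by a scalar in `A`, so that `σ` descends to the
  -- foundation.
  let σs : GL (Fin n) L → Rˣ := fun g => ℓ (cls g) * (υ (κ (A.proj (det g))))⁻¹
  let σ : GL (Fin n) L → GL (Fin n) R := fun g => scalar (Fin n) (σs g) * map ι g
  have hσj : ∀ g, σ g ∈ j.range := by
    intro g
    -- The determinant of this product is `det g` divided by its `A`-part, hence torsion, so the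
    -- product lies in `H` by `hdet`. Multiplying by the element `ℓ d` of `H` gives `σ g`.
    have e1 : IsOfFinOrder (det (scalar (Fin n) (κ (A.proj (det g)) : Lˣ)⁻¹ * g *
        (d (cls g))⁻¹)) := by
      have e2 := A.isOfFinOrder_div_proj (det g)
      have e3 : ((κ (A.proj (det g)) : Lˣ)) ^ n * rep (cls g) = A.proj (det g) :=
        congrArg Subtype.val (hκ (A.proj (det g)))
      rw [← e3] at e2
      have e4 : det (scalar (Fin n) (κ (A.proj (det g)) : Lˣ)⁻¹ * g * (d (cls g))⁻¹) =
          det g * ((κ (A.proj (det g)) : Lˣ) ^ n * rep (cls g))⁻¹ := by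
        rw [map_mul, map_mul, det_scalar, Fintype.card_fin, map_inv, hdd, inv_pow, mul_inv,
          mul_comm _ (det g), mul_assoc]
      rw [e4]
      exact e2
    have e4 := mul_mem (hdet _ e1) (hdj (cls g))
    rw [map_mul, map_mul, map_scalar, map_inv (map ι), mul_assoc, ← mul_assoc (map ι (d _))⁻¹,
      ← scalar_commute, mul_assoc (scalar (Fin n) _) _ (map ι (d _)), inv_mul_cancel, mul_one,
      mul_assoc, ← scalar_commute, ← mul_assoc, ← map_mul, mul_comm, map_inv] at e4
    exact e4
  have hσmul : ∀ g g', σ g * σ g' = scalar (Fin n) (m (cls g) (cls g')) * σ (g * g') := by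
    intro g g'
    have e1 : cls (g * g') = cls g * cls g' := by simp only [cls, map_mul]
    have e2 : κ (A.proj (det (g * g'))) =
        κ (A.proj (det g)) * κ (A.proj (det g')) * c (cls g) (cls g') := by
      rw [map_mul, map_mul, hκmul]
      rfl
    have e3 : m (cls g) (cls g') * σs (g * g') = σs g * σs g' := by
      simp only [σs, m]
      rw [e1, e2, Subgroup.coe_mul, Subgroup.coe_mul, map_mul υ, map_mul υ, mul_inv, mul_inv]
      exact mul_inv_eq_of_cocycle _ _ _ _ _ _
    simp only [σ]
    rw [scalar_mul_mul_scalar_mul, ← e3, map_mul (scalar (Fin n)), map_mul (map ι), mul_assoc]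
  have hσscalar : ∀ (g : GL (Fin n) L) (t : Lˣ), σs (scalar (Fin n) t * g) =
      σs g * (υ (A.proj t))⁻¹ := by
    intro g t
    have e0 : A.proj (det (scalar (Fin n) t * g)) = A.proj (det g) * A.proj t ^ n := by
      rw [map_mul, det_scalar, Fintype.card_fin, map_mul, map_pow, mul_comm]
    have e1 : cls (scalar (Fin n) t * g) = cls g := by
      simp only [cls, map_mul, det_scalar, Fintype.card_fin]
      rw [A.toModPow_pow, one_mul]
    simp only [σs]
    rw [e1, e0, hκpow, Subgroup.coe_mul, map_mul, mul_inv, mul_assoc]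
  have hsex : ∀ x : Foundation K₀, ∃ y : H, ∀ g, QuotientGroup.mk g = x → j y = σ g := by
    intro x
    obtain ⟨g, rfl⟩ := QuotientGroup.mk_surjective x
    obtain ⟨y, hy⟩ := hσj g
    refine ⟨y, fun g' hg' => ?_⟩
    obtain ⟨a, ha⟩ := hK₀.1 (QuotientGroup.eq.1 hg'.symm)
    have e1 : g' = scalar (Fin n) (a : Lˣ) * g := by
      rw [scalar_commute, ← ha, mul_inv_cancel_left]
    rw [hy, e1]
    simp only [σ]
    have e2 : map ι (scalar (Fin n) (a : Lˣ)) = scalar (Fin n) (υ a) := map_scalar _ _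
    rw [hσscalar, A.proj_coe, map_mul (map ι), e2, ← mul_assoc, ← map_mul, inv_mul_cancel_right]
  choose s hs using hsex
  have hs' : ∀ g : GL (Fin n) L, j (s (QuotientGroup.mk g)) = σ g := fun g => hs _ g rfl
  have hmj : ∀ q r, scalar (Fin n) (m q r) ∈ j.range := by
    intro q r
    have e1 : ∀ q, cls (d q) = q := fun q => by
      rw [hcls, hdd, A.proj_coe, hrep]
    have e2 := hσmul (d q) (d r)
    rw [e1, e1, ← mul_inv_eq_iff_eq_mul] at e2
    rw [← e2]
    exact mul_mem (mul_mem (hσj _) (hσj _)) (inv_mem (hσj _))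
  choose hB hhB using fun q r => hBex _ (hmj q r) (hmπ q r)
  have hjB : ∀ {b b' : B.carrier}, j ((b : Subgroup.center H) : H) = j ((b' : Subgroup.center H) : H) →
      b = b' := fun h => Subtype.ext (Subtype.ext (hj h))
  let h : SymmCocycle (A.ModPow n) B.carrier :=
    { toFun := hB
      cocycle := fun x y z => by
        apply hjB
        simp only [Subgroup.coe_mul, map_mul, hhB]
        rw [← map_mul, ← map_mul]
        congr 1
        have e1 := congrArg (fun a : A.carrier => υ a) (hcc x y z)
        simp only [Subgroup.coe_mul, map_mul] at e1
        simp only [m]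
        rw [mul_assoc x y z]
        exact mul_cocycle_eq _ _ _ _ _ _ e1
      one_left := fun x => by
        apply hjB
        rw [hhB]
        simp only [m, hcone, (h1 1 rfl).2, one_mul, OneMemClass.coe_one, map_one, mul_one,
          mul_inv_cancel]
      one_right := fun x => by
        apply hjB
        rw [hhB]
        simp only [m, hcsymm x 1, hcone, (h1 1 rfl).2, OneMemClass.coe_one, map_one, mul_one,
          mul_inv_cancel]
      symm := fun x y => by
        apply hjB
        rw [hhB, hhB]
        simp only [m, hcsymm x y, mul_comm x y, mul_comm (ℓ x)] }
  have hh : ∀ q r, j (((h.toFun q r : B.carrier) : Subgroup.center H) : H) =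
      scalar (Fin n) (m q r) := hhB
  have hBc : ∀ (b : B.carrier) (y : H),
      ((b : Subgroup.center H) : H) * y = y * ((b : Subgroup.center H) : H) := fun b y =>
    (Subgroup.mem_center_iff.1 (b : Subgroup.center H).2 y).symm
  have hsmul : ∀ x y : Foundation K₀, s x * s y =
      ((h.toFun (foundationClass A K₀ x) (foundationClass A K₀ y) : B.carrier) :
        Subgroup.center H) * s (x * y) := by
    intro x y
    obtain ⟨g, rfl⟩ := QuotientGroup.mk_surjective x
    obtain ⟨g', rfl⟩ := QuotientGroup.mk_surjective y
    apply hj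
    rw [map_mul, map_mul, hh, hs', hs', ← QuotientGroup.mk_mul, hs', hσmul]
    rfl
  let ψ : AbelianDeformation A K₀ B.carrier h →* H := MonoidHom.mk'
    (fun x => ((x.fst : Subgroup.center H) : H) * s x.snd) (fun x y => by
      rw [AbelianDeformation.mul_def]
      simp only [Subgroup.coe_mul]
      rw [mul_assoc (((x.fst : Subgroup.center H) : H)) (s x.snd), ← mul_assoc (s x.snd),
        ← hBc y.fst (s x.snd), mul_assoc _ (s x.snd), hsmul]
      simp only [mul_assoc])
  have hψ : ∀ x, ψ x = ((x.fst : Subgroup.center H) : H) * s x.snd := fun _ => rfl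
  have hs1 : s 1 = 1 := by
    apply hj
    rw [← QuotientGroup.mk_one, hs' 1, map_one]
    simp only [σ, σs, map_one, cls, (h1 1 rfl).2, one_mul, mul_one]
    have : κ 1 = 1 := by
      have := hκ1 1
      rwa [(h1 1 rfl).1] at this
    rw [this, OneMemClass.coe_one, map_one, inv_one, map_one]
  have hBθ : ∀ b : B.carrier, π (θ b) = 1 := fun b => b.2
  -- If `b * s x = 1`, a matrix over `L` representing `x` is scalar. The retraction is trivial on
  -- all factors of that scalar, so it lies in `A` and `x` is trivial in the foundation.
  have hinj : Function.Injective ψ := by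
    rw [injective_iff_map_eq_one]
    rintro ⟨b, x⟩ hx
    obtain ⟨g, rfl⟩ := QuotientGroup.mk_surjective x
    rw [hψ] at hx
    have e1 := congrArg j hx
    rw [map_mul, map_one, hs', hθ] at e1
    simp only [σ] at e1
    rw [← mul_assoc, ← map_mul] at e1
    have e2 : map ι g = scalar (Fin n) (θ b * σs g)⁻¹ := by
      rw [map_inv]
      exact eq_inv_of_mul_eq_one_right e1
    obtain ⟨t, rfl, ht⟩ := exists_scalar_of_map_eq_scalar hn ι e2
    have e3 : σs (scalar (Fin n) t) = (υ (A.proj t))⁻¹ := by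
      have := hσscalar 1 t
      rw [mul_one] at this
      rw [this]
      have e4 : σs 1 = 1 := by
        simp only [σs, map_one, cls, (h1 1 rfl).2, one_mul]
        have : κ 1 = 1 := by
          have := hκ1 1
          rwa [(h1 1 rfl).1] at this
        rw [this, OneMemClass.coe_one, map_one, inv_one]
      rw [e4, one_mul]
    have e5 : π (υ t) = 1 := by
      change π (Units.map ι t) = 1
      rw [ht, e3, map_inv, map_mul, map_inv, hA, hBθ, one_mul, inv_one, inv_one]
    have e6 : (QuotientGroup.mk (scalar (Fin n) t) : Foundation K₀) = 1 :=
      (QuotientGroup.eq_one_iff _).2 (hK₀.2 ⟨⟨t, e5⟩, rfl⟩)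
    rw [e6, hs1, mul_one] at hx
    ext
    · simpa [AbelianDeformation.one_def] using hx
    · exact e6
  have hsurj : Function.Surjective ψ := by
    intro x
    obtain ⟨a, g, hx⟩ := hH x
    -- The scalar by which `j x` differs from `σ g` need not satisfy `π = 1`. Absorbing its torsion
    -- part in `g`, as a scalar `t` over `L`, leaves a scalar belonging to `B`.
    obtain ⟨t, ht⟩ := (hT _ (hπ (a * (σs g)⁻¹))).2
    have htA : A.proj t = 1 := by
      apply A.proj_of_isOfFinOrder
      rw [← hυ.isOfFinOrder_iff]
      change IsOfFinOrder (Units.map ι.toMonoidHom t)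
      rw [ht]
      exact hπ _
    have e1 : σ (scalar (Fin n) t * g) = scalar (Fin n) (σs g * υ t) * map ι g := by
      have e2 : map ι (scalar (Fin n) t) = scalar (Fin n) (υ t) := map_scalar _ _
      simp only [σ]
      rw [hσscalar, htA, OneMemClass.coe_one, map_one, inv_one, mul_one, map_mul (map ι), e2,
        map_mul (scalar (Fin n)) (σs g) (υ t), mul_assoc]
    have e2 : j (x * (s (QuotientGroup.mk (scalar (Fin n) t * g)))⁻¹) =
        scalar (Fin n) (a * (σs g)⁻¹ * (υ t)⁻¹) := by
      rw [map_mul, map_inv, hs', e1, hx, mul_inv_rev, ← mul_assoc, mul_assoc _ (map ι g),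
        mul_inv_cancel, mul_one, ← map_inv, ← map_mul, mul_inv, mul_assoc]
    obtain ⟨b, hb⟩ := hBex _ ⟨_, e2⟩ (by
      rw [map_mul, map_inv]
      change _ * (π (Units.map ι.toMonoidHom t))⁻¹ = 1
      rw [ht, hπT _ (hπ _), mul_inv_cancel])
    refine ⟨⟨b, QuotientGroup.mk (scalar (Fin n) t * g)⟩, ?_⟩
    rw [hψ, ← eq_mul_inv_iff_mul_eq]
    apply hj
    rw [hb, e2]
  let Φ : AbelianDeformation A K₀ B.carrier h ≃* H := MulEquiv.ofBijective ψ ⟨hinj, hsurj⟩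
  refine ⟨A, K₀, B, h, Φ.symm, rfl, fun z => ?_, fun b => ?_⟩
  · rw [hBmem]
    constructor
    · exact fun hz => ⟨θ z, hθ z, hz⟩
    · rintro ⟨a, ha, ha'⟩
      rw [← ha']
      congr 1
      apply scalar_injective hn
      rw [← hθ, ha]
  · rw [MulEquiv.symm_apply_eq]
    change _ = ((b : Subgroup.center H) : H) * s 1
    rw [hs1, mul_one]

end Deformation

/-! ### Transvections, diagonal matrices and sign matrices -/

namespace Matrix.GeneralLinearGroup

open scoped commutatorElement

variable {n : ℕ} {R : Type*} [Field R] {i j k : Fin n}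

/-- Transvections as elements of the general linear group. -/
def transv (hij : i ≠ j) (r : R) : GL (Fin n) R :=
  SpecialLinearGroup.toGL (SpecialLinearGroup.transvection hij r)

theorem val_transv (hij : i ≠ j) (r : R) : (transv hij r).val = 1 + single i j r := rfl

theorem transv_add (hij : i ≠ j) (r s : R) : transv hij (r + s) = transv hij r * transv hij s := by
  rw [transv, SpecialLinearGroup.transvection_add, map_mul]
  rfl

theorem transv_zero (hij : i ≠ j) : transv hij (0 : R) = 1 := by
  rw [transv, SpecialLinearGroup.transvection_coeff_zero, map_one]

theorem transv_neg (hij : i ≠ j) (r : R) : transv hij (-r) = (transv hij r)⁻¹ :=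
  eq_inv_of_mul_eq_one_left (by rw [← transv_add, neg_add_cancel, transv_zero])

theorem transv_apply (hij : i ≠ j) (r : R) : (transv hij r).val i j = r := by
  simp [val_transv, hij]

theorem transv_injective (hij : i ≠ j) : Function.Injective (transv hij : R → GL (Fin n) R) :=
  fun r s h => by rw [← transv_apply hij r, h, transv_apply]

theorem commute_transv (hij : i ≠ j) (r s : R) : Commute (transv hij r) (transv hij s) := by
  rw [Commute, SemiconjBy, ← transv_add, ← transv_add, add_comm]

theorem commutator_transv (hij : i ≠ j) (hjk : j ≠ k) (hik : i ≠ k) (r s : R) :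
    ⁅transv hij r, transv hjk s⁆ = transv hik (r * s) := by
  rw [commutatorElement_def, mul_inv_eq_iff_eq_mul, mul_inv_eq_iff_eq_mul]
  apply Units.ext
  simp only [Units.val_mul, val_transv, mul_add, add_mul, mul_one, one_mul, single_mul_single_same,
    single_mul_single_of_ne _ _ _ _ hik.symm, single_mul_single_of_ne _ _ _ _ hjk.symm, zero_mul]
  abel

/-- Invertible diagonal matrices. -/
def dg (d : Fin n → Rˣ) : GL (Fin n) R where
  val := diagonal fun a => (d a : R)
  inv := diagonal fun a => ((d a)⁻¹ : Rˣ)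
  val_inv := by simp [diagonal_mul_diagonal]
  inv_val := by simp [diagonal_mul_diagonal]

theorem val_dg (d : Fin n → Rˣ) : (dg d).val = diagonal fun a => (d a : R) := rfl

theorem dg_mul (d d' : Fin n → Rˣ) : dg (d * d') = dg d * dg d' :=
  Units.ext (by simp [val_dg, diagonal_mul_diagonal])

theorem dg_one : dg (1 : Fin n → Rˣ) = 1 := Units.ext (by simp [val_dg])

theorem dg_inv (d : Fin n → Rˣ) : dg d⁻¹ = (dg d)⁻¹ :=
  eq_inv_of_mul_eq_one_left (by rw [← dg_mul, inv_mul_cancel, dg_one])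

theorem dg_injective : Function.Injective (dg : (Fin n → Rˣ) → GL (Fin n) R) := by
  intro d d' h
  funext a
  have := congrArg (fun g : GL (Fin n) R => g.val a a) h
  simpa [val_dg, Units.ext_iff] using this

theorem commute_dg (d d' : Fin n → Rˣ) : Commute (dg d) (dg d') := by
  rw [Commute, SemiconjBy, ← dg_mul, ← dg_mul, mul_comm]

theorem dg_const (a : Rˣ) : dg (fun _ : Fin n => a) = scalar (Fin n) a := rfl

theorem dg_conj_transv (d : Fin n → Rˣ) (hij : i ≠ j) (r : R) :
    dg d * transv hij r * (dg d)⁻¹ = transv hij (d i * r * (d j)⁻¹) := by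
  rw [mul_inv_eq_iff_eq_mul]
  apply Units.ext
  simp only [Units.val_mul, val_transv, val_dg, mul_add, add_mul, mul_one, one_mul]
  congr 1
  ext a b
  rw [diagonal_mul, mul_diagonal, single_apply, single_apply]
  split_ifs with h
  · rw [← h.1, ← h.2]
    simp
  · rw [mul_zero, zero_mul]

theorem det_dg (d : Fin n → Rˣ) : det (dg d) = ∏ a, d a :=
  Units.ext (by
    rw [val_det_apply, val_dg, det_diagonal]
    simp)

theorem exists_dg_of_val_eq_diagonal {g : GL (Fin n) R} {D : Fin n → R}
    (h : g.val = diagonal D) : ∃ d, g = dg d ∧ ∀ a, (d a : R) = D a := by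
  have hD : ∀ a, D a ≠ 0 := by
    have := det_ne_zero g
    rw [h, det_diagonal, Finset.prod_ne_zero_iff] at this
    exact fun a => this a (Finset.mem_univ a)
  exact ⟨fun a => Units.mk0 (D a) (hD a), Units.ext h, fun a => rfl⟩

/-- Diagonal matrices of signs. -/
def sgn (ε : Fin n → ℤˣ) : GL (Fin n) R := dg fun a => Units.map (Int.castRingHom R).toMonoidHom (ε a)

theorem commute_sgn (ε ε' : Fin n → ℤˣ) : Commute (sgn ε : GL (Fin n) R) (sgn ε') :=
  commute_dg _ _

theorem sgn_mul_self (ε : Fin n → ℤˣ) : (sgn ε : GL (Fin n) R) * sgn ε = 1 := by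
  rw [sgn, ← dg_mul, ← dg_one]
  congr 1
  funext a
  rw [Pi.mul_apply, ← map_mul, Int.units_mul_self, map_one]
  rfl

theorem sgn_injective (h2 : (2 : R) ≠ 0) :
    Function.Injective (sgn : (Fin n → ℤˣ) → GL (Fin n) R) := by
  have h3 : (-1 : R) ≠ 1 := by
    intro h
    apply h2
    linear_combination (-1 : R) * h
  intro ε ε' h
  funext a
  have := congrArg (fun u : Rˣ => (u : R)) (congrFun (dg_injective h) a)
  rcases Int.units_eq_one_or (ε a) with h1 | h1 <;>
    rcases Int.units_eq_one_or (ε' a) with h4 | h4 <;> simp [h1, h4, h3, h3.symm] at this ⊢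

/-- The reflection changing the sign of one coordinate. -/
def refl (k : Fin n) : GL (Fin n) R := sgn (Function.update 1 k (-1))

theorem val_refl (k : Fin n) : (refl k : GL (Fin n) R).val =
    diagonal fun a => if a = k then (-1 : R) else 1 := by
  rw [refl, sgn, val_dg]
  congr 1
  funext a
  by_cases h : a = k
  · subst h
    simp
  · simp [h]

theorem refl_mul_apply (k a b : Fin n) (u : GL (Fin n) R) :
    ((refl k : GL (Fin n) R) * u).val a b = (if a = k then (-1 : R) else 1) * u.val a b := by
  rw [Units.val_mul, val_refl, diagonal_mul]

theorem mul_refl_apply (k a b : Fin n) (u : GL (Fin n) R) :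
    (u * (refl k : GL (Fin n) R)).val a b = u.val a b * (if b = k then (-1 : R) else 1) := by
  rw [Units.val_mul, val_refl, mul_diagonal]

theorem apply_eq_zero_of_commute_refl (h2 : (2 : R) ≠ 0) {u : GL (Fin n) R} {k a b : Fin n}
    (h : Commute u (refl k)) (hab : a ≠ b) (hk : a = k ∨ b = k) : u.val a b = 0 := by
  have h1 := congrArg (fun g : GL (Fin n) R => g.val a b) h.eq
  simp only [refl_mul_apply, mul_refl_apply] at h1
  have h3 : (2 : R) * u.val a b = 0 := by
    rcases hk with rfl | rfl
    · rw [if_pos rfl, if_neg hab.symm] at h1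
      linear_combination h1
    · rw [if_pos rfl, if_neg hab] at h1
      linear_combination -h1
  exact (mul_eq_zero.1 h3).resolve_left h2

/-- Commuting with a reflection kills the off-diagonal entries in its row and column. Since the
reflections will lie in `H`, this makes the diagonal group definable. -/
theorem exists_dg_of_commute_refl (h2 : (2 : R) ≠ 0) {u : GL (Fin n) R}
    (h : ∀ k, Commute u (refl k)) : ∃ d, u = dg d := by
  have h1 : u.val = diagonal fun a => u.val a a := by
    ext a b
    by_cases hab : a = b
    · subst hab
      simp
    · rw [diagonal_apply_ne _ hab]
      exact apply_eq_zero_of_commute_refl h2 (h a) hab (Or.inl rfl)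
  obtain ⟨d, hd, -⟩ := exists_dg_of_val_eq_diagonal h1
  exact ⟨d, hd⟩

theorem commute_transv_refl (hij : i ≠ j) (r : R) (hki : k ≠ i) (hkj : k ≠ j) :
    Commute (transv hij r) (refl k) := by
  have h := dg_conj_transv (fun a => Units.map (Int.castRingHom R).toMonoidHom
    ((Function.update 1 k (-1) : Fin n → ℤˣ) a)) hij r
  rw [mul_inv_eq_iff_eq_mul] at h
  refine (Eq.trans h ?_).symm
  congr 2
  simp [hki.symm, hkj.symm]

/-- The elements inverted by a reflection and commuting with all but one other reflection. -/
def IsInvertedBlock (i j : Fin n) (u : GL (Fin n) R) : Prop :=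
  (∀ k, k ≠ i → k ≠ j → Commute u (refl k)) ∧ refl i * u * refl i * u = 1

theorem isInvertedBlock_transv (hij : i ≠ j) (r : R) : IsInvertedBlock i j (transv hij r) := by
  refine ⟨fun k hki hkj => commute_transv_refl hij r hki hkj, ?_⟩
  have h := dg_conj_transv (fun a => Units.map (Int.castRingHom R).toMonoidHom
    ((Function.update 1 i (-1) : Fin n → ℤˣ) a)) hij r
  have h1 : (refl i : GL (Fin n) R)⁻¹ = refl i := inv_eq_of_mul_eq_one_left (sgn_mul_self _)
  change refl i * transv hij r * (refl i)⁻¹ = _ at h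
  rw [h1] at h
  rw [h, ← transv_add, ← transv_zero hij]
  congr 1
  simp [hij.symm]

theorem isInvertedBlock_transv_symm (hij : i ≠ j) (r : R) :
    IsInvertedBlock i j (transv hij.symm r) := by
  refine ⟨fun k hki hkj => commute_transv_refl hij.symm r hkj hki, ?_⟩
  have h := dg_conj_transv (fun a => Units.map (Int.castRingHom R).toMonoidHom
    ((Function.update 1 i (-1) : Fin n → ℤˣ) a)) hij.symm r
  have h1 : (refl i : GL (Fin n) R)⁻¹ = refl i := inv_eq_of_mul_eq_one_left (sgn_mul_self _)
  change refl i * transv hij.symm r * (refl i)⁻¹ = _ at h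
  rw [h1] at h
  rw [h, ← transv_add, ← transv_zero hij.symm]
  congr 1
  simp [hij.symm]

namespace IsInvertedBlock

variable {u : GL (Fin n) R}

theorem apply_eq_zero (h : IsInvertedBlock i j u) (h2 : (2 : R) ≠ 0) {a b : Fin n} (hab : a ≠ b)
    (h1 : ¬ (a = i ∧ b = j)) (h3 : ¬ (a = j ∧ b = i)) : u.val a b = 0 := by
  by_cases ha : a = i ∨ a = j
  · have hb : b ≠ i ∧ b ≠ j := by grind
    exact apply_eq_zero_of_commute_refl h2 (h.1 b hb.1 hb.2) hab (Or.inr rfl)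
  · push Not at ha
    exact apply_eq_zero_of_commute_refl h2 (h.1 a ha.1 ha.2) hab (Or.inl rfl)

theorem mul_apply (h : IsInvertedBlock i j u) (h2 : (2 : R) ≠ 0) (hij : i ≠ j)
    (w : GL (Fin n) R) (b : Fin n) :
    (w * u).val b i = w.val b i * u.val i i + w.val b j * u.val j i ∧
    (w * u).val b j = w.val b i * u.val i j + w.val b j * u.val j j ∧
    ∀ k, k ≠ i → k ≠ j → (w * u).val b k = w.val b k * u.val k k := by
  refine ⟨?_, ?_, fun k hki hkj => ?_⟩
  · rw [Units.val_mul, Matrix.mul_apply]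
    refine Fintype.sum_eq_add i j hij fun x hx => ?_
    rw [h.apply_eq_zero h2 (a := x) (b := i) hx.1 (by grind) (by grind), mul_zero]
  · rw [Units.val_mul, Matrix.mul_apply]
    refine Fintype.sum_eq_add i j hij fun x hx => ?_
    rw [h.apply_eq_zero h2 (a := x) (b := j) hx.2 (by grind) (by grind), mul_zero]
  · rw [Units.val_mul, Matrix.mul_apply]
    refine Fintype.sum_eq_single k fun x hx => ?_
    rw [h.apply_eq_zero h2 (a := x) (b := k) hx (by grind) (by grind), mul_zero]

/-- Outside the block `i, j` the matrix is diagonal, and being inverted by the reflection makes all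
diagonal entries square to 1 when the off-diagonal product vanishes. Squaring removes these signs
and leaves a unipotent matrix. -/
theorem mul_self_eq (h : IsInvertedBlock i j u) (h2 : (2 : R) ≠ 0) (hij : i ≠ j)
    (hbc : u.val i j * u.val j i = 0) :
    (u * u).val = 1 + single i j (u.val i j * (u.val i i + u.val j j)) +
      single j i (u.val j i * (u.val i i + u.val j j)) := by
  have hz : ∀ a b, a ≠ b → ¬ (a = i ∧ b = j) → ¬ (a = j ∧ b = i) → u.val a b = 0 :=
    fun a b h1 h3 h4 => h.apply_eq_zero h2 h1 h3 h4
  have hm := h.mul_apply h2 hij u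
  have hm' := h.mul_apply h2 hij (refl i * u * refl i)
  rw [h.2] at hm'
  simp only [mul_refl_apply, refl_mul_apply] at hm'
  have hii := (hm' i).1
  have hjj := (hm' j).2.1
  simp only [Units.val_one, one_apply_eq, if_true, if_neg hij.symm] at hii hjj
  have hkk : ∀ k, k ≠ i → k ≠ j → u.val k k * u.val k k = 1 := by
    intro k hki hkj
    have := (hm' k).2.2 k hki hkj
    simp only [Units.val_one, one_apply_eq, if_neg hki] at this
    linear_combination -this
  ext a b
  by_cases hbi : b = i
  · subst hbi
    rw [(hm a).1]
    by_cases ha : a = b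
    · subst ha
      simp [hij.symm]
      linear_combination -hii + 2 * hbc
    · by_cases ha' : a = j
      · subst ha'
        simp [hij, hij.symm]
        ring
      · rw [hz a b ha (by grind) (by grind), hz a j ha' (by grind) (by grind)]
        simp [ha, Ne.symm ha', Ne.symm ha, hij.symm]
  · by_cases hbj : b = j
    · subst hbj
      rw [(hm a).2.1]
      by_cases ha : a = b
      · subst ha
        simp [hij]
        linear_combination -hjj + 2 * hbc
      · by_cases ha' : a = i
        · subst ha'
          simp [hij, hij.symm]
          ring
        · rw [hz a b ha (by grind) (by grind), hz a i ha' (by grind) (by grind)]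
          simp [ha, Ne.symm ha', Ne.symm ha, hij]
    · rw [(hm a).2.2 b hbi hbj]
      by_cases ha : a = b
      · subst ha
        rw [hkk a hbi hbj]
        simp [Ne.symm hbi, Ne.symm hbj]
      · rw [hz a b ha (by grind) (by grind)]
        simp [ha, Ne.symm hbi, Ne.symm hbj]

theorem exists_mul_self_eq_transv_of_commute (h : IsInvertedBlock i j u) (h2 : (2 : R) ≠ 0)
    (hij : i ≠ j) {s : R} (hs : s ≠ 0) (hu : Commute u (transv hij s)) :
    ∃ r, u * u = transv hij r := by
  have hc : u.val j i = 0 := by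
    have h1 := congrArg (fun g : GL (Fin n) R => g.val j j) hu.eq
    simp only [Units.val_mul, val_transv, mul_add, add_mul, mul_one, one_mul, Matrix.add_apply] at h1
    simpa [hs, hij, hij.symm] using h1
  refine ⟨u.val i j * (u.val i i + u.val j j), Units.ext ?_⟩
  rw [h.mul_self_eq h2 hij (by rw [hc, mul_zero])]
  rw [hc, zero_mul, single_zero, add_zero]
  rfl

/-- Conjugation by the diagonal matrix scales the two off-diagonal entries of the block by `t` and
`t⁻¹`. Comparing the `(i, i)` entries of the two products gives `(t ^ 2 - 1) * (u i j * u j i) = 0`,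
so one of these entries vanishes. -/
theorem exists_mul_self_eq_transv (h : IsInvertedBlock i j u) (h2 : (2 : R) ≠ 0) (hij : i ≠ j)
    {t : Rˣ} (ht : (t : R) ^ 2 ≠ 1)
    (hu : Commute u (dg (Function.update 1 i t) * u * (dg (Function.update 1 i t))⁻¹)) :
    (∃ r, u * u = transv hij r) ∨ ∃ r, u * u = transv hij.symm r := by
  have hbc : u.val i j * u.val j i = 0 := by
    have e1 : ∀ x : GL (Fin n) R, ∀ b,
        (dg (Function.update 1 i t) * x).val i b = t * x.val i b := by
      intro x b
      rw [Units.val_mul, val_dg, diagonal_mul, Function.update_self]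
    have e2 : ∀ x : GL (Fin n) R, ∀ b,
        (dg (Function.update 1 i t) * x * (dg (Function.update 1 i t))⁻¹).val b i =
          (dg (Function.update 1 i t) * x).val b i * ((t⁻¹ : Rˣ) : R) := by
      intro x b
      rw [← dg_inv, Units.val_mul, val_dg, mul_diagonal]
      simp
    have e3 : ∀ x : GL (Fin n) R, ∀ b, b ≠ i →
        (dg (Function.update 1 i t) * x * (dg (Function.update 1 i t))⁻¹).val i b =
          t * x.val i b := by
      intro x b hb
      rw [← dg_inv, Units.val_mul, val_dg (Function.update 1 i t)⁻¹, mul_diagonal, e1]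
      simp [hb]
    have e4 : ∀ x : GL (Fin n) R, ∀ b, b ≠ i →
        (dg (Function.update 1 i t) * x).val b i = x.val b i := by
      intro x b hb
      rw [Units.val_mul, val_dg, diagonal_mul, Function.update_of_ne hb]
      simp
    have h1 := congrArg (fun g : GL (Fin n) R => g.val i i) hu.eq
    rw [(h.mul_apply h2 hij _ i).1, e2, e1, e3 _ _ hij.symm] at h1
    rw [Units.val_mul, Matrix.mul_apply, Fintype.sum_eq_add i j hij, e2, e2, e1, e4 _ _ hij.symm]
      at h1
    · have h3 : ((t : R) ^ 2 - 1) * (u.val i j * u.val j i) = 0 := by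
        have h4 : (t : R) * ((t⁻¹ : Rˣ) : R) = 1 := t.mul_inv
        linear_combination (-(t : R)) * h1 + (u.val i j * u.val j i) * h4
      exact (mul_eq_zero.1 h3).resolve_left (sub_ne_zero.2 ht)
    · intro x hx
      rw [h.apply_eq_zero h2 (a := i) (b := x) hx.1.symm (by grind) (by grind), zero_mul]
  have h1 := h.mul_self_eq h2 hij hbc
  rcases mul_eq_zero.1 hbc with h3 | h3
  · right
    refine ⟨u.val j i * (u.val i i + u.val j j), Units.ext (h1.trans ?_)⟩
    rw [h3, zero_mul, single_zero, add_zero]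
    rfl
  · left
    refine ⟨u.val i j * (u.val i i + u.val j j), Units.ext (h1.trans ?_)⟩
    rw [h3, zero_mul, single_zero, add_zero]
    rfl

end IsInvertedBlock

theorem not_commute_transv_symm (h2 : (2 : R) ≠ 0) (hij : i ≠ j) :
    ¬ Commute (transv hij (2 : R)) (transv hij.symm 2) := by
  intro h
  have h1 := congrArg (fun g : GL (Fin n) R => g.val i i) h.eq
  simp only [Units.val_mul, val_transv, mul_add, add_mul, mul_one, one_mul, Matrix.add_apply] at h1
  simp [hij, hij.symm, h2] at h1

/-! ### Simultaneous diagonalization of commuting involutions -/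

/-- Common eigenvectors span: a common eigenvector `v` of some of the involutions is half the sum of
`v + y v` and `v - y v`, which are eigenvectors for the next involution `y` too. A basis of common
eigenvectors gives the conjugating matrix. -/
theorem exists_conj_eq_sgn (h2 : (2 : R) ≠ 0) {ι : Type*} [Finite ι] (y : ι → GL (Fin n) R)
    (hy : ∀ a b, Commute (y a) (y b)) (hy2 : ∀ a, y a * y a = 1) :
    ∃ P : GL (Fin n) R, ∀ a, ∃ ε, P * y a * P⁻¹ = sgn ε := by
  classical
  have : Fintype ι := Fintype.ofFinite ι
  let W : Finset ι → Set (Fin n → R) := fun s =>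
    {v | ∀ a ∈ s, (y a).val.mulVec v = v ∨ (y a).val.mulVec v = -v}
  have hW : ∀ s, Submodule.span R (W s) = ⊤ := by
    intro s
    induction s using Finset.induction_on with
    | empty =>
      rw [eq_top_iff]
      exact fun v _ => Submodule.subset_span (by simp [W])
    | insert a s ha ih =>
      rw [eq_top_iff, ← ih, Submodule.span_le]
      intro v hv
      have hyy : ∀ v, (y a).val.mulVec ((y a).val.mulVec v) = v := by
        intro v
        rw [mulVec_mulVec, ← Units.val_mul, hy2, Units.val_one, one_mulVec]
      have hcomm : ∀ b v, (y b).val.mulVec ((y a).val.mulVec v) =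
          (y a).val.mulVec ((y b).val.mulVec v) := by
        intro b v
        rw [mulVec_mulVec, mulVec_mulVec, ← Units.val_mul, ← Units.val_mul, (hy b a).eq]
      have h1 : v + (y a).val.mulVec v ∈ W (insert a s) := by
        intro b hb
        rcases Finset.mem_insert.1 hb with rfl | hb
        · left
          rw [mulVec_add, hyy, add_comm]
        · rw [mulVec_add, hcomm]
          rcases hv b hb with h | h <;> rw [h]
          · exact Or.inl rfl
          · right
            rw [mulVec_neg, neg_add]
      have h3 : v - (y a).val.mulVec v ∈ W (insert a s) := by
        intro b hb
        rcases Finset.mem_insert.1 hb with rfl | hb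
        · right
          rw [mulVec_sub, hyy, neg_sub]
        · rw [mulVec_sub, hcomm]
          rcases hv b hb with h | h <;> rw [h]
          · exact Or.inl rfl
          · right
            rw [mulVec_neg, neg_sub, sub_neg_eq_add, neg_add_eq_sub]
      have h4 : v = (2 : R)⁻¹ • ((v + (y a).val.mulVec v) + (v - (y a).val.mulVec v)) := by
        rw [add_add_sub_cancel, ← two_smul R, smul_smul, inv_mul_cancel₀ h2, one_smul]
      rw [SetLike.mem_coe, h4]
      exact Submodule.smul_mem _ _ (Submodule.add_mem _ (Submodule.subset_span h1)
        (Submodule.subset_span h3))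
  have hspan := hW Finset.univ
  let b₀ := Module.Basis.ofSpan hspan.ge
  have : Fintype (LinearIndepOn.extend (linearIndepOn_empty R id) (Set.empty_subset (W Finset.univ))) :=
    FiniteDimensional.fintypeBasisIndex b₀
  let b : Module.Basis (Fin n) R (Fin n → R) := b₀.reindex (Fintype.equivFinOfCardEq (by
    rw [← Module.finrank_eq_card_basis b₀, Module.finrank_fin_fun]))
  have hb : ∀ k, b k ∈ W Finset.univ := by
    intro k
    rw [Module.Basis.reindex_apply]
    exact Module.Basis.ofSpan_subset hspan.ge ⟨_, rfl⟩
  let Q : GL (Fin n) R :=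
    { val := (Pi.basisFun R (Fin n)).toMatrix b
      inv := b.toMatrix (Pi.basisFun R (Fin n))
      val_inv := Module.Basis.toMatrix_mul_toMatrix_flip _ _
      inv_val := Module.Basis.toMatrix_mul_toMatrix_flip _ _ }
  have hQ : ∀ c k, Q.val c k = b k c := fun c k => rfl
  refine ⟨Q⁻¹, fun a => ?_⟩
  choose ε hε using fun k => (show ∃ e : ℤˣ, (y a).val.mulVec (b k) = ((e : ℤ) : R) • b k by
    rcases hb k a (Finset.mem_univ a) with h | h
    · exact ⟨1, by simpa using h⟩
    · exact ⟨-1, by simpa using h⟩)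
  refine ⟨ε, ?_⟩
  rw [inv_inv, mul_assoc, inv_mul_eq_iff_eq_mul]
  ext c k
  have h1 := congrFun (hε k) c
  rw [Units.val_mul, Units.val_mul, sgn, val_dg, mul_diagonal, hQ, Matrix.mul_apply]
  simp only [hQ]
  rw [mulVec, dotProduct] at h1
  rw [h1, Pi.smul_apply, smul_eq_mul, mul_comm]
  rfl

end Matrix.GeneralLinearGroup

/-! ### Elementary subgroups of general linear groups in standard position -/

section StandardPosition

open FirstOrder.Language Matrix Matrix.GeneralLinearGroup
open scoped commutatorElement

attribute [local instance] groupStructure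

theorem GroupTerm.of_mem_range {H G S β : Type*} [Group H] [Group G] {j : H →* G} {e : S → G}
    {x : G} (hx : x ∈ j.range) : GroupTerm j e fun _ : β → S => x := by
  obtain ⟨y, rfl⟩ := hx
  exact TermOver.param y

variable {n : ℕ} {R H : Type*} [Field R] [Group H] {j : H →* GL (Fin n) R}

/-- The sign matrices form a family of `2 ^ n` distinct commuting elements with square 1, so `H`
contains such a family. Diagonalized simultaneously, it becomes a family of `2 ^ n` distinct sign
matrices, that is, all of them. -/
theorem exists_conj_sgn_mem_range (h2 : (2 : R) ≠ 0) (hj : GroupElementary j) :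
    ∃ P : GL (Fin n) R, ∀ ε, sgn ε ∈ ((MulAut.conj P).toMonoidHom.comp j).range := by
  obtain ⟨y, hy1, hy2, hy3⟩ := hj.exists_family (β := Fin n → ℤˣ)
    (P := fun w => (∀ a b, Commute (w a) (w b)) ∧ (∀ a, w a * w a = 1) ∧
      ∀ a b, a ≠ b → ¬ w a = w b)
    (.and (.forall_finite fun a => .forall_finite fun b =>
        GroupTerm.commute (TermOver.var a) (TermOver.var b))
      (.and (.forall_finite fun a =>
          .eq (GroupTerm.mul (TermOver.var a) (TermOver.var a)) GroupTerm.one)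
        (.forall_finite fun a => .forall_finite fun b => .imp (.const _)
          (.not (.eq (TermOver.var a) (TermOver.var b))))))
    ⟨sgn, commute_sgn, sgn_mul_self, fun a b hab h => hab (sgn_injective h2 h)⟩
  obtain ⟨P, hP⟩ := exists_conj_eq_sgn h2 (fun a => j (y a)) hy1 hy2
  choose ε hε using hP
  have hinj : Function.Injective ε := by
    intro a b hab
    by_contra hne
    apply hy3 a b hne
    have := (hε a).trans ((congrArg sgn hab).trans (hε b).symm)
    exact mul_left_cancel (mul_right_cancel this)
  refine ⟨P, fun ε' => ?_⟩
  obtain ⟨a, rfl⟩ := (Finite.injective_iff_surjective.1 hinj) ε'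
  exact ⟨y a, hε a⟩

theorem groupDefinable_isInvertedBlock {S β : Type*} {e : S → GL (Fin n) R}
    (hs : ∀ ε, sgn ε ∈ j.range) (i k : Fin n) {t : (β → S) → GL (Fin n) R}
    (ht : GroupTerm j e t) : GroupDefinable j e fun s => IsInvertedBlock i k (t s) :=
  .and (.forall_finite fun _ => .imp (.const _) (.imp (.const _)
      (ht.commute (GroupTerm.of_mem_range (hs _)))))
    (.eq ((((GroupTerm.of_mem_range (hs _)).mul ht).mul (GroupTerm.of_mem_range (hs _))).mul ht) GroupTerm.one)

theorem groupDefinable_diagonal {S β : Type*} {e : S → GL (Fin n) R}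
    (hs : ∀ ε, sgn ε ∈ j.range) {t : (β → S) → GL (Fin n) R}
    (ht : GroupTerm j e t) : GroupDefinable j e fun s => ∀ k, Commute (t s) (refl k) :=
  .forall_finite fun _ => ht.commute (GroupTerm.of_mem_range (hs _))

theorem commute_dg_refl (d : Fin n → Rˣ) (k : Fin n) : Commute (dg d) (refl k) :=
  commute_dg _ _

/-- The definable conditions do not tell position `(i, k)` from `(k, i)`, so two elements are taken
at once. Their squares are transvections in one of these positions; as the squares do not commute,
both positions occur, with nonzero coefficients. -/
theorem exists_transv_mem_range [Infinite R] (h2 : (2 : R) ≠ 0) (hj : GroupElementary j)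
    (hs : ∀ ε, sgn ε ∈ j.range) {i k : Fin n} (hik : i ≠ k) :
    ∃ r : R, r ≠ 0 ∧ transv hik r ∈ j.range := by
  let D : GL (Fin n) R → Prop := fun u =>
    ∀ d : GL (Fin n) R, (∀ l, Commute d (refl l)) → Commute u (d * u * d⁻¹)
  have hD : ∀ a : Fin 2, GroupDefinable j id fun w : Fin 2 → GL (Fin n) R => D (w a) := fun a =>
    .forall_elem (P := fun (w : Fin 2 → GL (Fin n) R) d =>
      (∀ l, Commute d (refl l)) → Commute (w a) (d * w a * d⁻¹))
      (.imp (groupDefinable_diagonal hs (TermOver.var (Sum.inr ())))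
        (GroupTerm.commute (TermOver.var (Sum.inl a))
          (GroupTerm.mul (GroupTerm.mul (TermOver.var (Sum.inr ())) (TermOver.var (Sum.inl a)))
            (GroupTerm.inv (TermOver.var (Sum.inr ()))))))
  have hDt : ∀ {a b : Fin n} (hab : a ≠ b) (r : R), D (transv hab r) := by
    intro a b hab r d hd
    obtain ⟨d, rfl⟩ := exists_dg_of_commute_refl h2 hd
    rw [dg_conj_transv]
    exact commute_transv hab _ _
  obtain ⟨w, ⟨hw0, hw1⟩, hw2, hw3⟩ := hj.exists_family (β := Fin 2)
    (P := fun w => (IsInvertedBlock i k (w 0) ∧ IsInvertedBlock i k (w 1)) ∧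
      (D (w 0) ∧ D (w 1)) ∧ ¬ Commute (w 0 * w 0) (w 1 * w 1))
    (.and (.and (groupDefinable_isInvertedBlock hs i k (TermOver.var 0))
        (groupDefinable_isInvertedBlock hs i k (TermOver.var 1)))
      (.and (.and (hD 0) (hD 1)) (.not (GroupTerm.commute
        (GroupTerm.mul (TermOver.var 0) (TermOver.var 0)) (GroupTerm.mul (TermOver.var 1) (TermOver.var 1))))))
    -- The squares of these witnesses are the opposite transvections with coefficient 2, which do
    -- not commute.
    ⟨![transv hik 1, transv hik.symm 1], ⟨isInvertedBlock_transv hik 1,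
      isInvertedBlock_transv_symm hik 1⟩, ⟨hDt hik 1, hDt hik.symm 1⟩, by
        have := not_commute_transv_symm h2 hik
        rw [← one_add_one_eq_two, transv_add, transv_add] at this
        exact this⟩
  obtain ⟨t, ht⟩ : ∃ t : Rˣ, (t : R) ^ 2 ≠ 1 := by
    classical
    obtain ⟨t, ht⟩ := Infinite.exists_notMem_finset ({0, 1, -1} : Finset R)
    simp only [Finset.mem_insert, Finset.mem_singleton, not_or] at ht
    refine ⟨Units.mk0 t ht.1, fun h => ?_⟩
    rcases mul_self_eq_one_iff.1 ((sq t).symm.trans h) with h | h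
    · exact ht.2.1 h
    · exact ht.2.2 h
  have hcases : ∀ a : Fin 2, IsInvertedBlock i k (j (w a)) → D (j (w a)) →
      (∃ r, j (w a) * j (w a) = transv hik r) ∨ ∃ r, j (w a) * j (w a) = transv hik.symm r :=
    fun a h1 h3 => h1.exists_mul_self_eq_transv h2 hik ht (h3 _ fun l => commute_dg_refl _ l)
  simp only [Function.comp_apply] at hw0 hw1 hw2 hw3
  rcases hcases 0 hw0 hw2.1 with ⟨r, hr⟩ | ⟨r, hr⟩ <;>
    rcases hcases 1 hw1 hw2.2 with ⟨r', hr'⟩ | ⟨r', hr'⟩ <;> rw [hr, hr'] at hw3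
  · exact absurd (commute_transv hik _ _) hw3
  · refine ⟨r, ?_, w 0 * w 0, by rw [map_mul, hr]⟩
    rintro rfl
    rw [transv_zero] at hw3
    exact hw3 (Commute.one_left _)
  · refine ⟨r', ?_, w 1 * w 1, by rw [map_mul, hr']⟩
    rintro rfl
    rw [transv_zero] at hw3
    exact hw3 (Commute.one_right _)
  · exact absurd (commute_transv hik.symm _ _) hw3

/-- One nontrivial transvection in `H` serves as a parameter that excludes the opposite position.
The root subgroup is then the set of squares of the inverted blocks commuting with it; coefficients
can be halved, so nothing is lost by squaring. -/
theorem groupDefinable_transv (h2 : (2 : R) ≠ 0) (hs : ∀ ε, sgn ε ∈ j.range) {i k : Fin n}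
    (hik : i ≠ k) {r₀ : R} (hr₀ : r₀ ≠ 0) (h : transv hik r₀ ∈ j.range) {β : Type*} (b : β) :
    GroupDefinable j id fun w : β → GL (Fin n) R => ∃ r, w b = transv hik r := by
  refine (DefinableOver.exists_elem (P := fun (w : β → GL (Fin n) R) u =>
    IsInvertedBlock i k u ∧ Commute u (transv hik r₀) ∧ w b = u * u)
    (.and (groupDefinable_isInvertedBlock hs i k (TermOver.var (Sum.inr ())))
      (.and (GroupTerm.commute (TermOver.var (Sum.inr ())) (GroupTerm.of_mem_range h))
        (.eq (TermOver.var (Sum.inl b)) (GroupTerm.mul (TermOver.var (Sum.inr ()))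
          (TermOver.var (Sum.inr ()))))))).congr fun w => ?_
  constructor
  · rintro ⟨u, hu1, hu2, hu3⟩
    rw [hu3]
    exact hu1.exists_mul_self_eq_transv_of_commute h2 hik hr₀ hu2
  · rintro ⟨r, hr⟩
    have : NeZero (2 : R) := ⟨h2⟩
    refine ⟨transv hik (r / 2), isInvertedBlock_transv hik _, commute_transv hik _ _, ?_⟩
    rw [hr, ← transv_add, add_halves]

/-- An elementary subgroup of a general linear group which contains the sign matrices and the
elementary matrices of the prime field. -/
structure IsStandard (j : H →* GL (Fin n) R) : Prop where
  elementary : GroupElementary j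
  two_ne_zero : (2 : R) ≠ 0
  sgn_mem : ∀ ε, sgn ε ∈ j.range
  transv_mem : ∀ {i k : Fin n} (hik : i ≠ k), transv hik (1 : R) ∈ j.range

/-- A diagonal conjugation commutes with the sign matrices and can normalize one transvection in
each position of the row `o`. The transvections with coefficient 1 in the other positions are then
the only elements of their definable root subgroups with prescribed commutators, so they lie in `H`.
-/
theorem exists_isStandard [Infinite R] (hn : 3 ≤ n) (h2 : (2 : R) ≠ 0) (hj : GroupElementary j) :
    ∃ α : GL (Fin n) R ≃* GL (Fin n) R, IsStandard (α.toMonoidHom.comp j) := by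
  classical
  obtain ⟨P, hP⟩ := exists_conj_sgn_mem_range h2 hj
  have hj' := hj.comp_mulEquiv (MulAut.conj P)
  let o : Fin n := ⟨0, by omega⟩
  choose! r hr0 hr using fun k (hk : o ≠ k) => exists_transv_mem_range h2 hj' hP hk
  -- Conjugation multiplies the coefficient `r k` at `(o, k)` by `d o / d k`; the default value 1 at
  -- `o` makes the result 1.
  let d : Fin n → Rˣ := fun k => if h : r k ≠ 0 ∧ o ≠ k then Units.mk0 (r k) h.1 else 1
  let α : GL (Fin n) R ≃* GL (Fin n) R := (MulAut.conj P).trans (MulAut.conj (dg d))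
  let j' : H →* GL (Fin n) R := α.toMonoidHom.comp j
  have hj'' : GroupElementary j' := hj.comp_mulEquiv α
  have hmem : ∀ {x : GL (Fin n) R}, x ∈ ((MulAut.conj P).toMonoidHom.comp j).range →
      dg d * x * (dg d)⁻¹ ∈ j'.range := by
    rintro _ ⟨y, rfl⟩
    exact ⟨y, rfl⟩
  have hs : ∀ ε, sgn ε ∈ j'.range := by
    intro ε
    have h1 : Commute (dg d) (sgn ε) := commute_dg d _
    have := hmem (hP ε)
    rwa [h1.eq, mul_inv_cancel_right] at this
  have h1 : ∀ {k} (hk : o ≠ k), transv hk (1 : R) ∈ j'.range := by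
    intro k hk
    have := hmem (hr k hk)
    rw [dg_conj_transv] at this
    have e1 : d o = 1 := by simp [d]
    have e2 : (d k : R) = r k := by simp [d, hk, hr0 k hk]
    rw [e1, Units.val_one, one_mul, ← e2, Units.mul_inv] at this
    exact this
  have hU : ∀ {i k : Fin n} (hik : i ≠ k), GroupDefinable j' id
      fun w : Unit → GL (Fin n) R => ∃ r, w () = transv hik r := by
    intro i k hik
    obtain ⟨r, hr, hr'⟩ := exists_transv_mem_range h2 hj'' hs hik
    exact groupDefinable_transv h2 hs hik hr hr' ()
  have h3 : ∀ {i k : Fin n} (hi : o ≠ i) (hk : o ≠ k) (hik : i ≠ k),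
      transv hik (1 : R) ∈ j'.range := by
    intro i k hi hk hik
    refine hj''.mem_range_of_unique
      (P := fun x => (∃ r, x = transv hik r) ∧ ⁅transv hi (1 : R), x⁆ = transv hk 1)
      (.and (hU hik) (.eq (GroupTerm.commutator (GroupTerm.of_mem_range (h1 hi)) (TermOver.var ()))
        (GroupTerm.of_mem_range (h1 hk)))) ⟨⟨1, rfl⟩, ?_⟩ ?_
    · rw [commutator_transv hi hik hk, one_mul]
    · rintro _ ⟨⟨r, rfl⟩, hr⟩
      rw [commutator_transv hi hik hk, one_mul] at hr
      rw [transv_injective hk hr]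
  refine ⟨α, hj'', h2, hs, fun {i k} hik => ?_⟩
  by_cases hi : o = i
  · subst hi
    exact h1 hik
  by_cases hk : o = k
  · subst hk
    obtain ⟨l, hl1, hl2⟩ : ∃ l : Fin n, o ≠ l ∧ i ≠ l := by
      by_cases h : i.val = 1
      · exact ⟨⟨2, by omega⟩, by simp [o, Fin.ext_iff], by simp [Fin.ext_iff, h]⟩
      · exact ⟨⟨1, by omega⟩, by simp [o, Fin.ext_iff], by simp [Fin.ext_iff, h]⟩
    refine hj''.mem_range_of_unique
      (P := fun x => (∃ r, x = transv hik r) ∧ ⁅x, transv hl1 (1 : R)⁆ = transv hl2 1)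
      (.and (hU hik) (.eq (GroupTerm.commutator (TermOver.var ()) (GroupTerm.of_mem_range (h1 hl1)))
        (GroupTerm.of_mem_range (h3 hi hl1 hl2)))) ⟨⟨1, rfl⟩, ?_⟩ ?_
    · rw [commutator_transv hik hl1 hl2, one_mul]
    · rintro _ ⟨⟨r, rfl⟩, hr⟩
      rw [commutator_transv hik hl1 hl2, mul_one] at hr
      rw [transv_injective hl2 hr]
  · exact h3 hi hk hik

end StandardPosition

/-! ### The field of coefficients of an elementary subgroup -/

section CoefficientField

open FirstOrder.Language Matrix Matrix.GeneralLinearGroup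
open scoped commutatorElement

attribute [local instance] groupStructure

theorem Subgroup.commutatorElement_mem {G : Type*} [Group G] (K : Subgroup G) {x y : G}
    (hx : x ∈ K) (hy : y ∈ K) : ⁅x, y⁆ ∈ K :=
  K.mul_mem (K.mul_mem (K.mul_mem hx hy) (K.inv_mem hx)) (K.inv_mem hy)

theorem Fin.exists_ne_and_ne_of_three_le {n : ℕ} (hn : 3 ≤ n) (i k : Fin n) :
    ∃ l, i ≠ l ∧ k ≠ l := by
  obtain ⟨l, hl⟩ := Finset.exists_mem_notMem_of_card_lt_card
    (s := {i, k}) (t := (Finset.univ : Finset (Fin n))) (by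
      rw [Finset.card_univ, Fintype.card_fin]
      exact lt_of_le_of_lt Finset.card_le_two (by omega))
  simp only [Finset.mem_univ, true_and, Finset.mem_insert, Finset.mem_singleton, not_or] at hl
  exact ⟨l, Ne.symm hl.1, Ne.symm hl.2⟩

namespace IsStandard

variable {n : ℕ} {R H : Type*} [Field R] [Group H] {j : H →* GL (Fin n) R}

/-- Commutators with transvections of coefficient 1 change the row or the column and keep the
coefficient. The move goes through `(i, b)`; when `b = i`, a third index is inserted. -/
theorem transv_mem_of_transv_mem (hj : IsStandard j) (hn : 3 ≤ n) {i k a b : Fin n} (hik : i ≠ k)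
    (hab : a ≠ b) {r : R} (h : transv hik r ∈ j.range) : transv hab r ∈ j.range := by
  have right : ∀ {i k l : Fin n} (hik : i ≠ k) (hkl : k ≠ l) (hil : i ≠ l),
      transv hik r ∈ j.range → transv hil r ∈ j.range := by
    intro i k l hik hkl hil h
    have := j.range.commutatorElement_mem h (hj.transv_mem hkl)
    rwa [commutator_transv hik hkl hil, mul_one] at this
  have left : ∀ {i k l : Fin n} (hik : i ≠ k) (hli : l ≠ i) (hlk : l ≠ k),
      transv hik r ∈ j.range → transv hlk r ∈ j.range := by
    intro i k l hik hli hlk h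
    have := j.range.commutatorElement_mem (hj.transv_mem hli) h
    rwa [commutator_transv hli hik hlk, one_mul] at this
  have key : ∀ {i k a b : Fin n} (hik : i ≠ k) (hab : a ≠ b), b ≠ i →
      transv hik r ∈ j.range → transv hab r ∈ j.range := by
    intro i k a b hik hab hbi h
    have h1 : transv hbi.symm r ∈ j.range := by
      by_cases hkb : k = b
      · subst hkb
        exact h
      · exact right hik hkb hbi.symm h
    by_cases hai : a = i
    · subst hai
      exact h1
    · exact left hbi.symm hai hab h1
  by_cases hbi : b = i
  · subst hbi
    obtain ⟨l, hl, hl'⟩ := Fin.exists_ne_and_ne_of_three_le hn b a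
    exact key hl'.symm hab hl (key hik hl'.symm hab h)
  · exact key hik hab hbi h

/-- The field of coefficients of an elementary subgroup in standard position. -/
def coeffSubfield (hj : IsStandard j) (hn : 3 ≤ n) : Subfield R where
  carrier := {r | ∀ {i k : Fin n} (hik : i ≠ k), transv hik r ∈ j.range}
  one_mem' := hj.transv_mem
  zero_mem' hik := by
    rw [transv_zero]
    exact j.range.one_mem
  add_mem' ha hb _ _ hik := by
    rw [transv_add]
    exact j.range.mul_mem (ha hik) (hb hik)
  neg_mem' ha _ _ hik := by
    rw [transv_neg]
    exact j.range.inv_mem (ha hik)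
  mul_mem' {r s} ha hb i k hik := by
    obtain ⟨l, hl, hl'⟩ := Fin.exists_ne_and_ne_of_three_le hn i k
    rw [← commutator_transv hl hl'.symm hik]
    exact j.range.commutatorElement_mem (ha hl) (hb hl'.symm)
  inv_mem' r hr i k hik := by
    by_cases h0 : r = 0
    · subst h0
      rw [_root_.inv_zero, transv_zero]
      exact j.range.one_mem
    obtain ⟨l, hl, hl'⟩ := Fin.exists_ne_and_ne_of_three_le hn i k
    -- The transvection with coefficient `r⁻¹` is the only element of its root subgroup whose
    -- commutator with the one of coefficient `r` has coefficient 1.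
    refine hj.elementary.mem_range_of_unique
      (P := fun x => (∃ s, x = transv hik s) ∧ ⁅x, transv hl' r⁆ = transv hl 1)
      (.and (groupDefinable_transv hj.two_ne_zero hj.sgn_mem hik one_ne_zero
          (hj.transv_mem hik) ())
        (.eq (GroupTerm.commutator (TermOver.var ()) (GroupTerm.of_mem_range (hr hl')))
          (GroupTerm.of_mem_range (hj.transv_mem hl)))) ⟨⟨_, rfl⟩, ?_⟩ ?_
    · rw [commutator_transv hik hl' hl, inv_mul_cancel₀ h0]
    · rintro _ ⟨⟨s, rfl⟩, hs⟩
      rw [commutator_transv hik hl' hl] at hs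
      rw [eq_inv_of_mul_eq_one_left (transv_injective hl hs)]

theorem mem_coeffSubfield_iff (hj : IsStandard j) (hn : 3 ≤ n) {i k : Fin n} (hik : i ≠ k) (r : R) :
    r ∈ hj.coeffSubfield hn ↔ transv hik r ∈ j.range :=
  ⟨fun h => h hik, fun h _ _ hab => hj.transv_mem_of_transv_mem hn hik hab h⟩

/-- `R` is interpreted in `GL n R` on one root subgroup: sums are products of transvections, and
products are iterated commutators with parameters of coefficient 1 from `H`. The points in `H` are
the coefficient field. -/
theorem fieldElementary_subtype (hj : IsStandard j) (hn : 3 ≤ n) :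
    FieldElementary (hj.coeffSubfield hn).subtype := by
  have h01 : (⟨0, by omega⟩ : Fin n) ≠ ⟨1, by omega⟩ := by simp
  have h12 : (⟨1, by omega⟩ : Fin n) ≠ ⟨2, by omega⟩ := by simp
  have h02 : (⟨0, by omega⟩ : Fin n) ≠ ⟨2, by omega⟩ := by simp
  refine FieldElementary.of_interpretation hj.elementary (transv_injective h01)
    ((groupDefinable_transv hj.two_ne_zero hj.sgn_mem h01 one_ne_zero
      (hj.transv_mem h01) ()).congr fun w => ⟨fun ⟨r, hr⟩ => ⟨r, hr.symm⟩, fun ⟨r, hr⟩ =>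
        ⟨r, hr.symm⟩⟩) (transv_add h01) (hj.transv_mem h01) ?_ _
    (fun a => (hj.mem_coeffSubfield_iff hn h01 a).1 a.2)
    (fun s hs => ⟨⟨s, (hj.mem_coeffSubfield_iff hn h01 s).2 hs⟩, rfl⟩)
  have h : ∀ r s : R, transv h01 (r * s) = ⁅⁅transv h01 r, transv h12 (1 : R)⁆,
      ⁅transv h02.symm (1 : R), transv h01 s⁆⁆ := by
    intro r s
    rw [commutator_transv h01 h12 h02, commutator_transv h02.symm h01 h12.symm,
      commutator_transv h02 h12.symm h01, mul_one, one_mul]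
  simp only [h]
  exact GroupTerm.commutator
    (GroupTerm.commutator (TermOver.var (0 : Fin 2)) (GroupTerm.of_mem_range (hj.transv_mem h12)))
    (GroupTerm.commutator (GroupTerm.of_mem_range (hj.transv_mem h02.symm))
      (TermOver.var (1 : Fin 2)))

/-- The coefficients embed in `H` through a root subgroup, so the field has a copy in the universe
of `H`. -/
theorem exists_coefficientField {H : Type v} [Group H] {j : H →* GL (Fin n) R}
    (hj : IsStandard j) (hn : 3 ≤ n) :
    ∃ (L : Type v) (_ : Field L) (ι : L →+* R), FieldElementary ι ∧
      ∀ {i k : Fin n} (hik : i ≠ k) (r : R), transv hik r ∈ j.range ↔ ∃ x, ι x = r := by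
  have h01 : (⟨0, by omega⟩ : Fin n) ≠ ⟨1, by omega⟩ := by simp
  choose f hf using fun r : hj.coeffSubfield hn => (hj.mem_coeffSubfield_iff hn h01 r).1 r.2
  have : Small.{v} (hj.coeffSubfield hn) := small_of_injective (f := f) fun a b hab =>
    Subtype.ext (transv_injective h01 (by rw [← hf, ← hf, hab]))
  refine ⟨Shrink.{v} (hj.coeffSubfield hn), inferInstance, _,
    (hj.fieldElementary_subtype hn).comp_ringEquiv (Shrink.ringEquiv _), fun hik r => ?_⟩
  rw [← hj.mem_coeffSubfield_iff hn hik]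
  constructor
  · intro hr
    let r' : hj.coeffSubfield hn := ⟨r, hr⟩
    exact ⟨(Shrink.ringEquiv _).symm r',
      congrArg Subtype.val ((Shrink.ringEquiv (hj.coeffSubfield hn)).apply_symm_apply r')⟩
  · rintro ⟨x, rfl⟩
    exact (Shrink.ringEquiv (hj.coeffSubfield hn) x).2

end IsStandard

end CoefficientField

/-! ### Comparison of an elementary subgroup with the general linear group of its coefficients -/

namespace Matrix.GeneralLinearGroup

open scoped commutatorElement

variable {n : ℕ} {R L : Type*} [Field R] [Field L]

/-- Gaussian elimination: an invertible matrix is a diagonal one between two products of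
transvections. -/
theorem induction_on_dg {P : GL (Fin n) R → Prop} (hdg : ∀ d, P (dg d))
    (hl : ∀ {i k : Fin n} (hik : i ≠ k) r x, P x → P (transv hik r * x))
    (hr : ∀ {i k : Fin n} (hik : i ≠ k) r x, P x → P (x * transv hik r)) (g : GL (Fin n) R) :
    P g := by
  obtain ⟨l, l', D, hD⟩ := Pivot.exists_list_transvec_mul_diagonal_mul_list_transvec g.val
  let p : List (TransvectionStruct (Fin n) R) → GL (Fin n) R := fun l =>
    (l.map fun t => transv t.hij t.c).prod
  have hp : ∀ l, (p l).val = (l.map TransvectionStruct.toMatrix).prod := by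
    intro l
    induction l with
    | nil => rfl
    | cons t l ih =>
      rw [List.map_cons, List.prod_cons, ← ih]
      rfl
  have h1 : ((p l)⁻¹ * g * (p l')⁻¹).val = diagonal D := by
    rw [Units.val_mul, Units.val_mul, hD, ← hp, ← hp, mul_assoc, mul_assoc, mul_assoc,
      Units.mul_inv, mul_one, ← mul_assoc, Units.inv_mul, one_mul]
  obtain ⟨d, hd, -⟩ := exists_dg_of_val_eq_diagonal h1
  have h2 : g = p l * (dg d * p l') := by
    rw [← hd]
    group
  have h3 : ∀ l' x, P x → P (x * p l') := by
    intro l'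
    induction l' with
    | nil =>
      intro x hx
      simpa [p] using hx
    | cons t l' ih =>
      intro x hx
      have h4 : x * p (t :: l') = x * transv t.hij t.c * p l' := by
        simp only [p, List.map_cons, List.prod_cons, mul_assoc]
      rw [h4]
      exact ih _ (hr _ _ _ hx)
  have h4 : ∀ l x, P x → P (p l * x) := by
    intro l
    induction l with
    | nil =>
      intro x hx
      simpa [p] using hx
    | cons t l ih =>
      intro x hx
      have h4 : p (t :: l) * x = transv t.hij t.c * (p l * x) := by
        simp only [p, List.map_cons, List.prod_cons, mul_assoc]
      rw [h4]
      exact hl _ _ _ (ih _ hx)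
  rw [h2]
  exact h4 _ _ (h3 _ _ (hdg d))

theorem map_transv (ι : L →+* R) {i k : Fin n} (hik : i ≠ k) (r : L) :
    map ι (transv hik r) = transv hik (ι r) := by
  ext a b
  simp [val_transv, Matrix.one_apply, Matrix.single_apply, apply_ite ι]

theorem map_dg (ι : L →+* R) (d : Fin n → Lˣ) :
    map ι (dg d) = dg fun a => Units.map ι.toMonoidHom (d a) := by
  ext a b
  simp [val_dg, Matrix.diagonal_apply, apply_ite ι]

theorem scalar_mul_dg (a : Rˣ) (d : Fin n → Rˣ) :
    scalar (Fin n) a * dg d = dg fun k => a * d k := by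
  rw [← dg_const, ← dg_mul]
  rfl

theorem dg_pow (d : Fin n → Rˣ) (N : ℕ) : dg d ^ N = dg (d ^ N) := by
  induction N with
  | zero => rw [pow_zero, pow_zero, dg_one]
  | succ N ih => rw [pow_succ, pow_succ, dg_mul, ih]

theorem commutator_scalar_mul (a b : Rˣ) (x y : GL (Fin n) R) :
    ⁅scalar (Fin n) a * x, scalar (Fin n) b * y⁆ = ⁅x, y⁆ := by
  have hc : ∀ (c : Rˣ) (z : GL (Fin n) R), Commute (scalar (Fin n) c) z := fun c z =>
    scalar_commute c z
  have h1 : scalar (Fin n) a * x * (scalar (Fin n) b * y) =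
      ⁅x, y⁆ * (scalar (Fin n) b * y * (scalar (Fin n) a * x)) := by
    rw [(hc b x).symm.mul_mul_mul_comm, (hc a y).symm.mul_mul_mul_comm, ← map_mul, ← map_mul,
      mul_comm b a, ← mul_assoc ⁅x, y⁆, ← (hc _ ⁅x, y⁆).eq, mul_assoc (scalar (Fin n) _) ⁅x, y⁆,
      commutatorElement_def]
    group
  rw [commutatorElement_def (scalar (Fin n) a * x), h1]
  group

/-- Permutation matrices. -/
def perm (σ : Equiv.Perm (Fin n)) : GL (Fin n) R where
  val := σ.permMatrix R
  inv := σ⁻¹.permMatrix R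
  val_inv := by rw [← Matrix.permMatrix_mul, inv_mul_cancel, Matrix.permMatrix_one]
  inv_val := by rw [← Matrix.permMatrix_mul, mul_inv_cancel, Matrix.permMatrix_one]

theorem commutator_dg_perm (d : Fin n → Rˣ) (σ : Equiv.Perm (Fin n)) :
    ⁅dg d, perm σ⁆ = dg (d * (d ∘ σ)⁻¹) := by
  have h : (dg (d ∘ σ)) * perm σ = perm σ * dg d := by
    ext a b
    rw [Units.val_mul, Units.val_mul, val_dg, val_dg, diagonal_mul, mul_diagonal]
    simp only [perm, Equiv.Perm.permMatrix, PEquiv.toMatrix_apply, Equiv.toPEquiv_apply,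
      Option.mem_def, Option.some.injEq, Function.comp_apply]
    split_ifs with h
    · rw [h, mul_one, one_mul]
    · rw [mul_zero, zero_mul]
  rw [commutatorElement_def, dg_mul, dg_inv, mul_assoc, mul_assoc]
  congr 1
  rw [eq_mul_inv_of_mul_eq h]
  group

end Matrix.GeneralLinearGroup

/-! ### Agreement up to scalars of `H` and `GL n L` -/

section Coefficients

open FirstOrder.Language Matrix Matrix.GeneralLinearGroup
open scoped commutatorElement

attribute [local instance] groupStructure

/-- The field embedding `ι` parametrizes the coefficients of the elementary subgroup given
by `j`. -/
structure IsCoefficientMap {n : ℕ} {R L H : Type*} [Field R] [Field L] [Group H]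
    (j : H →* GL (Fin n) R) (ι : L →+* R) : Prop where
  isStandard : IsStandard j
  transv_mem_iff : ∀ {i k : Fin n} (hik : i ≠ k) (r : R), transv hik r ∈ j.range ↔ ∃ x, ι x = r

namespace IsCoefficientMap

variable {n : ℕ} {R L H : Type*} [Field R] [Field L] [Group H] {j : H →* GL (Fin n) R}
  {ι : L →+* R}

theorem map_transv_mem (h : IsCoefficientMap j ι) {i k : Fin n} (hik : i ≠ k) (x : L) :
    map ι (transv hik x) ∈ j.range := by
  rw [map_transv]
  exact (h.transv_mem_iff hik _).2 ⟨x, rfl⟩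

/-- Conjugating transvections with coefficient 1 by the diagonal matrix shows that the ratios of its
entries are coefficients of `H`. The scalar is then one of the entries. -/
theorem exists_eq_scalar_mul_of_dg (h : IsCoefficientMap j ι) (d : Fin n → Rˣ)
    (hd : dg d ∈ j.range) : ∃ (a : Rˣ) (g : GL (Fin n) L), dg d = scalar (Fin n) a * map ι g := by
  rcases isEmpty_or_nonempty (Fin n) with hn | ⟨⟨o⟩⟩
  · exact ⟨1, 1, Subsingleton.elim _ _⟩
  have h1 : ∀ k, ∃ y : Lˣ, Units.map ι.toMonoidHom y = (d o)⁻¹ * d k := by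
    intro k
    by_cases hk : k = o
    · subst hk
      exact ⟨1, by rw [map_one, inv_mul_cancel]⟩
    · have h2 := j.range.mul_mem (j.range.mul_mem hd (h.isStandard.transv_mem hk))
        (j.range.inv_mem hd)
      rw [dg_conj_transv, h.transv_mem_iff] at h2
      obtain ⟨y, hy⟩ := h2
      have hy0 : y ≠ 0 := by
        rintro rfl
        rw [map_zero, mul_one] at hy
        exact (d k * (d o)⁻¹).ne_zero hy.symm
      refine ⟨Units.mk0 y hy0, Units.ext (hy.trans ?_)⟩
      rw [mul_one, mul_comm]
      rfl
  choose y hy using h1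
  refine ⟨d o, dg y, ?_⟩
  rw [map_dg, scalar_mul_dg]
  simp only [hy, mul_inv_cancel_left]

/-- Definable sets whose elements are, in an elementary subgroup, proportional to matrices over the
field of coefficients. -/
def IsProportional (j : H →* GL (Fin n) R) (ι : L →+* R) (Q : GL (Fin n) R → Prop) : Prop :=
  GroupDefinable j id (fun w : Unit → GL (Fin n) R => Q (w ())) ∧
    ∀ x ∈ j.range, Q x → ∃ (a : Rˣ) (g : GL (Fin n) L), x = scalar (Fin n) a * map ι g

theorem isProportional_diagonal (h : IsCoefficientMap j ι) :
    IsProportional j ι fun x => ∀ k, Commute x (refl k) := by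
  refine ⟨groupDefinable_diagonal h.isStandard.sgn_mem (TermOver.var ()), fun x hx hd => ?_⟩
  obtain ⟨d, rfl⟩ := exists_dg_of_commute_refl h.isStandard.two_ne_zero hd
  exact h.exists_eq_scalar_mul_of_dg d hx

theorem _root_.IsStandard.groupDefinable_transv (h : IsStandard j) {i k : Fin n} (hik : i ≠ k)
    {β : Type*} (b : β) :
    GroupDefinable j id fun w : β → GL (Fin n) R => ∃ r, w b = transv hik r :=
  _root_.groupDefinable_transv h.two_ne_zero h.sgn_mem hik one_ne_zero (h.transv_mem hik) b

/-- For `x` in `H` the transvection carrying `x` into `Q` can be chosen in `H` by elementarity; its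
coefficient then comes from `L`. -/
theorem isProportional_transv_mul (h : IsCoefficientMap j ι) {Q : GL (Fin n) R → Prop}
    (hQ : IsProportional j ι Q) {i k : Fin n} (hik : i ≠ k) :
    IsProportional j ι fun x => ∃ u, (∃ r, u = transv hik r) ∧ Q (u * x) := by
  refine ⟨.exists_elem (P := fun (w : Unit → GL (Fin n) R) u =>
    (∃ r, u = transv hik r) ∧ Q (u * w ())) (.and (h.isStandard.groupDefinable_transv hik _)
      (DefinableOver.subst hQ.1 (t := fun _ w => w (Sum.inr ()) * w (Sum.inl ()))
        fun _ => GroupTerm.mul (TermOver.var _) (TermOver.var _))), fun x hx hux => ?_⟩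
  obtain ⟨m, ⟨r, hr⟩, hm⟩ := h.isStandard.elementary.exists_elem
    (P := fun u => (∃ r, u = transv hik r) ∧ Q (u * x))
    (.and (h.isStandard.groupDefinable_transv hik _)
      (DefinableOver.subst hQ.1 (t := fun _ w => w () * x)
        fun _ => GroupTerm.mul (TermOver.var _) (GroupTerm.of_mem_range hx))) hux
  obtain ⟨y, rfl⟩ := (h.transv_mem_iff hik r).1 ⟨m, hr⟩
  obtain ⟨a, g, hag⟩ := hQ.2 _ (j.range.mul_mem ⟨m, rfl⟩ hx) hm
  refine ⟨a, (transv hik y)⁻¹ * g, ?_⟩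
  rw [map_mul, map_inv, map_transv, ← hr, ← mul_assoc, scalar_commute a, mul_assoc, ← hag,
    inv_mul_cancel_left]

theorem isProportional_mul_transv (h : IsCoefficientMap j ι) {Q : GL (Fin n) R → Prop}
    (hQ : IsProportional j ι Q) {i k : Fin n} (hik : i ≠ k) :
    IsProportional j ι fun x => ∃ u, (∃ r, u = transv hik r) ∧ Q (x * u) := by
  refine ⟨.exists_elem (P := fun (w : Unit → GL (Fin n) R) u =>
    (∃ r, u = transv hik r) ∧ Q (w () * u)) (.and (h.isStandard.groupDefinable_transv hik _)
      (DefinableOver.subst hQ.1 (t := fun _ w => w (Sum.inl ()) * w (Sum.inr ()))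
        fun _ => GroupTerm.mul (TermOver.var _) (TermOver.var _))), fun x hx hux => ?_⟩
  obtain ⟨m, ⟨r, hr⟩, hm⟩ := h.isStandard.elementary.exists_elem
    (P := fun u => (∃ r, u = transv hik r) ∧ Q (x * u))
    (.and (h.isStandard.groupDefinable_transv hik _)
      (DefinableOver.subst hQ.1 (t := fun _ w => x * w ())
        fun _ => GroupTerm.mul (GroupTerm.of_mem_range hx) (TermOver.var _))) hux
  obtain ⟨y, rfl⟩ := (h.transv_mem_iff hik r).1 ⟨m, hr⟩
  obtain ⟨a, g, hag⟩ := hQ.2 _ (j.range.mul_mem hx ⟨m, rfl⟩) hm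
  refine ⟨a, g * (transv hik y)⁻¹, ?_⟩
  rw [map_mul, map_inv, map_transv, ← hr, ← mul_assoc, ← hag, mul_inv_cancel_right]

/-- Eliminating `j x` uses transvections over `R`, but the pattern of positions is a definable
condition. So the elimination can be carried out with transvections of `H`, down to a diagonal
matrix of `H`. -/
theorem exists_eq_scalar_mul (h : IsCoefficientMap j ι) (x : H) :
    ∃ (a : Rˣ) (g : GL (Fin n) L), j x = scalar (Fin n) a * map ι g := by
  obtain ⟨Q, hQ, hx⟩ : ∃ Q, IsProportional j ι Q ∧ Q (j x) := by
    refine induction_on_dg (P := fun y => ∃ Q, IsProportional j ι Q ∧ Q y) (fun d =>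
      ⟨_, h.isProportional_diagonal, fun k => commute_dg_refl d k⟩) ?_ ?_ _
    · rintro i k hik r y ⟨Q, hQ, hy⟩
      refine ⟨_, h.isProportional_transv_mul hQ hik, transv hik (-r), ⟨-r, rfl⟩, ?_⟩
      rwa [transv_neg, inv_mul_cancel_left]
    · rintro i k hik r y ⟨Q, hQ, hy⟩
      refine ⟨_, h.isProportional_mul_transv hQ hik, transv hik (-r), ⟨-r, rfl⟩, ?_⟩
      rwa [transv_neg, mul_inv_cancel_right]
  exact hQ.2 _ ⟨x, rfl⟩ hx

/-- The diagonal matrix may fail to lie in `H`, but its conjugation action on the transvections with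
coefficient 1 is described by elements of `H`. A diagonal solution in `H` has the same action, hence
differs by a scalar. The exponent `N` controls the order of that scalar; `N = 0` imposes nothing. -/
theorem exists_scalar_mul_dg_mem (h : IsCoefficientMap j ι) (d : Fin n → Lˣ) {N : ℕ}
    (hd : d ^ N = 1) :
    ∃ c : Rˣ, c ^ N = 1 ∧ scalar (Fin n) c * map ι (dg d) ∈ j.range := by
  have hdN : map ι (dg d) ^ N = 1 := by rw [← map_pow, dg_pow, hd, dg_one, map_one]
  have hconj : ∀ {i k : Fin n} (hik : i ≠ k), map ι (dg d) * transv hik 1 * (map ι (dg d))⁻¹ =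
      map ι (transv hik (d i * (d k)⁻¹)) := by
    intro i k hik
    have h1 : transv hik (1 : R) = map ι (transv hik 1) := by rw [map_transv, map_one]
    rw [h1, ← map_inv, ← map_mul, ← map_mul, dg_conj_transv, mul_one]
  obtain ⟨m, hm1, hm2, hm3⟩ := h.isStandard.elementary.exists_elem
    (P := fun x => x ^ N = 1 ∧ (∀ k, Commute x (refl k)) ∧
      ∀ p : {p : Fin n × Fin n // p.1 ≠ p.2}, x * transv p.2 1 * x⁻¹ =
        map ι (transv p.2 (d p.1.1 * (d p.1.2)⁻¹)))
    (.and (.eq (GroupTerm.pow (TermOver.var ()) N) GroupTerm.one)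
      (.and (groupDefinable_diagonal h.isStandard.sgn_mem (TermOver.var ()))
        (.forall_finite fun p =>
          .eq (GroupTerm.mul (GroupTerm.mul (TermOver.var ())
            (GroupTerm.of_mem_range (h.isStandard.transv_mem p.2)))
            (GroupTerm.inv (TermOver.var ()))) (GroupTerm.of_mem_range (h.map_transv_mem p.2 _)))))
    ⟨map ι (dg d), hdN, by
      rw [map_dg]
      exact commute_dg_refl _, fun p => hconj p.2⟩
  obtain ⟨d', hd'⟩ := exists_dg_of_commute_refl h.isStandard.two_ne_zero hm2
  rcases isEmpty_or_nonempty (Fin n) with hn | ⟨⟨o⟩⟩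
  · exact ⟨1, one_pow _, 1, Subsingleton.elim _ _⟩
  have hsc : dg d' = scalar (Fin n) (d' o * (Units.map ι.toMonoidHom (d o))⁻¹) * map ι (dg d) := by
    rw [map_dg, scalar_mul_dg]
    congr 1
    funext k
    by_cases hk : o = k
    · subst hk
      rw [inv_mul_cancel_right]
    · have h1 := hm3 ⟨(o, k), hk⟩
      rw [hd', dg_conj_transv, map_transv] at h1
      have h2 := transv_injective hk h1
      rw [mul_one, map_mul] at h2
      have h3 : d' o * (d' k)⁻¹ = Units.map ι.toMonoidHom (d o) *
          (Units.map ι.toMonoidHom (d k))⁻¹ := by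
        rw [← map_inv]
        exact Units.ext h2
      rw [mul_inv_eq_iff_eq_mul] at h3
      rw [h3, mul_comm (Units.map ι.toMonoidHom (d o)), mul_comm _ (d' k)]
      group
  refine ⟨_, ?_, m, hd'.trans hsc⟩
  have hn : n ≠ 0 := by
    rintro rfl
    exact o.elim0
  apply scalar_injective hn
  rw [map_one, map_pow, ← hm1, hd', hsc, Commute.mul_pow (scalar_commute _ _), hdN, mul_one]

theorem exists_scalar_mul_map_mem (h : IsCoefficientMap j ι) (g : GL (Fin n) L) :
    ∃ c : Rˣ, scalar (Fin n) c * map ι g ∈ j.range := by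
  refine induction_on_dg (P := fun g => ∃ c : Rˣ, scalar (Fin n) c * map ι g ∈ j.range)
    (fun d => ?_) ?_ ?_ g
  · obtain ⟨c, -, hc⟩ := h.exists_scalar_mul_dg_mem d (pow_zero d)
    exact ⟨c, hc⟩
  · rintro i k hik r x ⟨c, hc⟩
    refine ⟨c, ?_⟩
    rw [map_mul, ← mul_assoc, scalar_commute c, mul_assoc]
    exact j.range.mul_mem (h.map_transv_mem hik r) hc
  · rintro i k hik r x ⟨c, hc⟩
    refine ⟨c, ?_⟩
    rw [map_mul, ← mul_assoc]
    exact j.range.mul_mem hc (h.map_transv_mem hik r)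

theorem map_commutator_mem (h : IsCoefficientMap j ι) (x y : GL (Fin n) L) :
    map ι ⁅x, y⁆ ∈ j.range := by
  obtain ⟨a, ha⟩ := h.exists_scalar_mul_map_mem x
  obtain ⟨b, hb⟩ := h.exists_scalar_mul_map_mem y
  rw [map_commutatorElement, ← commutator_scalar_mul a b]
  exact j.range.commutatorElement_mem ha hb

/-- `SL n L` is generated by transvections and by diagonal matrices with two mutually inverse
entries. The latter are commutators of a diagonal matrix with a transposition, and commutators over
`L` lie in `H` because scalars cancel. -/
theorem map_toGL_mem [Nontrivial (Fin n)] (h : IsCoefficientMap j ι) (g : SpecialLinearGroup (Fin n) L) :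
    map ι (SpecialLinearGroup.toGL g) ∈ j.range := by
  refine SpecialLinearGroup.diagonal_transvection_induction'
    (fun g => GeneralLinearGroup.map ι (SpecialLinearGroup.toGL g) ∈ j.range) g ?_
    (fun i k hik a => h.map_transv_mem hik a) fun a b ha hb => by
      rw [map_mul, map_mul]
      exact j.range.mul_mem ha hb
  intro i k hik c hc
  have h1 := h.map_commutator_mem (dg (Pi.mulSingle i (Units.mk0 c hc))) (perm (Equiv.swap i k))
  rw [commutator_dg_perm] at h1
  convert h1 using 2
  refine Units.ext ?_
  change (SpecialLinearGroup.diag2n hik c hc).1 = _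
  rw [SpecialLinearGroup.diag2n_coe, val_dg]
  congr 1
  funext a
  by_cases hai : a = i
  · subst hai
    simp [hik.symm]
  · by_cases hak : a = k
    · subst hak
      simp [hai]
    · simp [hai, hak, Equiv.swap_apply_of_ne_of_ne hai hak]

/-- Split off `diag(det g, 1, …, 1)` to reach `SL n L`. This factor has finite order, so it lies in
`H` up to a scalar of finite order, which lies in `H` as well. -/
theorem map_mem_of_isOfFinOrder_det (h : IsCoefficientMap j ι) (hn : 3 ≤ n)
    (hT : ∀ t : Rˣ, IsOfFinOrder t → scalar (Fin n) t ∈ j.range) {g : GL (Fin n) L}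
    (hg : IsOfFinOrder (det g)) : map ι g ∈ j.range := by
  obtain ⟨N, hN, hgN⟩ := isOfFinOrder_iff_pow_eq_one.1 hg
  have : Nontrivial (Fin n) := Fin.nontrivial_iff_two_le.2 (by omega)
  let o : Fin n := ⟨0, by omega⟩
  obtain ⟨c, hcN, hc⟩ := h.exists_scalar_mul_dg_mem (Pi.mulSingle o (det g)) (N := N) (by
    rw [← Pi.mulSingle_pow, hgN, Pi.mulSingle_one])
  have h1 : map ι (dg (Pi.mulSingle o (det g))) ∈ j.range := by
    have := j.range.mul_mem (j.range.inv_mem (hT c (isOfFinOrder_iff_pow_eq_one.2 ⟨N, hN, hcN⟩))) hc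
    rwa [inv_mul_cancel_left] at this
  have h2 : det ((dg (Pi.mulSingle o (det g)))⁻¹ * g) = 1 := by
    rw [map_mul, map_inv, det_dg, Finset.prod_pi_mulSingle']
    simp
  let s : SpecialLinearGroup (Fin n) L := ⟨((dg (Pi.mulSingle o (det g)))⁻¹ * g).val, by
    simpa using congrArg Units.val h2⟩
  have h3 : g = dg (Pi.mulSingle o (det g)) * SpecialLinearGroup.toGL s := by
    rw [← inv_mul_eq_iff_eq_mul]
    exact Units.ext rfl
  rw [h3, map_mul]
  exact j.range.mul_mem h1 (h.map_toGL_mem s)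

end IsCoefficientMap

end Coefficients

/-! ### Torsion in elementary extensions -/

section Torsion

open FirstOrder.Language Matrix Matrix.GeneralLinearGroup

attribute [local instance] groupStructure
attribute [local instance] FirstOrder.Ring.compatibleRingOfRing

theorem Units.val_pow_eq_one_iff {M : Type*} [Monoid M] (x : Mˣ) (m : ℕ) :
    (x : M) ^ m = 1 ↔ x ^ m = 1 := by
  rw [← Units.val_pow_eq_pow_val, Units.val_eq_one]

/-- With `N` the order of the torsion subgroup of `Fˣ`, a root of unity in `R` violating `x ^ N = 1`
would be reflected to one in `F`. -/
theorem FieldElementary.exists_torsion_exponent {F R : Type*} [Field F] [Field R] {ι : F →+* R}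
    (hι : FieldElementary ι) (hF : IsNFT F) :
    ∃ N : ℕ, N ≠ 0 ∧ (∀ x : Rˣ, IsOfFinOrder x → x ^ N = 1) ∧
      ∃ w : Fin N → R, Function.Injective w ∧ ∀ i, w i ^ N = 1 := by
  have : Finite (CommGroup.torsion Fˣ) := hF
  let N := Nat.card (CommGroup.torsion Fˣ)
  have hN : ∀ x : Fˣ, IsOfFinOrder x → x ^ N = 1 := fun x hx =>
    congrArg Subtype.val (pow_card_eq_one' (x := (⟨x, hx⟩ : CommGroup.torsion Fˣ)))
  refine ⟨N, Nat.card_pos.ne', fun x hx => ?_, ?_⟩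
  · obtain ⟨m, hm, hxm⟩ := isOfFinOrder_iff_pow_eq_one.1 hx
    by_contra hxN
    obtain ⟨y, hy1, hy2⟩ := hι.exists_elem (P := fun x => x ^ m = 1 ∧ ¬ x ^ N = 1)
      (.and (.eq (FieldTerm.pow (TermOver.var ()) m) FieldTerm.one)
        (.not (.eq (FieldTerm.pow (TermOver.var ()) N) FieldTerm.one)))
      ⟨x, (x.val_pow_eq_one_iff m).2 hxm, fun h => hxN ((x.val_pow_eq_one_iff N).1 h)⟩
    rw [← map_pow, map_eq_one_iff ι ι.injective] at hy1 hy2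
    have hy : IsUnit y := IsUnit.of_pow_eq_one hy1 hm.ne'
    obtain ⟨y, rfl⟩ := hy
    rw [Units.val_pow_eq_one_iff] at hy1 hy2
    exact hy2 (hN y (isOfFinOrder_iff_pow_eq_one.2 ⟨m, hm, hy1⟩))
  · let e := (Finite.equivFin (CommGroup.torsion Fˣ)).symm
    refine ⟨fun i => ι ((e i : Fˣ) : F), fun a b hab => ?_, fun i => ?_⟩
    · exact e.injective (Subtype.ext (Units.ext (ι.injective hab)))
    · rw [← map_pow, ← Units.val_pow_eq_pow_val, hN _ (e i).2, Units.val_one, map_one]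

theorem exists_eq_of_pow_eq_one {R : Type*} [Field R] {N : ℕ} (w : Fin N → R)
    (hw : Function.Injective w) (hw1 : ∀ i, w i ^ N = 1) {x : R} (hN : N ≠ 0) (hx : x ^ N = 1) :
    ∃ i, w i = x := by
  classical
  have hsub : Finset.univ.image w ⊆ Polynomial.nthRootsFinset N (1 : R) := by
    intro y hy
    obtain ⟨i, -, rfl⟩ := Finset.mem_image.1 hy
    exact (Polynomial.mem_nthRootsFinset (Nat.pos_of_ne_zero hN) _).2 (hw1 i)
  have heq := Finset.eq_of_subset_of_card_le hsub (by
    rw [Finset.card_image_of_injective _ hw, Finset.card_univ, Fintype.card_fin,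
      Polynomial.nthRootsFinset_def]
    exact (Multiset.toFinset_card_le _).trans (Polynomial.card_nthRoots _ _))
  have hx' := (Polynomial.mem_nthRootsFinset (Nat.pos_of_ne_zero hN) _).2 hx
  rw [← heq] at hx'
  obtain ⟨i, -, hi⟩ := Finset.mem_image.1 hx'
  exact ⟨i, hi⟩

theorem finite_torsion_units {R : Type*} [Field R] {N : ℕ} (hN : N ≠ 0)
    (h : ∀ x : Rˣ, IsOfFinOrder x → x ^ N = 1) : Finite (CommGroup.torsion Rˣ) := by
  have : NeZero N := ⟨hN⟩
  have : Finite (rootsOfUnity N R : Set Rˣ) := inferInstanceAs (Finite (rootsOfUnity N R))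
  exact Finite.Set.subset (rootsOfUnity N R : Set Rˣ) fun x hx => (mem_rootsOfUnity N x).2 (h x hx)

/-- Having `N` distinct roots of `X ^ N - 1` is first-order, so `L` has them, and there are no
others in `R`. -/
theorem FieldElementary.mem_range_of_pow_eq_one {L R : Type*} [Field L] [Field R] {ι : L →+* R}
    (hι : FieldElementary ι) {N : ℕ} (hN : N ≠ 0) {w : Fin N → R} (hw : Function.Injective w)
    (hw1 : ∀ i, w i ^ N = 1) {x : Rˣ} (hx : x ^ N = 1) : x ∈ (Units.map ι.toMonoidHom).range := by
  obtain ⟨w', hw', hw1'⟩ := hι.exists_family (β := Fin N)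
    (P := fun w => (∀ a b, a ≠ b → ¬ w a = w b) ∧ ∀ a, w a ^ N = 1)
    (.and (.forall_finite fun a => .forall_finite fun b => .imp (.const _)
      (.not (.eq (TermOver.var a) (TermOver.var b))))
      (.forall_finite fun a => .eq (FieldTerm.pow (TermOver.var a) N) FieldTerm.one))
    ⟨w, fun a b hab h => hab (hw h), hw1⟩
  obtain ⟨i, hi⟩ := exists_eq_of_pow_eq_one (ι ∘ w')
    (fun a b hab => by
      by_contra hne
      exact hw' a b hne hab) hw1' hN ((x.val_pow_eq_one_iff N).2 hx)
  have h0 : w' i ≠ 0 := by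
    intro h0
    rw [Function.comp_apply, h0, map_zero] at hi
    exact x.ne_zero hi.symm
  exact ⟨Units.mk0 (w' i) h0, Units.ext hi⟩

variable {n : ℕ} {R L H : Type*} [Field R] [Field L] [Group H] {j : H →* GL (Fin n) R}

theorem Matrix.GeneralLinearGroup.exists_scalar_of_commute_transv (hn : n ≠ 0) {g : GL (Fin n) R}
    (h : ∀ {i k : Fin n} (hik : i ≠ k), Commute g (transv hik 1)) :
    ∃ a, g = GeneralLinearGroup.scalar (Fin n) a := by
  have h1 : g.val ∈ Set.range (Matrix.scalar (Fin n)) := by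
    refine mem_range_scalar_of_commute_single fun i k hik => ?_
    have := congrArg Units.val (h hik).eq
    rw [Units.val_mul, Units.val_mul, val_transv, mul_add, add_mul, mul_one, one_mul] at this
    exact (add_left_cancel this).symm
  obtain ⟨r, hr⟩ := h1
  obtain ⟨d, rfl, hd⟩ := exists_dg_of_val_eq_diagonal (g := g) (D := fun _ => r) hr.symm
  refine ⟨d ⟨0, Nat.pos_of_ne_zero hn⟩, ?_⟩
  rw [← dg_const]
  congr 1
  funext k
  exact Units.ext ((hd _).trans (hd _).symm)

theorem IsStandard.exists_scalar_of_mem_center (hj : IsStandard j) (hn : n ≠ 0) {z : H}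
    (hz : z ∈ Subgroup.center H) : ∃ a, j z = GeneralLinearGroup.scalar (Fin n) a := by
  refine exists_scalar_of_commute_transv hn fun hik => ?_
  obtain ⟨y, hy⟩ := hj.transv_mem hik
  rw [← hy]
  exact Commute.map (Subgroup.mem_center_iff.1 hz y).symm j

theorem groupDefinable_central {β : Type*} (b : β) :
    GroupDefinable j id fun w : β → GL (Fin n) R => ∀ g, Commute (w b) g :=
  .forall_elem (P := fun (w : β → GL (Fin n) R) g => Commute (w b) g)
    (GroupTerm.commute (TermOver.var _) (TermOver.var _))

/-- By elementarity `H` contains `N` distinct elements, central in `GL n R`, whose `N`-th power is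
1. They are scalars and exhaust the `N`-th roots of unity. -/
theorem GroupElementary.scalar_mem_range_of_pow_eq_one (hj : GroupElementary j) (hn : n ≠ 0) {N : ℕ}
    (hN : N ≠ 0) {w : Fin N → R} (hw : Function.Injective w) (hw1 : ∀ i, w i ^ N = 1) {x : Rˣ}
    (hx : x ^ N = 1) : scalar (Fin n) x ∈ j.range := by
  have hu : ∀ i, ∃ u : Rˣ, (u : R) = w i := fun i => IsUnit.of_pow_eq_one (hw1 i) hN
  choose u hu using hu
  obtain ⟨z, hz, hz', hz1⟩ := hj.exists_family (β := Fin N)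
    (P := fun z => (∀ a b, a ≠ b → ¬ z a = z b) ∧ (∀ a g, Commute (z a) g) ∧ ∀ a, z a ^ N = 1)
    (.and (.forall_finite fun a => .forall_finite fun b => .imp (.const _)
      (.not (.eq (TermOver.var a) (TermOver.var b))))
      (.and (.forall_finite fun a => groupDefinable_central a)
        (.forall_finite fun a => .eq (GroupTerm.pow (TermOver.var a) N) GroupTerm.one)))
    ⟨fun i => scalar (Fin n) (u i), fun a b hab h => hab (hw (by
      rw [← hu, ← hu, scalar_injective hn h])), fun a g => scalar_commute _ _, fun a => by
        rw [← map_pow, ← map_one (GeneralLinearGroup.scalar (Fin n))]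
        exact congrArg _ (Units.ext (by rw [Units.val_pow_eq_pow_val, hu, hw1, Units.val_one]))⟩
  choose a ha using fun i => exists_scalar_of_commute_transv hn (g := j (z i))
    fun hik => hz' i (transv hik 1)
  obtain ⟨i, hi⟩ := exists_eq_of_pow_eq_one (fun i => (a i : R)) (fun b c hbc => by
      by_contra hne
      refine hz b c hne ?_
      rw [Function.comp_apply, Function.comp_apply, ha, ha, Units.ext hbc]) (fun i => by
        have := hz1 i
        rw [Function.comp_apply, ha, ← map_pow, ← map_one (GeneralLinearGroup.scalar (Fin n))] at this
        exact ((a i).val_pow_eq_one_iff N).2 (scalar_injective hn this)) hN ((x.val_pow_eq_one_iff N).2 hx)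
  exact ⟨z i, (ha i).trans (congrArg _ (Units.ext hi))⟩

end Torsion

/-! ### Elementary equivalence of complements of the torsion subgroup -/

section Complements

open FirstOrder.Language Matrix Matrix.GeneralLinearGroup

attribute [local instance] groupStructure
attribute [local instance] FirstOrder.Ring.compatibleRingOfRing

theorem GroupElemEquiv.of_mulEquiv {G G' : Type*} [Group G] [Group G'] (α : G ≃* G') :
    GroupElemEquiv G G' := by
  have h : GroupElementary (MonoidHom.id G) := ⟨ElementaryEmbedding.refl _ _, rfl⟩
  exact (h.comp_mulEquiv α).groupElemEquiv

section Retraction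

variable {M : Type*} [CommGroup M] {π : M →* M} {N : ℕ}

theorem pow_injective_ker_retraction (hπT : ∀ t, IsOfFinOrder t → π t = t) (hN : N ≠ 0) :
    Function.Injective fun r : π.ker => (r : M) ^ N := by
  intro r s hrs
  have h1 : IsOfFinOrder ((r : M) * (s : M)⁻¹) := isOfFinOrder_iff_pow_eq_one.2
    ⟨N, Nat.pos_of_ne_zero hN, by
      have : (r : M) ^ N = (s : M) ^ N := hrs
      rw [mul_pow, inv_pow, this, mul_inv_cancel]⟩
  have h2 := hπT _ h1
  rw [map_mul, map_inv, r.2, s.2, inv_one, mul_one] at h2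
  exact Subtype.ext (mul_inv_eq_one.1 h2.symm)

theorem exists_ker_retraction_pow_eq (hπ : ∀ x, IsOfFinOrder (π x))
    (hπT : ∀ t, IsOfFinOrder t → π t = t) (hN : ∀ t : M, IsOfFinOrder t → t ^ N = 1) (x : M) :
    ∃ r : π.ker, (r : M) ^ N = x ^ N := by
  refine ⟨⟨x * (π x)⁻¹, ?_⟩, ?_⟩
  · rw [MonoidHom.mem_ker, map_mul, map_inv, hπT _ (hπ x), mul_inv_cancel]
  · rw [mul_pow, inv_pow, hN _ (hπ x), inv_one, mul_one]

end Retraction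

variable {R : Type*} [Field R] {π : Rˣ →* Rˣ} {N : ℕ}

/-- The retraction is arbitrary, so `ker π` need not be definable. But the `N`-th power map is
injective on it and kills torsion, so it identifies `ker π` with the definable group of nonzero
`N`-th powers. -/
theorem FieldElementary.groupElemEquiv_ker {L : Type*} [Field L] {ι : L →+* R}
    (hι : FieldElementary ι) (hπ : ∀ x, IsOfFinOrder (π x))
    (hπT : ∀ t, IsOfFinOrder t → π t = t) (hN0 : N ≠ 0) (hN : ∀ t : Rˣ, IsOfFinOrder t → t ^ N = 1)
    (hT : ∀ t : Rˣ, IsOfFinOrder t → t ∈ (Units.map ι.toMonoidHom).range) :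
    GroupElemEquiv (π.comp (Units.map ι.toMonoidHom)).ker π.ker := by
  have hιu : Function.Injective (Units.map ι.toMonoidHom) := Units.map_injective ι.injective
  let e : π.ker → R := fun r => (((r : Rˣ) ^ N : Rˣ) : R)
  have he : Function.Injective e := fun r s hrs =>
    pow_injective_ker_retraction hπT hN0 (Units.ext hrs)
  let k : (π.comp (Units.map ι.toMonoidHom)).ker →* π.ker :=
    ((Units.map ι.toMonoidHom).comp (Subgroup.subtype _)).codRestrict π.ker fun a => a.2
  have hι' := hι
  obtain ⟨f, hf⟩ := hι
  refine GroupElementary.groupElemEquiv (j := k)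
    (GroupElementary.of_interpretation f (e := e) he ?_ ?_ k ?_ ?_ ?_)
  · refine (DefinableOver.exists_elem (P := fun (w : Unit → R) y => y ^ N = w () ∧ ¬ y = 0)
      (.and (.eq (FieldTerm.pow (TermOver.var _) N) (TermOver.var _))
        (.not (.eq (TermOver.var _) FieldTerm.zero)))).congr fun w => ?_
    constructor
    · rintro ⟨y, hy, hy0⟩
      obtain ⟨r, hr⟩ := exists_ker_retraction_pow_eq hπ hπT hN (Units.mk0 y hy0)
      exact ⟨r, (congrArg Units.val hr).trans hy⟩
    · rintro ⟨r, hr⟩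
      exact ⟨((r : Rˣ) : R), by rw [← hr]; simp [e], (r : Rˣ).ne_zero⟩
  · refine (DefinableOver.eq (FieldTerm.mul (TermOver.var (Sum.inl (0 : Fin 2)))
      (TermOver.var (Sum.inl 1))) (TermOver.var (Sum.inr ()))).congr fun s => ?_
    rw [← he.eq_iff]
    simp [e, mul_pow]
  · exact fun a b hab => Subtype.ext (hιu (congrArg Subtype.val hab))
  · intro a
    refine ⟨((a : Lˣ) : L) ^ N, ?_⟩
    rw [hf, map_pow]
    rfl
  · rintro s ⟨x, hx⟩
    rw [hf] at hx
    obtain ⟨y, hy⟩ := hι'.exists_elem (P := fun y => y ^ N = e s)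
      (.eq (FieldTerm.pow (TermOver.var _) N) ⟨(Term.var (Sum.inl x)), fun _ => hx⟩)
      ⟨((s : Rˣ) : R), by simp [e]⟩
    have hy0 : y ≠ 0 := by
      rintro rfl
      rw [map_zero, zero_pow hN0] at hy
      exact Units.ne_zero _ hy.symm
    have h1 : (Units.map ι.toMonoidHom (Units.mk0 y hy0)) ^ N = (s : Rˣ) ^ N := Units.ext (by
      rw [Units.val_pow_eq_pow_val]
      exact hy)
    -- Elementarity only gives some `N`-th root in `L`; it differs from `s` by a root of unity,
    -- which also lies in `L`.
    obtain ⟨t, ht⟩ := hT ((s : Rˣ) * (Units.map ι.toMonoidHom (Units.mk0 y hy0))⁻¹)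
      (isOfFinOrder_iff_pow_eq_one.2 ⟨N, Nat.pos_of_ne_zero hN0, by
        rw [mul_pow, inv_pow, h1, mul_inv_cancel]⟩)
    have h2 : Units.map ι.toMonoidHom (t * Units.mk0 y hy0) = s := by
      rw [map_mul, ht, inv_mul_cancel_right]
    refine ⟨⟨t * Units.mk0 y hy0, ?_⟩, Subtype.ext h2⟩
    rw [MonoidHom.mem_ker, MonoidHom.comp_apply, h2]
    exact s.2

/-- The same device in the group: `ker π` becomes the group of `N`-th powers of central elements of
`GL n R`, which is definable although the addition itself need not be. -/
theorem GroupElementary.groupElemEquiv_ker {n : ℕ} {H : Type*} [Group H] {j : H →* GL (Fin n) R}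
    (hj : GroupElementary j) (hn : n ≠ 0)
    (hc : ∀ z ∈ Subgroup.center H, ∃ a : Rˣ, j z = scalar (Fin n) a)
    (hπ : ∀ x, IsOfFinOrder (π x))
    (hπT : ∀ t, IsOfFinOrder t → π t = t) (hN0 : N ≠ 0) (hN : ∀ t : Rˣ, IsOfFinOrder t → t ^ N = 1)
    (hT : ∀ t : Rˣ, IsOfFinOrder t → scalar (Fin n) t ∈ j.range) (B : Addition H)
    (hB : ∀ z, z ∈ B.carrier ↔ ∃ a : Rˣ, j z = scalar (Fin n) a ∧ π a = 1) :
    GroupElemEquiv B.carrier π.ker := by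
  obtain ⟨θ, hθ, hθj⟩ := exists_centerScalar hn j hj.injective hc
  let e : π.ker → GL (Fin n) R := fun r => scalar (Fin n) ((r : Rˣ) ^ N)
  have he : Function.Injective e := fun r s hrs =>
    pow_injective_ker_retraction hπT hN0 (scalar_injective hn hrs)
  let k : B.carrier →* π.ker := (θ.comp (Subgroup.subtype _)).codRestrict π.ker fun b => by
    obtain ⟨a, ha, ha'⟩ := (hB b).1 b.2
    have : θ b = a := scalar_injective hn ((hθj b).symm.trans ha)
    rw [MonoidHom.comp_apply, Subgroup.subtype_apply, this]
    exact ha'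
  have hcent : ∀ {g : GL (Fin n) R}, (∀ h, Commute g h) → ∃ a, g = GeneralLinearGroup.scalar (Fin n) a := fun hg =>
    exists_scalar_of_commute_transv hn fun hik => hg _
  have hj' := hj
  obtain ⟨f, hf⟩ := hj
  refine GroupElementary.groupElemEquiv (j := k)
    (GroupElementary.of_interpretation f (e := e) he ?_ ?_ k ?_ ?_ ?_)
  · refine (DefinableOver.exists_elem (P := fun (w : Unit → GL (Fin n) R) y =>
      (∀ g, Commute y g) ∧ y ^ N = w ()) (.and (by rw [hf]; exact groupDefinable_central _)
        (.eq (GroupTerm.pow (TermOver.var _) N) (TermOver.var _)))).congr fun w => ?_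
    constructor
    · rintro ⟨y, hy, hyw⟩
      obtain ⟨a, rfl⟩ := hcent hy
      obtain ⟨r, hr⟩ := exists_ker_retraction_pow_eq hπ hπT hN a
      refine ⟨r, ?_⟩
      rw [← hyw, ← map_pow, ← hr]
    · rintro ⟨r, hr⟩
      exact ⟨scalar (Fin n) r, fun g => scalar_commute _ _, by rw [← hr, ← map_pow]⟩
  · refine (DefinableOver.eq (GroupTerm.mul (TermOver.var (Sum.inl (0 : Fin 2)))
      (TermOver.var (Sum.inl 1))) (TermOver.var (Sum.inr ()))).congr fun s => ?_
    rw [← he.eq_iff]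
    simp only [e, Subgroup.coe_mul, mul_pow, map_mul]
  · exact fun a b hab => Subtype.ext (hθ (congrArg Subtype.val hab))
  · intro b
    refine ⟨((b : Subgroup.center H) : H) ^ N, ?_⟩
    rw [hf, map_pow, hθj, ← map_pow]
    rfl
  · rintro s ⟨x, hx⟩
    rw [hf] at hx
    obtain ⟨m, hm, hms⟩ := hj'.exists_elem
      (P := fun y => (∀ g, Commute y g) ∧ y ^ N = e s)
      (.and (groupDefinable_central _) (.eq (GroupTerm.pow (TermOver.var _) N)
        (GroupTerm.of_mem_range ⟨x, hx⟩)))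
      ⟨scalar (Fin n) s, fun g => scalar_commute _ _, (map_pow _ _ _).symm⟩
    obtain ⟨a, ha⟩ := hcent hm
    have h1 : a ^ N = (s : Rˣ) ^ N := scalar_injective hn (by
      rw [map_pow, ← ha]
      exact hms)
    obtain ⟨t, ht⟩ := hT ((s : Rˣ) * a⁻¹) (isOfFinOrder_iff_pow_eq_one.2
      ⟨N, Nat.pos_of_ne_zero hN0, by rw [mul_pow, inv_pow, h1, mul_inv_cancel]⟩)
    have h2 : j (t * m) = scalar (Fin n) s := by
      rw [map_mul, ht, ha, ← map_mul, inv_mul_cancel_right]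
    have h3 : t * m ∈ Subgroup.center H := by
      rw [Subgroup.mem_center_iff]
      intro y
      apply hj'.injective
      rw [map_mul, map_mul j (t * m), h2, GeneralLinearGroup.scalar_commute]
    let z : Subgroup.center H := ⟨t * m, h3⟩
    have h4 : z ∈ B.carrier := (hB z).2 ⟨s, h2, s.2⟩
    exact ⟨⟨z, h4⟩, Subtype.ext (scalar_injective hn ((hθj z).symm.trans h2))⟩

end Complements

/-! ### Conclusion: the deformation and the elementary equivalences -/

theorem mainTheorem5 {n : ℕ} (hn : 3 ≤ n)
    (F : Type u) [Field F] [Infinite F] (hchar : ringChar F ≠ 2) (hF : IsNFT F)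
    (H : Type v) [Group H] (hH : GroupElemEquiv H (GL (Fin n) F)) :
    ∃ (L : Type v) (_ : Field L) (A : TorsionComplement Lˣ) (K₀ : Addition (GL (Fin n) L))
      (B : Addition H) (h : SymmCocycle (A.ModPow n) B.carrier)
      (φ : H ≃* AbelianDeformation A K₀ B.carrier h),
      FieldElemEquiv L F ∧ IsNFT L ∧
      GroupElemEquiv B.carrier (Fˣ ⧸ CommGroup.torsion Fˣ) ∧
      GroupElemEquiv B.carrier A.carrier ∧
      ∀ b : B.carrier, φ ((b : Subgroup.center H) : H) = AbelianDeformation.inl b := by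
  have hn0 : n ≠ 0 := by omega
  obtain ⟨R, _, ι₀, j₀, hι₀, hj₀⟩ := exists_groupElementary_GL hH
  have : Infinite R := Infinite.of_injective ι₀ ι₀.injective
  have h2 : (2 : R) ≠ 0 := by
    rw [← map_ofNat ι₀ 2, map_ne_zero]
    exact Ring.two_ne_zero hchar
  obtain ⟨α, hj⟩ := exists_isStandard hn h2 hj₀
  obtain ⟨L, _, ι, hι, hmem⟩ := hj.exists_coefficientField hn
  have hC : IsCoefficientMap (α.toMonoidHom.comp j₀) ι := ⟨hj, hmem⟩
  obtain ⟨N, hN0, hN, w, hw, hw1⟩ := hι₀.exists_torsion_exponent hF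
  have hTF : ∀ t : Rˣ, IsOfFinOrder t → t ∈ (Units.map ι₀.toMonoidHom).range := fun t ht =>
    hι₀.mem_range_of_pow_eq_one hN0 hw hw1 (hN t ht)
  have hTL : ∀ t : Rˣ, IsOfFinOrder t → t ∈ (Units.map ι.toMonoidHom).range := fun t ht =>
    hι.mem_range_of_pow_eq_one hN0 hw hw1 (hN t ht)
  have hTH : ∀ t : Rˣ, IsOfFinOrder t →
      Matrix.GeneralLinearGroup.scalar (Fin n) t ∈ (α.toMonoidHom.comp j₀).range := fun t ht =>
    hj.elementary.scalar_mem_range_of_pow_eq_one hn0 hN0 hw hw1 (hN t ht)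
  have : Finite (CommGroup.torsion Rˣ) := finite_torsion_units hN0 hN
  obtain ⟨π, hπ, hπT⟩ := exists_retraction_torsion Rˣ
  have hc : ∀ z ∈ Subgroup.center H, ∃ a, α.toMonoidHom.comp j₀ z =
      Matrix.GeneralLinearGroup.scalar (Fin n) a := fun z hz =>
    hj.exists_scalar_of_mem_center hn0 hz
  obtain ⟨A, K₀, B, h, φ, hA, hB, hφ⟩ := exists_mulEquiv_abelianDeformation hn0 ι
    (α.toMonoidHom.comp j₀) hj.elementary.injective π hπ hπT hc hC.exists_eq_scalar_mul
    hC.exists_scalar_mul_map_mem (fun g hg => hC.map_mem_of_isOfFinOrder_det hn hTH hg)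
    fun t ht => ⟨hTH t ht, hTL t ht⟩
  have hBR := hj.elementary.groupElemEquiv_ker hn0 hc hπ hπT hN0 hN hTH B hB
  refine ⟨L, inferInstance, A, K₀, B, h, φ, hι.fieldElemEquiv.trans hι₀.fieldElemEquiv.symm, ?_,
    ?_, ?_, hφ⟩
  · refine finite_torsion_units hN0 fun x hx => ?_
    have hinj : Function.Injective (Units.map ι.toMonoidHom) := Units.map_injective ι.injective
    apply hinj
    rw [map_pow, map_one]
    exact hN _ ((Units.map ι.toMonoidHom).isOfFinOrder hx)
  -- The same retraction cuts out a complement of the torsion in `Fˣ`, which is isomorphic to the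
  -- quotient and elementarily equivalent to `ker π`.
  · let A' := TorsionComplement.ofRetraction (Units.map ι₀.toMonoidHom)
      (Units.map_injective ι₀.injective) hTF π hπ hπT
    exact (hBR.trans (hι₀.groupElemEquiv_ker hπ hπT hN0 hN hTF).symm).trans
      (GroupElemEquiv.of_mulEquiv (MulEquiv.ofBijective _ A'.bijective_mk))
  · rw [hA]
    exact hBR.trans (hι.groupElemEquiv_ker hπ hπT hN0 hN hTL).symm
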